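/- Let $a:[0,1]\to[0,\infty)$ be measurable and bounded, and let $\sigma:\mathbb{R}\to\mathbb{R}$ be a scalar damping function: $\sigma$ is locally Lipschitz and odd, $\sigma(0)=0$, $\sigma(s)s>0$ for all $s\neq 0$, and $\sigma$ is differentiable at $0$ with $\sigma'(0)>0$ ($\sigma$ need not be monotone). Consider $$ z_{tt}=z_{xx}-\sigma(a(x)z_t)\ \text{ on } (0,\infty)\times(0,1),\qquad z(t,0)=z(t,1)=0,\qquad z(0,\cdot)=z_0,\ z_t(0,\cdot)=z_1 . $$ For all initial data $(z_0,z_1)\in H_\infty(0,1)=W^{1,\infty}_0(0,1)\times L^\infty(0,1)$ there is a unique global solution $z$ in the class $L^\infty(\mathbb{R}_+;W^{1,\infty}(0,1))\cap W^{1,\infty}(\mathbb{R}_+;L^\infty(0,1))$, that is, among the functions $z$ such that $z$ and its weak derivatives $z_t,z_x$ belong to $L^\infty((0,\infty)\times(0,1))$. Here $z$ stands for its continuous representative on $[0,\infty)\times[0,1]$, the boundary conditions and $z(0,\cdot)=z_0$ hold pointwise, and the equation together with $z_t(0,\cdot)=z_1$ is understood weakly: for all $\varphi\in C_c^\infty(\mathbb{R}\times(0,1))$,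 $$ \int_0^\infty\!\!\int_0^1\bigl(z_t\varphi_t-z_x\varphi_x-\sigma(a z_t)\varphi\bigr)\,dx\,dt+\int_0^1 z_1(x)\varphi(0,x)\,dx=0 . $$ Moreover, for every $t\ge 0$ the derivatives $z_x(t,x)$ and $z_t(t,x)$ (one-sided in time at $t=0$) exist for almost every $x\in(0,1)$, and $$ \operatorname*{ess\,sup}_{x\in(0,1)}\bigl(|z_x(t,x)|+|z_t(t,x)|\bigr)\le 2\max\bigl(\|z_0'\|_{L^\infty(0,1)},\|z_1\|_{L^\infty(0,1)}\bigr). $$ In particular $\max\bigl(\|z_x(t,\cdot)\|_{L^\infty(0,1)},\|z_t(t,\cdot)\|_{L^\infty(0,1)}\bigr)\le 2\max\bigl(\|z_0'\|_{L^\infty(0,1)},\|z_1\|_{L^\infty(0,1)}\bigr)$ for all $t\ge 0$. -/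

import Mathlib

open MeasureTheory Set
open scoped ContDiff

namespace DampedWave

/-- A scalar damping function. -/
structure IsDamping (σ : ℝ → ℝ) : Prop where
  locallyLipschitz : LocallyLipschitz σ
  odd : ∀ s, σ (-s) = -σ s
  map_zero : σ 0 = 0
  mul_self_pos : ∀ s, s ≠ 0 → 0 < σ s * s
  deriv_zero : ∃ C : ℝ, 0 < C ∧ HasDerivAt σ C 0

/-- Lebesgue measure on the space interval `(0,1)`. -/
noncomputable def spaceMeasure : Measure ℝ := volume.restrict (Ioo (0 : ℝ) 1)

/-- The open space-time strip `(0,∞) × (0,1)`; the first coordinate is time. -/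
def strip : Set (ℝ × ℝ) := Ioi (0 : ℝ) ×ˢ Ioo (0 : ℝ) 1

/-- Lebesgue measure on the strip. -/
noncomputable def stripMeasure : Measure (ℝ × ℝ) := volume.restrict strip

/-- The closed strip `[0,∞) × [0,1]`. -/
def closedStrip : Set (ℝ × ℝ) := Ici (0 : ℝ) ×ˢ Icc (0 : ℝ) 1

/-- `g` is the weak (distributional) derivative of `u` on the open set `Ω` in the
direction `e`. -/
def HasWeakDeriv {E : Type*} [NormedAddCommGroup E] [NormedSpace ℝ E] [MeasureSpace E]
    (Ω : Set E) (e : E) (u g : E → ℝ) : Prop :=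
  ∀ φ : E → ℝ, ContDiff ℝ ∞ φ → HasCompactSupport φ → tsupport φ ⊆ Ω →
    ∫ x in Ω, u x * fderiv ℝ φ x e = -∫ x in Ω, g x * φ x

/-- `u ∈ W₀^{1,∞}(0,1)` with weak derivative `u'`.  The element of the Sobolev space is
represented by its continuous representative on `[0,1]`. -/
structure MemW0 (u u' : ℝ → ℝ) : Prop where
  continuousOn : ContinuousOn u (Icc 0 1)
  memLp : MemLp u ⊤ spaceMeasure
  memLp_deriv : MemLp u' ⊤ spaceMeasure
  hasWeakDeriv : HasWeakDeriv (Ioo (0 : ℝ) 1) 1 u u'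
  left : u 0 = 0
  right : u 1 = 0

/-- The weak form of `z_tt = z_xx - σ(a(x) z_t)`, `z_t(0,·) = z₁`, for given space-time
functions `zt` (time derivative) and `zx` (space derivative).  The test functions need not
vanish at `t = 0`, which encodes the initial velocity. -/
def WeakEquation (σ a z₁ : ℝ → ℝ) (zt zx : ℝ × ℝ → ℝ) : Prop :=
  ∀ φ : ℝ × ℝ → ℝ, ContDiff ℝ ∞ φ → HasCompactSupport φ →
    tsupport φ ⊆ (univ : Set ℝ) ×ˢ Ioo (0 : ℝ) 1 →
    ∫ q, (zt q * fderiv ℝ φ q (1, 0) - zx q * fderiv ℝ φ q (0, 1)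
        - σ (a q.2 * zt q) * φ q) ∂stripMeasure
      + ∫ x, z₁ x * φ (0, x) ∂spaceMeasure = 0

/-- `z = z(t,x)` is a global solution of the damped wave equation with Dirichlet boundary
conditions and initial data `(z₀, z₁)`, in the class of functions for which `z`, `z_t` and
`z_x` belong to `L^∞((0,∞) × (0,1))`, that is
`z ∈ L^∞(ℝ₊; W^{1,∞}(0,1)) ∩ W^{1,∞}(ℝ₊; L^∞(0,1))`.  Such a `z` is represented by its
continuous representative on `[0,∞) × [0,1]`. -/
structure IsSolution (σ a z₀ z₁ : ℝ → ℝ) (z : ℝ × ℝ → ℝ) : Prop where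
  continuousOn : ContinuousOn z closedStrip
  left : ∀ t, 0 ≤ t → z (t, 0) = 0
  right : ∀ t, 0 ≤ t → z (t, 1) = 0
  initial : ∀ x ∈ Icc (0 : ℝ) 1, z (0, x) = z₀ x
  memLp : MemLp z ⊤ stripMeasure
  weak : ∃ zt zx : ℝ × ℝ → ℝ,
    MemLp zt ⊤ stripMeasure ∧ MemLp zx ⊤ stripMeasure ∧
    HasWeakDeriv strip (1, 0) z zt ∧ HasWeakDeriv strip (0, 1) z zx ∧
    WeakEquation σ a z₁ zt zx

end DampedWave

open Filter Topology

namespace DampedWave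

/-! Existence. Extend `z` oddly and 2-periodically in `x`. Then `z_x` is even and `z_t` is odd, so
the two Riemann invariants `z_x + z_t` and `z_x - z_t` are reflections of each other, and a single
function `r` describes the solution. With `r(t,c)` the value of `z_x + z_t` on the characteristic `x
+ t = c`, the equation becomes, for each fixed `c`, the ordinary differential equation `∂_t r(t,c) =
-g(c - t, (r(t,c) - r(t,2t - c)) / 2)` with `g(x,v) = σ(a(x) v)`.

The bound is a maximum principle in `L^∞` that needs no monotonicity. If `g` is `κ`-Lipschitz in `v`
and has the sign of `v`, then for `p, q` in `[-M,M]` the number `κ p - g(x,(p - q)/2)` lies between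
`κ p` and `κ (p + q)/2`, hence in `[-κM, κM]`. With the integrating factor `e^{κt}`, the mild map
preserves the ball of radius `M` for all times (`abs_mildMap_le`), so a Lipschitz constant of `σ` on
a bounded set suffices. On this ball the map contracts a weighted norm (`abs_mildMap_sub_le`), and
Picard iteration converges (`exists_mild_solution`). Here `M = ‖z₀'‖ + ‖z₁‖` bounds the initial
invariant, and `|z_x| + |z_t|` is the larger of the moduli of the two invariants.

From `r` the displacement is recovered by integration in space. The source is odd under reflection
in `x = 0`, which gives the formula for the time derivative (`displacement_eq_integral_velocity`),
differentiability at every fixed time for almost every `x` (`ae_hasDerivAt`) and the weak equation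
(`weak_equation`).

Uniqueness. The difference `w` of two solutions satisfies `w_tt = w_xx - f` with zero data and `|f|
≤ K |w_t|`. Since `w_t` is merely bounded, the energy identity is not tested directly with `w_t`.
Instead each sine coefficient of `w` solves a forced oscillator, whose energy estimate has a
constant independent of the frequency (`ae_sq_sineCoeff_le`). Summation by Parseval's identity and
Gronwall's inequality give `w_t = 0`, and then `w = 0` (`IsNullSolution.eqOn_zero`). -/

/-! ### Primitives, integration by parts and the lemma of du Bois-Reymond -/

theorem intervalIntegrable_of_bounded {f : ℝ → ℝ} (hf : Measurable f) {C : ℝ}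
    (hC : ∀ x, |f x| ≤ C) (a b : ℝ) : IntervalIntegrable f volume a b := by
  rw [intervalIntegrable_iff]
  exact Measure.integrableOn_of_bounded (M := C) (by simp) hf.aestronglyMeasurable
    (Eventually.of_forall hC)

/-- Integration by parts for two primitives of integrable functions. -/
theorem integral_mul_add_mul_of_primitive {f g F G : ℝ → ℝ} {a b : ℝ}
    (hf : IntervalIntegrable f volume a b) (hg : IntervalIntegrable g volume a b)
    (hF : ∀ t ∈ uIcc a b, F t = F a + ∫ s in a..t, f s)
    (hG : ∀ t ∈ uIcc a b, G t = G a + ∫ s in a..t, g s) :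
    ∫ t in a..b, (f t * G t + F t * g t) = F b * G b - F a * G a := by
  have key : ∀ {f F : ℝ → ℝ}, IntervalIntegrable f volume a b →
      (∀ t ∈ uIcc a b, F t = F a + ∫ s in a..t, f s) →
      AbsolutelyContinuousOnInterval (fun t => ∫ s in a..t, f s) a b ∧
      ∀ᵐ t, t ∈ uIcc a b → deriv (fun t => F a + ∫ s in a..t, f s) t = f t := by
    intro f F hf hF
    refine ⟨hf.absolutelyContinuousOnInterval_intervalIntegral (by simp), ?_⟩
    filter_upwards [hf.ae_hasDerivAt_integral] with t ht h
    exact ((ht h a (by simp)).const_add _).deriv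
  have cst : ∀ c : ℝ, AbsolutelyContinuousOnInterval (fun _ : ℝ => c) a b := fun c =>
    ((LipschitzWith.const c).lipschitzOnWith (s := uIcc a b)).absolutelyContinuousOnInterval
  obtain ⟨hF1, hF2⟩ := key hf hF
  obtain ⟨hG1, hG2⟩ := key hg hG
  have := AbsolutelyContinuousOnInterval.integral_deriv_mul_eq_sub
    ((cst (F a)).fun_add hF1) ((cst (G a)).fun_add hG1)
  rw [← hF b (by simp), ← hG b (by simp)] at this
  simp only [intervalIntegral.integral_same, add_zero] at this
  rw [← this]
  apply intervalIntegral.integral_congr_ae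
  filter_upwards [hF2, hG2] with t h1 h2 h3
  have h4 := uIoc_subset_uIcc h3
  rw [h1 h4, h2 h4, ← hF t h4, ← hG t h4]

/-- Integration by parts for a primitive and a `C¹` function. -/
theorem integral_mul_add_mul_deriv {f F φ : ℝ → ℝ} {a b : ℝ}
    (hf : IntervalIntegrable f volume a b)
    (hF : ∀ t ∈ uIcc a b, F t = F a + ∫ s in a..t, f s) (hφ : ContDiff ℝ 1 φ) :
    ∫ t in a..b, (f t * φ t + F t * deriv φ t) = F b * φ b - F a * φ a := by
  have hc : Continuous (deriv φ) := hφ.continuous_deriv le_rfl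
  refine integral_mul_add_mul_of_primitive hf (hc.intervalIntegrable _ _) hF fun t _ => ?_
  rw [intervalIntegral.integral_deriv_eq_sub (fun x _ => hφ.differentiable one_ne_zero x)
    (hc.intervalIntegrable _ _)]
  ring

theorem integral_mul_deriv_of_primitive {f F φ : ℝ → ℝ} {a b : ℝ}
    (hf : IntervalIntegrable f volume a b)
    (hF : ∀ t ∈ uIcc a b, F t = F a + ∫ s in a..t, f s) (hφ : ContDiff ℝ 1 φ) :
    ∫ t in a..b, F t * deriv φ t = F b * φ b - F a * φ a - ∫ t in a..b, f t * φ t := by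
  have hc : Continuous (deriv φ) := hφ.continuous_deriv le_rfl
  have hFc : ContinuousOn F (uIcc a b) := by
    refine ContinuousOn.congr ?_ hF
    exact continuousOn_const.add (intervalIntegral.continuousOn_primitive_interval'
      hf (by simp))
  rw [← integral_mul_add_mul_deriv hf hF hφ, intervalIntegral.integral_add]
  · ring
  · exact hf.mul_continuousOn hφ.continuous.continuousOn
  · exact (hFc.mul hc.continuousOn).intervalIntegrable

theorem hasDerivAt_smooth_primitive {f : ℝ → ℝ} (hf : ContDiff ℝ ∞ f) (a x : ℝ) :
    HasDerivAt (fun x => ∫ t in a..x, f t) (f x) x :=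
  intervalIntegral.integral_hasDerivAt_right (hf.continuous.intervalIntegrable _ _)
    hf.continuous.aestronglyMeasurable.stronglyMeasurableAtFilter hf.continuous.continuousAt

theorem contDiff_smooth_primitive {f : ℝ → ℝ} (hf : ContDiff ℝ ∞ f) (a : ℝ) :
    ContDiff ℝ ∞ (fun x => ∫ t in a..x, f t) := by
  rw [contDiff_infty_iff_deriv]
  refine ⟨fun x => (hasDerivAt_smooth_primitive hf a x).differentiableAt, ?_⟩
  rwa [show deriv (fun x => ∫ t in a..x, f t) = f from
    funext fun x => (hasDerivAt_smooth_primitive hf a x).deriv]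

theorem exists_Icc_of_compact_subset_Ioo {K : Set ℝ} {a b : ℝ} (hab : a < b) (hK : IsCompact K)
    (hKs : K ⊆ Ioo a b) : ∃ a' b', a < a' ∧ a' < b' ∧ b' < b ∧ K ⊆ Icc a' b' := by
  rcases K.eq_empty_or_nonempty with rfl | hne
  · exact ⟨(2 * a + b) / 3, (a + 2 * b) / 3, by linarith, by linarith, by linarith, by simp⟩
  · have h1 := hKs (hK.sInf_mem hne)
    have h2 := hKs (hK.sSup_mem hne)
    have h3 : sInf K ≤ sSup K := csInf_le hK.bddBelow (hK.sSup_mem hne)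
    refine ⟨(a + sInf K) / 2, (sSup K + b) / 2, ?_, ?_, ?_, fun x hx => ⟨?_, ?_⟩⟩
    · linarith [h1.1]
    · linarith [h1.1, h2.2]
    · linarith [h2.2]
    · linarith [h1.1, csInf_le hK.bddBelow hx]
    · linarith [h2.2, le_csSup hK.bddAbove hx]

/-- A smooth function compactly supported in `(a,b)` with integral zero has a primitive which
is compactly supported in `(a,b)`. -/
theorem exists_primitive_of_integral_eq_zero {χ : ℝ → ℝ} {a b : ℝ} (hab : a < b)
    (h1 : ContDiff ℝ ∞ χ) (h2 : HasCompactSupport χ) (h3 : tsupport χ ⊆ Ioo a b)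
    (h0 : ∫ x in a..b, χ x = 0) :
    ∃ η : ℝ → ℝ, ContDiff ℝ ∞ η ∧ HasCompactSupport η ∧ tsupport η ⊆ Ioo a b ∧ deriv η = χ := by
  obtain ⟨a', b', ha, hab', hb, hK⟩ := exists_Icc_of_compact_subset_Ioo hab h2 h3
  have hz : ∀ x, x ∉ Icc a' b' → χ x = 0 := fun x hx =>
    image_eq_zero_of_notMem_tsupport fun h => hx (hK h)
  have hi : ∀ c d, IntervalIntegrable χ volume c d := fun c d =>
    h1.continuous.intervalIntegrable _ _
  have hsub : Function.support (fun x => ∫ t in a..x, χ t) ⊆ Icc a' b' := by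
    intro x hx
    by_contra hxn
    apply hx
    rw [mem_Icc, not_and_or, not_le, not_le] at hxn
    rcases hxn with hxa | hxb
    · refine intervalIntegral.integral_zero_ae (Eventually.of_forall fun y hy => hz y fun hy' => ?_)
      rcases le_total a x with h | h
      · rw [uIoc_of_le h] at hy; linarith [hy.2, hy'.1]
      · rw [uIoc_of_ge h] at hy; linarith [hy.2, hy'.1]
    · change ∫ t in a..x, χ t = 0
      rw [← intervalIntegral.integral_add_adjacent_intervals (hi a b) (hi b x), h0, zero_add]
      refine intervalIntegral.integral_zero_ae (Eventually.of_forall fun y hy => hz y fun hy' => ?_)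
      rcases le_total b x with h | h
      · rw [uIoc_of_le h] at hy; linarith [hy.1, hy'.2]
      · rw [uIoc_of_ge h] at hy; linarith [hy.1, hy'.2]
  have hts : tsupport (fun x => ∫ t in a..x, χ t) ⊆ Icc a' b' :=
    closure_minimal hsub isClosed_Icc
  refine ⟨fun x => ∫ t in a..x, χ t, contDiff_smooth_primitive h1 a,
    HasCompactSupport.of_support_subset_isCompact isCompact_Icc hsub,
    hts.trans (Icc_subset_Ioo ha hb), funext fun x => (hasDerivAt_smooth_primitive h1 a x).deriv⟩

/-- The lemma of du Bois-Reymond: a function with an integrable weak derivative is a primitive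
of it. -/
theorem HasWeakDeriv.ae_eq_primitive {W V : ℝ → ℝ} {a b : ℝ} (hab : a < b)
    (hW : IntegrableOn W (Ioo a b)) (hV : IntegrableOn V (Ioo a b))
    (h : HasWeakDeriv (Ioo a b) 1 W V) :
    ∃ C, ∀ᵐ x, x ∈ Ioo a b → W x = C + ∫ t in a..x, V t := by
  have hVi : IntervalIntegrable V volume a b := by
    rwa [intervalIntegrable_iff_integrableOn_Ioo_of_le hab.le]
  set P : ℝ → ℝ := fun x => ∫ t in a..x, V t with hP
  have hPc : ContinuousOn P (Icc a b) := by
    have := intervalIntegral.continuousOn_primitive_interval' hVi (b₁ := a) (b₂ := b)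
      (a := a) (by simp)
    rwa [uIcc_of_le hab.le] at this
  have hPi : IntegrableOn P (Ioo a b) :=
    (hPc.integrableOn_Icc).mono_set Ioo_subset_Icc_self
  set Q : ℝ → ℝ := fun x => W x - P x with hQ
  have hQi : IntegrableOn Q (Ioo a b) := hW.sub hPi
  have hmul : ∀ {f g : ℝ → ℝ}, IntegrableOn f (Ioo a b) → ContDiff ℝ ∞ g →
      HasCompactSupport g → IntegrableOn (fun x => f x * g x) (Ioo a b) := by
    intro f g hf hg hgc
    obtain ⟨C, hC⟩ := hgc.exists_bound_of_continuous hg.continuous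
    exact hf.mul_bdd (c := C) hg.continuous.aestronglyMeasurable (Eventually.of_forall hC)
  have hQη : ∀ η : ℝ → ℝ, ContDiff ℝ ∞ η → HasCompactSupport η → tsupport η ⊆ Ioo a b →
      ∫ x in Ioo a b, Q x * deriv η x = 0 := by
    intro η h1 h2 h3
    have hw := h η h1 h2 h3
    simp only [fderiv_apply_one_eq_deriv] at hw
    have hd : ContDiff ℝ ∞ (deriv η) := (contDiff_infty_iff_deriv.1 h1).2
    have hib := integral_mul_deriv_of_primitive (F := P) (φ := η) hVi
      (fun t _ => by simp [hP]) (h1.of_le (by simp))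
    have ha : η a = 0 := image_eq_zero_of_notMem_tsupport fun h => lt_irrefl _ (h3 h).1
    have hb : η b = 0 := image_eq_zero_of_notMem_tsupport fun h => lt_irrefl _ (h3 h).2
    rw [ha, hb, intervalIntegral.integral_of_le hab.le, intervalIntegral.integral_of_le hab.le,
      integral_Ioc_eq_integral_Ioo, integral_Ioc_eq_integral_Ioo] at hib
    have : ∀ x, Q x * deriv η x = W x * deriv η x - P x * deriv η x := fun x => by
      simp only [hQ]; ring
    simp only [this]
    rw [integral_sub (hmul hW hd h2.deriv) (hmul hPi hd h2.deriv), hw, hib]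
    ring
  -- A fixed bump of mass one. Subtracting `m * η₀` from a test function of mass `m` leaves mass
  -- zero, hence the derivative of a test function, against which `Q` integrates to zero.
  obtain ⟨η₀, k1, k2, k3, k4⟩ : ∃ η₀ : ℝ → ℝ, ContDiff ℝ ∞ η₀ ∧ HasCompactSupport η₀ ∧
      tsupport η₀ ⊆ Ioo a b ∧ ∫ x in a..b, η₀ x = 1 := by
    let B : ContDiffBump ((a + b) / 2) := ⟨(b - a) / 8, (b - a) / 4, by linarith, by linarith⟩
    have hs : tsupport (B.normed volume) ⊆ Ioo a b := by
      rw [B.tsupport_normed_eq, Real.closedBall_eq_Icc]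
      apply Icc_subset_Ioo <;> simp only [B] <;> linarith
    refine ⟨B.normed volume, B.contDiff_normed, B.hasCompactSupport_normed, hs, ?_⟩
    rw [intervalIntegral.integral_eq_integral_of_support_subset, B.integral_normed]
    exact (subset_tsupport _).trans (hs.trans Ioo_subset_Ioc_self)
  set C := ∫ x in Ioo a b, Q x * η₀ x with hC
  have hfin : ∀ᵐ x, x ∈ Ioo a b → Q x - C = 0 := by
    refine IsOpen.ae_eq_zero_of_integral_contDiff_smul_eq_zero isOpen_Ioo ?_ ?_
    · exact (hQi.sub (integrableOn_const (by simp))).locallyIntegrableOn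
    intro χ h1 h2 h3
    set m := ∫ x in a..b, χ x with hm
    have hcd : ContDiff ℝ ∞ (fun x => χ x - m * η₀ x) := h1.sub (contDiff_const.mul k1)
    have hs1 : HasCompactSupport (fun x => m * η₀ x) := k2.mul_left
    have hs2 : tsupport (fun x => χ x - m * η₀ x) ⊆ Ioo a b := by
      refine (tsupport_sub χ _).trans (union_subset h3 ?_)
      exact (closure_mono (Function.support_mul_subset_right _ _)).trans k3
    have hint : ∫ x in a..b, (χ x - m * η₀ x) = 0 := by
      rw [intervalIntegral.integral_sub (h1.continuous.intervalIntegrable _ _)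
        ((k1.continuous.intervalIntegrable _ _).const_mul m),
        intervalIntegral.integral_const_mul, k4]
      simp [hm]
    obtain ⟨η, e1, e2, e3, e4⟩ := exists_primitive_of_integral_eq_zero hab hcd (h2.sub hs1) hs2 hint
    have := hQη η e1 e2 e3
    rw [e4] at this
    have e5 : ∀ x, Q x * (χ x - m * η₀ x) = Q x * χ x - m * (Q x * η₀ x) := fun x => by ring
    simp only [e5] at this
    rw [integral_sub (hmul hQi h1 h2) ((hmul hQi k1 k2).const_mul m), integral_const_mul,
      ← hC] at this
    have e6 : ∫ x, χ x • (Q x - C) = ∫ x in Ioo a b, χ x • (Q x - C) := by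
      rw [setIntegral_eq_integral_of_forall_compl_eq_zero]
      intro x hx
      rw [image_eq_zero_of_notMem_tsupport fun h => hx (h3 h), zero_smul]
    have e7 : ∀ x, χ x • (Q x - C) = Q x * χ x - C * χ x := fun x => by
      simp only [smul_eq_mul]; ring
    rw [e6]
    simp only [e7]
    rw [integral_sub (hmul hQi h1 h2) ((h1.continuous.integrableOn_Icc.mono_set
      Ioo_subset_Icc_self).const_mul C), integral_const_mul, ← integral_Ioc_eq_integral_Ioo (f := χ),
      ← intervalIntegral.integral_of_le hab.le, ← hm]
    linarith
  refine ⟨C, ?_⟩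
  filter_upwards [hfin] with x hx hx'
  have := hx hx'
  simp only [hQ, hP] at this
  linarith

/-- Continuous functions that agree almost everywhere on an interval agree everywhere on its
closure; the value at `a` then fixes the constant. -/
theorem HasWeakDeriv.eq_primitive {W V : ℝ → ℝ} {a b : ℝ} (hab : a < b)
    (hW : ContinuousOn W (Icc a b)) (hV : IntegrableOn V (Ioo a b))
    (h : HasWeakDeriv (Ioo a b) 1 W V) :
    ∀ x ∈ Icc a b, W x = W a + ∫ t in a..x, V t := by
  obtain ⟨C, hC⟩ := h.ae_eq_primitive hab
    (hW.integrableOn_Icc.mono_set Ioo_subset_Icc_self) hV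
  have hVi : IntervalIntegrable V volume a b := by
    rwa [intervalIntegrable_iff_integrableOn_Ioo_of_le hab.le]
  have hPc : ContinuousOn (fun x => ∫ t in a..x, V t) (Icc a b) := by
    have := intervalIntegral.continuousOn_primitive_interval' hVi (b₁ := a) (b₂ := b)
      (a := a) (by simp)
    rwa [uIcc_of_le hab.le] at this
  have heq : EqOn W (fun x => C + ∫ t in a..x, V t) (Icc a b) := by
    refine Measure.eqOn_Icc_of_ae_eq (μ := volume) hab.ne ?_ hW (continuousOn_const.add hPc)
    rw [Filter.EventuallyEq, ae_restrict_iff' measurableSet_Icc]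
    have h2 : ∀ᵐ x : ℝ, x ≠ a := by simp [ae_iff, measure_singleton]
    have h3 : ∀ᵐ x : ℝ, x ≠ b := by simp [ae_iff, measure_singleton]
    filter_upwards [hC, h2, h3] with x hx hxa hxb hx'
    exact hx ⟨lt_of_le_of_ne hx'.1 hxa.symm, lt_of_le_of_ne hx'.2 hxb⟩
  have ha : W a = C := by simpa using heq (left_mem_Icc.2 hab.le)
  intro x hx
  rw [ha]
  exact heq hx

/-- The variable endpoint is moved into an indicator function on the product, so that only the
integrand depends on the parameter. This keeps the Picard iterates jointly measurable. -/
theorem measurable_setIntegral_Ioc {F : ℝ → ℝ → ℝ} (hF : Measurable (Function.uncurry F)) :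
    Measurable fun p : ℝ × ℝ => ∫ s in Ioc 0 p.1, F s p.2 := by
  have h : ∀ p : ℝ × ℝ, ∫ s in Ioc 0 p.1, F s p.2
      = ∫ s, {q : (ℝ × ℝ) × ℝ | 0 < q.2 ∧ q.2 ≤ q.1.1}.indicator
          (fun q => F q.2 q.1.2) (p, s) := by
    intro p
    rw [← integral_indicator measurableSet_Ioc]
    rfl
  simp only [h]
  refine (StronglyMeasurable.integral_prod_right' (f := _) ?_).measurable
  refine (Measurable.indicator ?_ ?_).stronglyMeasurable
  · exact hF.comp (measurable_snd.prodMk (measurable_snd.comp measurable_fst))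
  · exact (measurableSet_lt measurable_const measurable_snd).inter
      (measurableSet_le measurable_snd (measurable_fst.comp measurable_fst))

/-! ### The reflected damping and its maximum principle -/

/-- A damping nonlinearity `g(x,v)` on the line: even and 2-periodic in `x`, odd, dissipative and
Lipschitz in `v` on `[-M,M]`. -/
structure IsPeriodicDamping (g : ℝ → ℝ → ℝ) (M κ : ℝ) : Prop where
  measurable : Measurable (Function.uncurry g)
  lipschitz : ∀ x v w, |v| ≤ M → |w| ≤ M → |g x v - g x w| ≤ κ * |v - w|
  nonneg : ∀ x v, |v| ≤ M → 0 ≤ v → 0 ≤ g x v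
  odd : ∀ x v, g x (-v) = -g x v
  even : ∀ x v, g (-x) v = g x v
  periodic : ∀ x v, g (x + 2) v = g x v

namespace IsPeriodicDamping

variable {g : ℝ → ℝ → ℝ} {M κ : ℝ}

theorem map_zero (hg : IsPeriodicDamping g M κ) (x : ℝ) : g x 0 = 0 := by
  have := hg.odd x 0
  rw [neg_zero] at this
  linarith

theorem le_mul (hg : IsPeriodicDamping g M κ) {x v : ℝ} (hv : |v| ≤ M) (h0 : 0 ≤ v) :
    g x v ≤ κ * v := by
  have := hg.lipschitz x v 0 hv (by simpa using (abs_nonneg v).trans hv)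
  rw [hg.map_zero, sub_zero, sub_zero, abs_of_nonneg h0] at this
  exact (le_abs_self _).trans this

theorem abs_half_sub_le {a b : ℝ} (ha : |a| ≤ M) (hb : |b| ≤ M) : |(a - b) / 2| ≤ M := by
  rw [abs_le] at *
  constructor <;> linarith [ha.1, ha.2, hb.1, hb.2]

/-- The damping relaxes each of the two Riemann invariants towards the other one. -/
theorem abs_relax_le (hg : IsPeriodicDamping g M κ) (hκ : 0 ≤ κ) {x a b : ℝ} (ha : |a| ≤ M)
    (hb : |b| ≤ M) : |κ * a - g x ((a - b) / 2)| ≤ κ * M := by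
  have hab := abs_half_sub_le ha hb
  rw [abs_le] at ha hb
  -- For `v = (a - b) / 2 ≥ 0`, the bounds `0 ≤ g ≤ κ v` place `κ a - g` between `κ (a + b) / 2` and
  -- `κ a`. For `v ≤ 0` oddness gives the mirror image.
  rcases le_total 0 ((a - b) / 2) with h | h
  · have h1 := hg.nonneg x _ hab h
    have h2 := hg.le_mul (x := x) hab h
    rw [abs_le]
    constructor <;> nlinarith
  · have h' : 0 ≤ -((a - b) / 2) := by linarith
    have h1 := hg.nonneg x _ (by rwa [abs_neg]) h'
    have h2 := hg.le_mul (x := x) (by rwa [abs_neg]) h'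
    rw [hg.odd] at h1 h2
    rw [abs_le]
    constructor <;> nlinarith

end IsPeriodicDamping

/-! ### Picard iteration along characteristics -/

/-- The relaxation term in the mild formulation of the equation along characteristics. -/
noncomputable def relax (g : ℝ → ℝ → ℝ) (κ : ℝ) (r : ℝ → ℝ → ℝ) (s c : ℝ) : ℝ :=
  κ * r s c - g (c - s) ((r s c - r s (2 * s - c)) / 2)

/-- The fixed point map of the mild formulation of the equation along characteristics. -/
noncomputable def mildMap (g : ℝ → ℝ → ℝ) (κ : ℝ) (r₀ : ℝ → ℝ) (r : ℝ → ℝ → ℝ) (t c : ℝ) : ℝ :=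
  Real.exp (-κ * t) * (r₀ c + ∫ s in Ioc 0 t, Real.exp (κ * s) * relax g κ r s c)

/-- The Picard iterates for the equation along characteristics. -/
noncomputable def picard (g : ℝ → ℝ → ℝ) (κ : ℝ) (r₀ : ℝ → ℝ) : ℕ → ℝ → ℝ → ℝ
  | 0 => fun _ c => r₀ c
  | n + 1 => mildMap g κ r₀ (picard g κ r₀ n)

section Picard

variable {g : ℝ → ℝ → ℝ} {M κ : ℝ} {r₀ : ℝ → ℝ}

theorem measurable_relax (hg : IsPeriodicDamping g M κ) {r : ℝ → ℝ → ℝ}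
    (hr : Measurable (Function.uncurry r)) : Measurable (Function.uncurry (relax g κ r)) := by
  have h1 : Measurable fun p : ℝ × ℝ => r p.1 p.2 := hr
  have h2 : Measurable fun p : ℝ × ℝ => r p.1 (2 * p.1 - p.2) :=
    hr.comp (measurable_fst.prodMk ((measurable_fst.const_mul 2).sub measurable_snd))
  have h3 : Measurable fun p : ℝ × ℝ => g (p.2 - p.1) ((r p.1 p.2 - r p.1 (2 * p.1 - p.2)) / 2) :=
    hg.measurable.comp ((measurable_snd.sub measurable_fst).prodMk ((h1.sub h2).div_const 2))
  exact (h1.const_mul κ).sub h3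

theorem measurable_mildMap (hg : IsPeriodicDamping g M κ) (hr₀ : Measurable r₀) {r : ℝ → ℝ → ℝ}
    (hr : Measurable (Function.uncurry r)) : Measurable (Function.uncurry (mildMap g κ r₀ r)) := by
  have h1 : Measurable fun p : ℝ × ℝ => Real.exp (-κ * p.1) := by fun_prop
  have h2 : Measurable fun p : ℝ × ℝ => r₀ p.2 := hr₀.comp measurable_snd
  have h3 : Measurable (Function.uncurry fun s c => Real.exp (κ * s) * relax g κ r s c) := by
    have : Measurable fun p : ℝ × ℝ => Real.exp (κ * p.1) := by fun_prop
    exact this.mul (measurable_relax hg hr)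
  exact h1.mul (h2.add (measurable_setIntegral_Ioc h3))

theorem abs_relax_le' (hg : IsPeriodicDamping g M κ) (hκ : 0 < κ) {r : ℝ → ℝ → ℝ}
    (hb : ∀ t, 0 ≤ t → ∀ c, |r t c| ≤ M) {s : ℝ} (hs : 0 ≤ s) (c : ℝ) :
    |Real.exp (κ * s) * relax g κ r s c| ≤ κ * M * Real.exp (κ * s) := by
  rw [abs_mul, abs_of_pos (Real.exp_pos _), mul_comm]
  exact mul_le_mul_of_nonneg_right (hg.abs_relax_le hκ.le (hb s hs c) (hb s hs _))
    (Real.exp_pos _).le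

theorem integrableOn_exp_mul_relax (hg : IsPeriodicDamping g M κ) (hκ : 0 < κ) {r : ℝ → ℝ → ℝ}
    (hr : Measurable (Function.uncurry r)) (hb : ∀ t, 0 ≤ t → ∀ c, |r t c| ≤ M) (t c : ℝ) :
    IntegrableOn (fun s => Real.exp (κ * s) * relax g κ r s c) (Ioc 0 t) := by
  have h1 : Continuous fun s => κ * M * Real.exp (κ * s) := by fun_prop
  have h2 : Measurable fun s => Real.exp (κ * s) * relax g κ r s c := by
    have h3 : Measurable fun s => relax g κ r s c :=
      (measurable_relax hg hr).comp (measurable_id.prodMk measurable_const)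
    exact (by fun_prop : Measurable fun s => Real.exp (κ * s)).mul h3
  refine Integrable.mono' (h1.integrableOn_Ioc) h2.aestronglyMeasurable ?_
  rw [ae_restrict_iff' measurableSet_Ioc]
  exact Eventually.of_forall fun s hs => abs_relax_le' hg hκ hb hs.1.le c

theorem setIntegral_exp_mul {κ : ℝ} (hκ : 0 < κ) (C : ℝ) {t : ℝ} (ht : 0 ≤ t) :
    ∫ s in Ioc 0 t, C * Real.exp (κ * s) = C / κ * (Real.exp (κ * t) - 1) := by
  have hd : ∀ s ∈ uIcc 0 t, HasDerivAt (fun s => C / κ * Real.exp (κ * s))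
      (C * Real.exp (κ * s)) s := by
    intro s _
    have := (((hasDerivAt_id s).const_mul κ).exp).const_mul (C / κ)
    convert! this using 1
    simp only [id]
    field_simp
  rw [← intervalIntegral.integral_of_le ht, intervalIntegral.integral_eq_sub_of_hasDerivAt hd
    ((by fun_prop : Continuous fun s => C * Real.exp (κ * s)).intervalIntegrable _ _)]
  simp
  ring

/-- Because `e^{-κt} + ∫₀ᵗ κ e^{-κ(t - s)} ds = 1`, the mild map is an average of `r₀` and of values
of `relax / κ`, all of which lie in `[-M, M]`. Hence the bound does not grow with time. -/
theorem abs_mildMap_le (hg : IsPeriodicDamping g M κ) (hκ : 0 < κ) (hb₀ : ∀ c, |r₀ c| ≤ M)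
    {r : ℝ → ℝ → ℝ} (hb : ∀ t, 0 ≤ t → ∀ c, |r t c| ≤ M) {t : ℝ} (ht : 0 ≤ t) (c : ℝ) :
    |mildMap g κ r₀ r t c| ≤ M := by
  have hcont : Continuous fun s => κ * M * Real.exp (κ * s) := by fun_prop
  have h1 : |∫ s in Ioc 0 t, Real.exp (κ * s) * relax g κ r s c| ≤
      ∫ s in Ioc 0 t, κ * M * Real.exp (κ * s) := by
    rw [← Real.norm_eq_abs]
    refine norm_integral_le_of_norm_le (hcont.integrableOn_Ioc (μ := volume)) ?_
    rw [ae_restrict_iff' measurableSet_Ioc]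
    exact Eventually.of_forall fun s hs => abs_relax_le' hg hκ hb hs.1.le c
  rw [setIntegral_exp_mul hκ _ ht, mul_div_cancel_left₀ _ hκ.ne'] at h1
  have h2 : |r₀ c + ∫ s in Ioc 0 t, Real.exp (κ * s) * relax g κ r s c| ≤ M * Real.exp (κ * t) :=
    (abs_add_le _ _).trans (by linarith [hb₀ c])
  rw [mildMap, abs_mul, abs_of_pos (Real.exp_pos _)]
  calc _ ≤ Real.exp (-κ * t) * (M * Real.exp (κ * t)) :=
        mul_le_mul_of_nonneg_left h2 (Real.exp_pos _).le
    _ = M * (Real.exp (-κ * t) * Real.exp (κ * t)) := by ring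
    _ = M := by rw [← Real.exp_add]; simp

/-- `relax` depends on `r` with Lipschitz constant `2κ` in the uniform norm, and the factor `e^{κs}`
is absorbed by `e^{κt}`. Integrating `2κ e^{4κs}` yields at most `e^{4κt} / 2`: the weight `4κ` is
chosen to make the contraction factor `1/2`. -/
theorem abs_mildMap_sub_le (hg : IsPeriodicDamping g M κ) (hκ : 0 < κ)
    {r q : ℝ → ℝ → ℝ} (hr : Measurable (Function.uncurry r)) (hq : Measurable (Function.uncurry q))
    (hrb : ∀ t, 0 ≤ t → ∀ c, |r t c| ≤ M) (hqb : ∀ t, 0 ≤ t → ∀ c, |q t c| ≤ M) {δ : ℝ}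
    (hδ : 0 ≤ δ)
    (hd : ∀ t, 0 ≤ t → ∀ c, |r t c - q t c| ≤ δ * Real.exp (4 * κ * t)) {t : ℝ} (ht : 0 ≤ t)
    (c : ℝ) :
    |mildMap g κ r₀ r t c - mildMap g κ r₀ q t c| ≤ δ / 2 * Real.exp (4 * κ * t) := by
  have hN : ∀ s, 0 ≤ s → |relax g κ r s c - relax g κ q s c| ≤
      2 * κ * δ * Real.exp (4 * κ * s) := by
    intro s hs
    have e1 := hd s hs c
    have e2 := hd s hs (2 * s - c)
    have e3 := hg.lipschitz (c - s) _ _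
      (IsPeriodicDamping.abs_half_sub_le (hrb s hs c) (hrb s hs (2 * s - c)))
      (IsPeriodicDamping.abs_half_sub_le (hqb s hs c) (hqb s hs (2 * s - c)))
    have e4 : |(r s c - r s (2 * s - c)) / 2 - (q s c - q s (2 * s - c)) / 2| ≤
        δ * Real.exp (4 * κ * s) := by
      rw [abs_le] at e1 e2 ⊢
      constructor <;> linarith [e1.1, e1.2, e2.1, e2.2]
    have e5 := e3.trans (mul_le_mul_of_nonneg_left e4 hκ.le)
    have e6 : relax g κ r s c - relax g κ q s c = κ * (r s c - q s c) -
        (g (c - s) ((r s c - r s (2 * s - c)) / 2) -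
          g (c - s) ((q s c - q s (2 * s - c)) / 2)) := by
      simp only [relax]; ring
    rw [e6]
    refine (abs_sub _ _).trans ?_
    rw [abs_mul, abs_of_pos hκ]
    have := mul_le_mul_of_nonneg_left e1 hκ.le
    linarith
  have hsub : mildMap g κ r₀ r t c - mildMap g κ r₀ q t c = Real.exp (-κ * t) *
      ∫ s in Ioc 0 t, Real.exp (κ * s) * (relax g κ r s c - relax g κ q s c) := by
    simp only [mul_sub]
    rw [integral_sub (integrableOn_exp_mul_relax hg hκ hr hrb t c)
      (integrableOn_exp_mul_relax hg hκ hq hqb t c)]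
    simp only [mildMap]
    ring
  have h1 : |∫ s in Ioc 0 t, Real.exp (κ * s) * (relax g κ r s c - relax g κ q s c)| ≤
      ∫ s in Ioc 0 t, 2 * κ * δ * Real.exp (κ * t) * Real.exp (4 * κ * s) := by
    have hcont : Continuous fun s => 2 * κ * δ * Real.exp (κ * t) * Real.exp (4 * κ * s) := by
      fun_prop
    rw [← Real.norm_eq_abs]
    refine norm_integral_le_of_norm_le (hcont.integrableOn_Ioc (μ := volume)) ?_
    rw [ae_restrict_iff' measurableSet_Ioc]
    refine Eventually.of_forall fun s hs => ?_
    rw [Real.norm_eq_abs, abs_mul, abs_of_pos (Real.exp_pos _)]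
    calc Real.exp (κ * s) * |relax g κ r s c - relax g κ q s c|
        ≤ Real.exp (κ * t) * (2 * κ * δ * Real.exp (4 * κ * s)) := by
          gcongr
          · exact hs.2
          · exact hN s hs.1.le
      _ = _ := by ring
  rw [setIntegral_exp_mul (by positivity) _ ht] at h1
  rw [hsub, abs_mul, abs_of_pos (Real.exp_pos _)]
  calc _ ≤ Real.exp (-κ * t) * (2 * κ * δ * Real.exp (κ * t) / (4 * κ) *
        (Real.exp (4 * κ * t) - 1)) := mul_le_mul_of_nonneg_left h1 (Real.exp_pos _).le
    _ = (Real.exp (-κ * t) * Real.exp (κ * t)) * (δ / 2 * (Real.exp (4 * κ * t) - 1)) := by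
      field_simp
      ring
    _ = δ / 2 * (Real.exp (4 * κ * t) - 1) := by rw [← Real.exp_add]; simp
    _ ≤ _ := by nlinarith

theorem measurable_picard (hg : IsPeriodicDamping g M κ) (hr₀ : Measurable r₀) (n : ℕ) :
    Measurable (Function.uncurry (picard g κ r₀ n)) := by
  induction n with
  | zero => exact hr₀.comp measurable_snd
  | succ n ih => exact measurable_mildMap hg hr₀ ih

theorem abs_picard_le (hg : IsPeriodicDamping g M κ) (hκ : 0 < κ) (hb₀ : ∀ c, |r₀ c| ≤ M) (n : ℕ) :
    ∀ t, 0 ≤ t → ∀ c, |picard g κ r₀ n t c| ≤ M := by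
  induction n with
  | zero => exact fun t _ c => hb₀ c
  | succ n ih => exact fun t ht c => abs_mildMap_le hg hκ hb₀ ih ht c

/-- Shifting `c` by `2` shifts the reflected point `2s - c` by `-2`, so both values of the previous
iterate are unchanged. The period passes to the limit and later yields the boundary condition at `x
= 1`. -/
theorem picard_periodic (hg : IsPeriodicDamping g M κ) (hp : ∀ c, r₀ (c + 2) = r₀ c) (n : ℕ) :
    ∀ t c, picard g κ r₀ n t (c + 2) = picard g κ r₀ n t c := by
  induction n with
  | zero => exact fun t c => hp c
  | succ n ih =>
    intro t c
    have : ∀ s, relax g κ (picard g κ r₀ n) s (c + 2) = relax g κ (picard g κ r₀ n) s c := by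
      intro s
      have e1 := ih s (2 * s - (c + 2))
      rw [show 2 * s - (c + 2) + 2 = 2 * s - c by ring] at e1
      simp only [relax]
      rw [ih, ← e1, show c + 2 - s = c - s + 2 by ring, hg.periodic]
    simp only [picard, mildMap, this, hp]

theorem abs_picard_sub_le (hg : IsPeriodicDamping g M κ) (hκ : 0 < κ) (hM : 0 ≤ M)
    (hr₀ : Measurable r₀) (hb₀ : ∀ c, |r₀ c| ≤ M) (n : ℕ) :
    ∀ t, 0 ≤ t → ∀ c, |picard g κ r₀ (n + 1) t c - picard g κ r₀ n t c| ≤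
      2 * M * (1 / 2) ^ n * Real.exp (4 * κ * t) := by
  induction n with
  | zero =>
    intro t ht c
    have h1 := abs_picard_le hg hκ hb₀ 1 t ht c
    have h2 := abs_picard_le hg hκ hb₀ 0 t ht c
    have h3 : 1 ≤ Real.exp (4 * κ * t) := Real.one_le_exp (by positivity)
    calc _ ≤ _ := abs_sub _ _
      _ ≤ 2 * M * 1 := by simp only [zero_add]; linarith
      _ ≤ _ := by rw [pow_zero, mul_one]; exact le_mul_of_one_le_right (by positivity) h3
  | succ n ih =>
    intro t ht c
    have := abs_mildMap_sub_le (r₀ := r₀) hg hκ (measurable_picard hg hr₀ (n + 1))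
      (measurable_picard hg hr₀ n)
      (abs_picard_le hg hκ hb₀ (n + 1)) (abs_picard_le hg hκ hb₀ n) (by positivity) ih ht c
    refine this.trans (le_of_eq ?_)
    rw [pow_succ]
    ring

/-- Existence for the mild formulation along characteristics. -/
theorem exists_mild_solution (hg : IsPeriodicDamping g M κ) (hκ : 0 < κ) (hM : 0 ≤ M)
    (hr₀ : Measurable r₀) (hb₀ : ∀ c, |r₀ c| ≤ M) (hp : ∀ c, r₀ (c + 2) = r₀ c) :
    ∃ r : ℝ → ℝ → ℝ, Measurable (Function.uncurry r) ∧ (∀ t c, |r t c| ≤ M) ∧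
      (∀ t c, r t (c + 2) = r t c) ∧ (∀ t, t ≤ 0 → ∀ c, r t c = r₀ c) ∧
      ∀ t, 0 ≤ t → ∀ c, r t c = mildMap g κ r₀ r t c := by
  -- With `max t 0` in place of `t` the limit is frozen at `r₀` for negative times, so bounds and
  -- measurability hold on the whole line.
  have hlim : ∀ t c, ∃ l, Tendsto (fun n => picard g κ r₀ n (max t 0) c) atTop (𝓝 l) := by
    intro t c
    refine cauchySeq_tendsto_of_complete (cauchySeq_of_le_geometric (1 / 2)
      (2 * M * Real.exp (4 * κ * max t 0)) (by norm_num) fun n => ?_)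
    rw [dist_comm, Real.dist_eq]
    refine (abs_picard_sub_le hg hκ hM hr₀ hb₀ n _ (le_max_right _ _) c).trans (le_of_eq ?_)
    ring
  choose r hr using hlim
  have hrpos : ∀ t, 0 ≤ t → ∀ c, Tendsto (fun n => picard g κ r₀ n t c) atTop (𝓝 (r t c)) := by
    intro t ht c
    have := hr t c
    rwa [max_eq_left ht] at this
  have hrm : Measurable (Function.uncurry r) := by
    refine measurable_of_tendsto_metrizable (f := fun n (p : ℝ × ℝ) =>
      picard g κ r₀ n (max p.1 0) p.2) (fun n => ?_) ?_
    · exact (measurable_picard hg hr₀ n).comp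
        ((measurable_fst.max measurable_const).prodMk measurable_snd)
    · rw [tendsto_pi_nhds]
      exact fun p => hr p.1 p.2
  have hrb : ∀ t c, |r t c| ≤ M := fun t c =>
    le_of_tendsto (hr t c).abs (Eventually.of_forall fun n =>
      abs_picard_le hg hκ hb₀ n _ (le_max_right _ _) c)
  have hmild : ∀ t, 0 ≤ t → ∀ c, r t c = mildMap g κ r₀ r t c := by
    intro t ht c
    -- The mild equation passes to the limit by dominated convergence, since every iterate stays in
    -- the invariant ball.
    refine tendsto_nhds_unique ((tendsto_add_atTop_iff_nat 1).2 (hrpos t ht c)) ?_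
    refine Tendsto.const_mul _ (Tendsto.const_add _ ?_)
    refine tendsto_integral_of_dominated_convergence (fun s => κ * M * Real.exp (κ * s))
      (fun n => ((integrableOn_exp_mul_relax hg hκ (measurable_picard hg hr₀ n)
        (abs_picard_le hg hκ hb₀ n) t c)).aestronglyMeasurable)
      (by fun_prop : Continuous fun s => κ * M * Real.exp (κ * s)).integrableOn_Ioc
      (fun n => ?_) ?_
    · rw [ae_restrict_iff' measurableSet_Ioc]
      exact Eventually.of_forall fun s hs => abs_relax_le' hg hκ (abs_picard_le hg hκ hb₀ n) hs.1.le c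
    · rw [ae_restrict_iff' measurableSet_Ioc]
      refine Eventually.of_forall fun s hs => Tendsto.const_mul _ ?_
      have e1 := hrpos s hs.1.le c
      have e2 := hrpos s hs.1.le (2 * s - c)
      refine (e1.const_mul κ).sub ?_
      have e3 := (e1.sub e2).div_const 2
      rw [tendsto_iff_dist_tendsto_zero] at e3 ⊢
      refine squeeze_zero (fun _ => dist_nonneg) (fun n => ?_) (by simpa using e3.const_mul κ)
      simp only [Real.dist_eq]
      exact hg.lipschitz _ _ _ (IsPeriodicDamping.abs_half_sub_le
        (abs_picard_le hg hκ hb₀ n s hs.1.le _) (abs_picard_le hg hκ hb₀ n s hs.1.le _))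
        (IsPeriodicDamping.abs_half_sub_le (hrb _ _) (hrb _ _))
  refine ⟨r, hrm, hrb, fun t c => ?_, fun t ht c => ?_, hmild⟩
  · refine tendsto_nhds_unique (hr t (c + 2)) ?_
    simp only [picard_periodic hg hp]
    exact hr t c
  · have h1 := hmild 0 le_rfl c
    have h2 : r t c = r 0 c := tendsto_nhds_unique (hr t c) (by
      rw [max_eq_right ht]
      exact hrpos 0 le_rfl c)
    rw [h2, h1]
    simp [mildMap]

end Picard

/-! ### The Riemann invariant as an integrated evolution along characteristics -/

/-- `r(t,c)` is the Riemann invariant `z_x + z_t` of the (reflected, periodic) damped wave equation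
at time `t` on the characteristic `x + t = c`, and `-G` is its time derivative. -/
structure IsCharSolution (g : ℝ → ℝ → ℝ) (r₀ : ℝ → ℝ) (M S : ℝ) (r G : ℝ → ℝ → ℝ) : Prop where
  measurable : Measurable (Function.uncurry r)
  measurable_source : Measurable (Function.uncurry G)
  abs_le : ∀ t c, |r t c| ≤ M
  abs_source_le : ∀ t c, |G t c| ≤ S
  eq_initial_sub : ∀ t c, r t c = r₀ c - ∫ s in (0 : ℝ)..t, G s c
  source_eq : ∀ s, 0 < s → ∀ c, G s c = g (c - s) ((r s c - r s (2 * s - c)) / 2)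
  source_reflect : ∀ s c, G s (2 * s - c) = -G s c
  periodic : ∀ t c, r t (c + 2) = r t c

/-- The integrating factor is undone: the product rule for `e^{-κt}` times the primitive `F` in the
mild formula leaves exactly `-G`. As `G = κ r - relax` and both terms are at most `κ M` in modulus,
the source is bounded by `2κM`. -/
theorem exists_isCharSolution {g : ℝ → ℝ → ℝ} {M κ : ℝ} {r₀ : ℝ → ℝ}
    (hg : IsPeriodicDamping g M κ) (hκ : 0 < κ) (hM : 0 ≤ M)
    (hr₀ : Measurable r₀) (hb₀ : ∀ c, |r₀ c| ≤ M) (hp : ∀ c, r₀ (c + 2) = r₀ c) :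
    ∃ r G : ℝ → ℝ → ℝ, IsCharSolution g r₀ M (2 * κ * M) r G := by
  obtain ⟨r, hrm, hrb, hrp, hr0, hmild⟩ := exists_mild_solution hg hκ hM hr₀ hb₀ hp
  -- The value zero for `s ≤ 0` matches the frozen `r` there, so the integral identity and the
  -- reflection rule hold at all times.
  set G : ℝ → ℝ → ℝ := fun s c =>
    if 0 < s then κ * r s c - relax g κ r s c else 0 with hG
  have hGpos : ∀ s, 0 < s → ∀ c, G s c = g (c - s) ((r s c - r s (2 * s - c)) / 2) := by
    intro s hs c
    simp only [hG, if_pos hs, relax]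
    ring
  have hGneg : ∀ s, ¬ 0 < s → ∀ c, G s c = 0 := fun s hs c => by simp only [hG, if_neg hs]
  have hGm : Measurable (Function.uncurry G) :=
    Measurable.ite (measurableSet_lt measurable_const measurable_fst)
      ((hrm.const_mul κ).sub (measurable_relax hg hrm)) measurable_const
  refine ⟨r, G, hrm, hGm, hrb, fun s c => ?_, fun t c => ?_, hGpos, fun s c => ?_, hrp⟩
  · by_cases hs : 0 < s
    · have h1 : |κ * r s c - relax g κ r s c| ≤ |κ * r s c| + |relax g κ r s c| := abs_sub _ _
      have h2 : |relax g κ r s c| ≤ κ * M := hg.abs_relax_le hκ.le (hrb _ _) (hrb _ _)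
      have h3 : |κ * r s c| ≤ κ * M := by
        rw [abs_mul, abs_of_pos hκ]
        exact mul_le_mul_of_nonneg_left (hrb s c) hκ.le
      simp only [hG, if_pos hs]
      linarith
    · rw [hGneg s hs, abs_zero]
      positivity
  · rcases le_total t 0 with ht | ht
    · rw [hr0 t ht, intervalIntegral.integral_zero_ae, sub_zero]
      refine Eventually.of_forall fun s hs => hGneg s ?_ c
      rw [uIoc_of_ge ht] at hs
      exact not_lt.2 hs.2
    · set F : ℝ → ℝ := fun t => r₀ c + ∫ s in (0 : ℝ)..t, Real.exp (κ * s) * relax g κ r s c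
      have hφ : ContDiff ℝ 1 fun t => Real.exp (-κ * t) := by fun_prop
      have hF : ∀ s, 0 ≤ s → r s c = Real.exp (-κ * s) * F s := fun s hs => by
        rw [hmild s hs c, mildMap]
        simp only [F, intervalIntegral.integral_of_le hs]
      have hfi : IntervalIntegrable (fun s => Real.exp (κ * s) * relax g κ r s c) volume 0 t := by
        rw [intervalIntegrable_iff_integrableOn_Ioc_of_le ht]
        exact integrableOn_exp_mul_relax hg hκ hrm (fun t _ c => hrb t c) t c
      have key := integral_mul_add_mul_deriv hfi (F := F) (fun s _ => by simp [F]) hφ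
      have hF0 : F 0 = r₀ c := by simp [F]
      rw [hF0, mul_comm (F t), ← hF t ht] at key
      have hcongr : ∫ s in (0 : ℝ)..t, (Real.exp (κ * s) * relax g κ r s c * Real.exp (-κ * s) +
          F s * deriv (fun t => Real.exp (-κ * t)) s) = ∫ s in (0 : ℝ)..t, -G s c := by
        refine intervalIntegral.integral_congr_ae (Eventually.of_forall fun s hs => ?_)
        rw [uIoc_of_le ht] at hs
        have hd : deriv (fun t => Real.exp (-κ * t)) s = -κ * Real.exp (-κ * s) := by
          have := (((hasDerivAt_id s).const_mul (-κ)).exp).deriv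
          simp only [id] at this
          rw [this]
          ring
        have he : Real.exp (κ * s) * Real.exp (-κ * s) = 1 := by rw [← Real.exp_add]; simp
        simp only [hd, hG, if_pos hs.1, hF s hs.1.le]
        linear_combination (relax g κ r s c) * he
      rw [hcongr, intervalIntegral.integral_neg] at key
      simp at key
      linarith
  -- The reflection `c ↦ 2s - c` replaces `x = c - s` by `-x` and exchanges the two invariants; `g`
  -- is even in the first argument and odd in the second.
  · by_cases hs : 0 < s
    · rw [hGpos s hs, hGpos s hs, ← hg.odd, ← hg.even]
      congr 1
      · ring
      · rw [show 2 * s - (2 * s - c) = c by ring]; ring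
    · rw [hGneg s hs, hGneg s hs, neg_zero]

/-! ### Integration on the strip and test functions -/

theorem stripMeasure_eq_prod :
    stripMeasure = (volume.restrict (Ioi (0 : ℝ))).prod (volume.restrict (Ioo (0 : ℝ) 1)) := by
  rw [Measure.prod_restrict, ← Measure.volume_eq_prod]
  rfl

theorem measurableSet_strip : MeasurableSet strip := measurableSet_Ioi.prod measurableSet_Ioo

theorem integrable_mul_compactSupport {f ψ : ℝ × ℝ → ℝ} {C : ℝ}
    (hf : AEStronglyMeasurable f stripMeasure) (hC : ∀ᵐ q ∂stripMeasure, |f q| ≤ C)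
    (hψ : Continuous ψ) (hc : HasCompactSupport ψ) :
    Integrable (fun q => f q * ψ q) stripMeasure :=
  ((hψ.integrable_of_hasCompactSupport hc).restrict (s := strip)).bdd_mul hf hC

theorem integral_strip {F : ℝ × ℝ → ℝ} (hF : Integrable F stripMeasure) :
    ∫ q, F q ∂stripMeasure = ∫ t in Ioi (0 : ℝ), ∫ x in Ioo (0 : ℝ) 1, F (t, x) := by
  rw [stripMeasure_eq_prod] at hF ⊢
  exact integral_prod _ hF

theorem integral_strip_symm {F : ℝ × ℝ → ℝ} (hF : Integrable F stripMeasure) :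
    ∫ q, F q ∂stripMeasure = ∫ x in Ioo (0 : ℝ) 1, ∫ t in Ioi (0 : ℝ), F (t, x) := by
  rw [stripMeasure_eq_prod] at hF ⊢
  exact integral_prod_symm _ hF

theorem contDiff_fderiv_apply {φ : ℝ × ℝ → ℝ} (hφ : ContDiff ℝ ∞ φ) (e : ℝ × ℝ) :
    ContDiff ℝ ∞ fun q => fderiv ℝ φ q e :=
  (hφ.fderiv_right (m := ∞) (by simp)).clm_apply contDiff_const

theorem hasCompactSupport_fderiv_apply {φ : ℝ × ℝ → ℝ} (hc : HasCompactSupport φ) (e : ℝ × ℝ) :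
    HasCompactSupport fun q => fderiv ℝ φ q e := hc.fderiv_apply ℝ e

theorem hasDerivAt_time {φ : ℝ × ℝ → ℝ} (hφ : ContDiff ℝ ∞ φ) (t x : ℝ) :
    HasDerivAt (fun s => φ (s, x)) (fderiv ℝ φ (t, x) (1, 0)) t := by
  have h1 : HasFDerivAt φ (fderiv ℝ φ (t, x)) (t, x) :=
    ((hφ.differentiable (by simp)) (t, x)).hasFDerivAt
  exact h1.comp_hasDerivAt t ((hasDerivAt_id t).prodMk (hasDerivAt_const t x))

theorem hasDerivAt_space {φ : ℝ × ℝ → ℝ} (hφ : ContDiff ℝ ∞ φ) (t x : ℝ) :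
    HasDerivAt (fun y => φ (t, y)) (fderiv ℝ φ (t, x) (0, 1)) x := by
  have h1 : HasFDerivAt φ (fderiv ℝ φ (t, x)) (t, x) :=
    ((hφ.differentiable (by simp)) (t, x)).hasFDerivAt
  exact h1.comp_hasDerivAt x ((hasDerivAt_const x t).prodMk (hasDerivAt_id x))

theorem exists_time_bound {φ : ℝ × ℝ → ℝ} (hc : HasCompactSupport φ) :
    ∃ T : ℝ, 0 < T ∧ ∀ t x, T ≤ t → φ (t, x) = 0 := by
  obtain ⟨R, hR⟩ := hc.isCompact.isBounded.subset_closedBall 0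
  refine ⟨max R 0 + 1, by positivity, fun t x ht => ?_⟩
  refine image_eq_zero_of_notMem_tsupport fun h => ?_
  have h1 := hR h
  rw [mem_closedBall_zero_iff, Prod.norm_def] at h1
  have h2 := (le_max_left _ _).trans h1
  have h3 := (le_abs_self t).trans h2
  linarith [le_max_left R 0]

theorem setIntegral_Ioi_eq_intervalIntegral {f : ℝ → ℝ} {T : ℝ} (hT : 0 ≤ T)
    (hf : ∀ t, T ≤ t → f t = 0) : ∫ t in Ioi (0 : ℝ), f t = ∫ t in (0 : ℝ)..T, f t := by
  rw [intervalIntegral.integral_of_le hT]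
  refine setIntegral_eq_of_subset_of_forall_sdiff_eq_zero measurableSet_Ioi Ioc_subset_Ioi_self ?_
  intro t ht
  refine hf t ?_
  by_contra h
  exact ht.2 ⟨ht.1, (not_le.1 h).le⟩

theorem setIntegral_Ioo_eq_intervalIntegral {E : Type*} [NormedAddCommGroup E] [NormedSpace ℝ E]
    {f : ℝ → E} {a b : ℝ} (hab : a ≤ b) :
    ∫ t in Ioo a b, f t = ∫ t in a..b, f t := by
  rw [intervalIntegral.integral_of_le hab, integral_Ioc_eq_integral_Ioo]

/-- Fubini's theorem on a triangle. -/
theorem integral_triangle_swap {K : ℝ → ℝ → ℝ} (hK : Measurable (Function.uncurry K)) {C : ℝ}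
    (hC : ∀ τ s, |K τ s| ≤ C) {t : ℝ} (ht : 0 ≤ t) :
    ∫ s in (0 : ℝ)..t, ∫ τ in (0 : ℝ)..s, K τ s = ∫ τ in (0 : ℝ)..t, ∫ s in τ..t, K τ s := by
  have hm : MeasurableSet {q : ℝ × ℝ | q.2 ≤ q.1} := measurableSet_le measurable_snd measurable_fst
  have hKs : Measurable fun q : ℝ × ℝ => K q.2 q.1 := hK.comp measurable_swap
  have hint : IntegrableOn (Function.uncurry fun s τ => if τ ≤ s then K τ s else 0)
      (uIoc 0 t ×ˢ uIoc 0 t) := by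
    refine Measure.integrableOn_of_bounded (M := C) ?_ ?_ (Eventually.of_forall fun q => ?_)
    · rw [Measure.volume_eq_prod, Measure.prod_prod]
      simp [ENNReal.mul_eq_top]
    · exact (Measurable.ite hm hKs measurable_const).aestronglyMeasurable
    · simp only [Function.uncurry]
      split_ifs
      · exact hC _ _
      · rw [norm_zero]; exact (abs_nonneg _).trans (hC 0 0)
  have h := intervalIntegral_intervalIntegral_swap hint
  have e1 : ∀ s ∈ uIcc 0 t, ∫ τ in (0 : ℝ)..t, (if τ ≤ s then K τ s else 0) =
      ∫ τ in (0 : ℝ)..s, K τ s := by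
    intro s hs
    rw [uIcc_of_le ht] at hs
    rw [intervalIntegral.integral_of_le ht, intervalIntegral.integral_of_le hs.1,
      ← integral_indicator measurableSet_Ioc, ← integral_indicator measurableSet_Ioc]
    congr 1
    ext τ
    simp only [indicator, mem_Ioc]
    have := hs.2
    split_ifs <;> grind
  have e2 : ∀ τ ∈ uIcc 0 t, ∫ s in (0 : ℝ)..t, (if τ ≤ s then K τ s else 0) =
      ∫ s in τ..t, K τ s := by
    intro τ hτ
    rw [uIcc_of_le ht] at hτ
    rw [intervalIntegral.integral_of_le ht, intervalIntegral.integral_of_le hτ.2,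
      ← integral_Icc_eq_integral_Ioc, ← integral_Icc_eq_integral_Ioc,
      ← integral_indicator measurableSet_Icc, ← integral_indicator measurableSet_Icc]
    congr 1
    ext s
    simp only [indicator, mem_Icc]
    have := hτ.1
    split_ifs <;> grind
  rw [intervalIntegral.integral_congr e1, intervalIntegral.integral_congr e2] at h
  exact h

/-! ### The solution built from a characteristic solution -/

/-- The displacement with Riemann invariant `r`. -/
noncomputable def displacement (r : ℝ → ℝ → ℝ) (q : ℝ × ℝ) : ℝ :=
  (∫ c in (q.1 - q.2)..(q.1 + q.2), r q.1 c) / 2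

/-- The space derivative of the displacement. -/
noncomputable def strain (r : ℝ → ℝ → ℝ) (q : ℝ × ℝ) : ℝ :=
  (r q.1 (q.1 + q.2) + r q.1 (q.1 - q.2)) / 2

/-- The time derivative of the displacement. -/
noncomputable def velocity (r : ℝ → ℝ → ℝ) (q : ℝ × ℝ) : ℝ :=
  (r q.1 (q.1 + q.2) - r q.1 (q.1 - q.2)) / 2

namespace IsCharSolution

variable {g : ℝ → ℝ → ℝ} {r₀ : ℝ → ℝ} {M S : ℝ} {r G : ℝ → ℝ → ℝ}

theorem measurable_section (h : IsCharSolution g r₀ M S r G) (t : ℝ) : Measurable (r t) :=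
  h.measurable.comp measurable_prodMk_left

theorem measurable_source_section (h : IsCharSolution g r₀ M S r G) (t : ℝ) : Measurable (G t) :=
  h.measurable_source.comp measurable_prodMk_left

theorem intervalIntegrable (h : IsCharSolution g r₀ M S r G) (t a b : ℝ) :
    IntervalIntegrable (r t) volume a b :=
  intervalIntegrable_of_bounded (h.measurable_section t) (h.abs_le t) a b

theorem intervalIntegrable_source (h : IsCharSolution g r₀ M S r G) (t a b : ℝ) :
    IntervalIntegrable (G t) volume a b :=
  intervalIntegrable_of_bounded (h.measurable_source_section t) (h.abs_source_le t) a b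

theorem intervalIntegrable_source_time (h : IsCharSolution g r₀ M S r G) (c a b : ℝ) :
    IntervalIntegrable (fun s => G s c) volume a b :=
  intervalIntegrable_of_bounded (h.measurable_source.comp measurable_prodMk_right)
    (fun s => h.abs_source_le s c) a b

theorem initial_eq (h : IsCharSolution g r₀ M S r G) : r 0 = r₀ := by
  ext c
  rw [h.eq_initial_sub]
  simp

theorem sub_eq (h : IsCharSolution g r₀ M S r G) (t s c : ℝ) :
    r s c = r t c - ∫ τ in t..s, G τ c := by
  rw [h.eq_initial_sub s, h.eq_initial_sub t, ← intervalIntegral.integral_add_adjacent_intervals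
    (h.intervalIntegrable_source_time c 0 t) (h.intervalIntegrable_source_time c t s)]
  ring

theorem measurable_strain (h : IsCharSolution g r₀ M S r G) : Measurable (strain r) := by
  have h1 : Measurable fun q : ℝ × ℝ => r q.1 (q.1 + q.2) :=
    h.measurable.comp (measurable_fst.prodMk (measurable_fst.add measurable_snd))
  have h2 : Measurable fun q : ℝ × ℝ => r q.1 (q.1 - q.2) :=
    h.measurable.comp (measurable_fst.prodMk (measurable_fst.sub measurable_snd))
  exact (h1.add h2).div_const 2

theorem measurable_velocity (h : IsCharSolution g r₀ M S r G) : Measurable (velocity r) := by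
  have h1 : Measurable fun q : ℝ × ℝ => r q.1 (q.1 + q.2) :=
    h.measurable.comp (measurable_fst.prodMk (measurable_fst.add measurable_snd))
  have h2 : Measurable fun q : ℝ × ℝ => r q.1 (q.1 - q.2) :=
    h.measurable.comp (measurable_fst.prodMk (measurable_fst.sub measurable_snd))
  exact (h1.sub h2).div_const 2

/-- `|(p + q)/2| + |(p - q)/2| = max |p| |q|`, so the bound on the invariant carries over to the sum
of the two derivatives without loss. -/
theorem abs_strain_add_abs_velocity_le (h : IsCharSolution g r₀ M S r G) (q : ℝ × ℝ) :
    |strain r q| + |velocity r q| ≤ M := by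
  have h1 := _root_.abs_le.1 (h.abs_le q.1 (q.1 + q.2))
  have h2 := _root_.abs_le.1 (h.abs_le q.1 (q.1 - q.2))
  simp only [strain, velocity]
  rcases abs_cases ((r q.1 (q.1 + q.2) + r q.1 (q.1 - q.2)) / 2) with h3 | h3 <;>
  rcases abs_cases ((r q.1 (q.1 + q.2) - r q.1 (q.1 - q.2)) / 2) with h4 | h4 <;>
  linarith [h1.1, h1.2, h2.1, h2.2]

theorem abs_strain_le (h : IsCharSolution g r₀ M S r G) (q : ℝ × ℝ) : |strain r q| ≤ M := by
  linarith [h.abs_strain_add_abs_velocity_le q, abs_nonneg (velocity r q)]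

theorem abs_velocity_le (h : IsCharSolution g r₀ M S r G) (q : ℝ × ℝ) : |velocity r q| ≤ M := by
  linarith [h.abs_strain_add_abs_velocity_le q, abs_nonneg (strain r q)]

theorem intervalIntegrable_strain (h : IsCharSolution g r₀ M S r G) (t a b : ℝ) :
    IntervalIntegrable (fun x => strain r (t, x)) volume a b :=
  intervalIntegrable_of_bounded (h.measurable_strain.comp measurable_prodMk_left)
    (fun x => h.abs_strain_le (t, x)) a b

theorem intervalIntegrable_velocity (h : IsCharSolution g r₀ M S r G) (x a b : ℝ) :
    IntervalIntegrable (fun t => velocity r (t, x)) volume a b :=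
  intervalIntegrable_of_bounded (h.measurable_velocity.comp measurable_prodMk_right)
    (fun t => h.abs_velocity_le (t, x)) a b

theorem displacement_eq_integral_strain (h : IsCharSolution g r₀ M S r G) (t x : ℝ) :
    displacement r (t, x) = ∫ y in (0 : ℝ)..x, strain r (t, y) := by
  have h1 : IntervalIntegrable (fun y => r t (t + y)) volume 0 x :=
    intervalIntegrable_of_bounded ((h.measurable_section t).comp (by fun_prop))
      (fun y => h.abs_le t _) _ _
  have h2 : IntervalIntegrable (fun y => r t (t - y)) volume 0 x :=
    intervalIntegrable_of_bounded ((h.measurable_section t).comp (by fun_prop))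
      (fun y => h.abs_le t _) _ _
  simp only [displacement, strain]
  rw [intervalIntegral.integral_div, intervalIntegral.integral_add h1 h2,
    intervalIntegral.integral_comp_add_left (r t), intervalIntegral.integral_comp_sub_left (r t),
    add_zero, sub_zero, add_comm (∫ c in t..(t + x), r t c), intervalIntegral.integral_add_adjacent_intervals
      (h.intervalIntegrable t _ _) (h.intervalIntegrable t _ _)]

/-- `G s` is odd about `c = s`, that is, about the boundary point `x = 0`, and the interval is
symmetric about that point. -/
theorem integral_source_symm (h : IsCharSolution g r₀ M S r G) (s x : ℝ) :
    ∫ c in (s - x)..(s + x), G s c = 0 := by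
  have h1 := intervalIntegral.integral_comp_sub_left (a := s - x) (b := s + x) (G s) (2 * s)
  simp only [h.source_reflect] at h1
  rw [intervalIntegral.integral_neg, show 2 * s - (s + x) = s - x by ring,
    show 2 * s - (s - x) = s + x by ring] at h1
  linarith

/-- By oddness about `τ`, the integral over the part centred at `τ` cancels; only two intervals of
length `|t - τ|` contribute. This smallness is what makes the displacement differentiable in time.
-/
theorem integral_source_shift (h : IsCharSolution g r₀ M S r G) (τ t x : ℝ) :
    ∫ c in (t - x)..(t + x), G τ c =
      (∫ c in (τ + x)..(t + x), G τ c) - ∫ c in (τ - x)..(t - x), G τ c := by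
  have hi := h.intervalIntegrable_source τ
  have h0 := h.integral_source_symm τ x
  have e1 := intervalIntegral.integral_add_adjacent_intervals (hi (τ - x) (t - x))
    (hi (t - x) (t + x))
  have e2 := intervalIntegral.integral_add_adjacent_intervals (hi (τ - x) (τ + x))
    (hi (τ + x) (t + x))
  linarith

theorem integral_integral_source_swap (h : IsCharSolution g r₀ M S r G) (a b c d : ℝ) :
    ∫ y in a..b, ∫ τ in c..d, G τ y = ∫ τ in c..d, ∫ y in a..b, G τ y := by
  refine intervalIntegral_intervalIntegral_swap (F := fun y τ => G τ y) ?_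
  refine Measure.integrableOn_of_bounded (M := S) ?_ ?_ (Eventually.of_forall fun q => ?_)
  · rw [Measure.volume_eq_prod, Measure.prod_prod]
    simp [ENNReal.mul_eq_top]
  · exact (h.measurable_source.comp measurable_swap).aestronglyMeasurable
  · exact h.abs_source_le _ _

/-- The invariant is frozen at time `t`. Apart from the double integral of the source, `s` then
enters only through the endpoints of integration. -/
theorem displacement_eq_sub (h : IsCharSolution g r₀ M S r G) (t s x : ℝ) :
    displacement r (s, x) = (∫ c in (s - x)..(s + x), r t c) / 2
      - (∫ τ in t..s, ∫ c in (s - x)..(s + x), G τ c) / 2 := by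
  have h1 : IntervalIntegrable (fun c => ∫ τ in t..s, G τ c) volume (s - x) (s + x) := by
    have : (fun c => ∫ τ in t..s, G τ c) = fun c => r t c - r s c := by
      ext c; rw [h.sub_eq t s]; ring
    rw [this]
    exact (h.intervalIntegrable t _ _).sub (h.intervalIntegrable s _ _)
  rw [← h.integral_integral_source_swap, ← sub_div, ← intervalIntegral.integral_sub
    (h.intervalIntegrable t _ _) h1]
  simp only [displacement]
  congr 1
  exact intervalIntegral.integral_congr fun c _ => h.sub_eq t s c

/-- Inserting `r = r₀ - ∫ G` into the velocity produces a source integral over the triangle `0 ≤ τ ≤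
s ≤ t`. After the order of integration is exchanged, the inner integral in `s` is the difference in
`integral_source_shift`, so it equals the integral of `G τ` over `[t - x, t + x]`: the source term
of `displacement_eq_sub` with base time `0`. -/
theorem displacement_eq_integral_velocity (h : IsCharSolution g r₀ M S r G) {t : ℝ} (ht : 0 ≤ t)
    (x : ℝ) : displacement r (t, x) = displacement r (0, x) +
      ∫ s in (0 : ℝ)..t, velocity r (s, x) := by
  have hm₀ : Measurable r₀ := h.initial_eq ▸ h.measurable_section 0
  have hb₀ : ∀ c, |r₀ c| ≤ M := h.initial_eq ▸ h.abs_le 0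
  have i1 : ∀ a b : ℝ, IntervalIntegrable (fun s => r₀ (s + x)) volume a b := fun a b =>
    intervalIntegrable_of_bounded (hm₀.comp (by fun_prop)) (fun s => hb₀ _) _ _
  have i2 : ∀ a b : ℝ, IntervalIntegrable (fun s => r₀ (s - x)) volume a b := fun a b =>
    intervalIntegrable_of_bounded (hm₀.comp (by fun_prop)) (fun s => hb₀ _) _ _
  have i0 : ∀ a b : ℝ, IntervalIntegrable r₀ volume a b := fun a b =>
    intervalIntegrable_of_bounded hm₀ hb₀ _ _
  set K : ℝ → ℝ → ℝ := fun τ s => G τ (s + x) - G τ (s - x) with hK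
  have hKm : Measurable (Function.uncurry K) :=
    (h.measurable_source.comp (measurable_fst.prodMk (measurable_snd.add_const x))).sub
      (h.measurable_source.comp (measurable_fst.prodMk (measurable_snd.sub_const x)))
  have hKb : ∀ τ s, |K τ s| ≤ S + S := fun τ s =>
    (abs_sub _ _).trans (add_le_add (h.abs_source_le _ _) (h.abs_source_le _ _))
  have hv : ∀ s, velocity r (s, x) =
      ((r₀ (s + x) - r₀ (s - x)) - ∫ τ in (0 : ℝ)..s, K τ s) / 2 := by
    intro s
    simp only [velocity, hK]
    rw [h.eq_initial_sub, h.eq_initial_sub s, intervalIntegral.integral_sub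
      (h.intervalIntegrable_source_time _ _ _) (h.intervalIntegrable_source_time _ _ _)]
    ring
  have i3 : IntervalIntegrable (fun s => ∫ τ in (0 : ℝ)..s, K τ s) volume 0 t := by
    have : (fun s => ∫ τ in (0 : ℝ)..s, K τ s) =
        fun s => (r₀ (s + x) - r₀ (s - x)) - 2 * velocity r (s, x) := by
      ext s; rw [hv]; ring
    rw [this]
    exact ((i1 _ _).sub (i2 _ _)).sub ((h.intervalIntegrable_velocity x _ _).const_mul 2)
  have hin : ∀ τ, ∫ s in τ..t, K τ s = ∫ c in (t - x)..(t + x), G τ c := by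
    intro τ
    have j1 : IntervalIntegrable (fun s => G τ (s + x)) volume τ t :=
      intervalIntegrable_of_bounded ((h.measurable_source_section τ).comp (by fun_prop))
        (fun s => h.abs_source_le _ _) _ _
    have j2 : IntervalIntegrable (fun s => G τ (s - x)) volume τ t :=
      intervalIntegrable_of_bounded ((h.measurable_source_section τ).comp (by fun_prop))
        (fun s => h.abs_source_le _ _) _ _
    simp only [hK]
    rw [intervalIntegral.integral_sub j1 j2, intervalIntegral.integral_comp_add_right (G τ),
      intervalIntegral.integral_comp_sub_right (G τ), h.integral_source_shift τ t x]
  simp only [hv]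
  rw [intervalIntegral.integral_div, intervalIntegral.integral_sub ((i1 _ _).sub (i2 _ _)) i3,
    intervalIntegral.integral_sub (i1 _ _) (i2 _ _), integral_triangle_swap hKm hKb ht,
    intervalIntegral.integral_comp_add_right r₀, intervalIntegral.integral_comp_sub_right r₀,
    h.displacement_eq_sub 0 t x, h.initial_eq]
  simp only [hin, displacement, h.initial_eq]
  have e1 := intervalIntegral.integral_add_adjacent_intervals (i0 (0 - x) (t - x))
    (i0 (t - x) (t + x))
  have e2 := intervalIntegral.integral_add_adjacent_intervals (i0 (0 - x) (0 + x))
    (i0 (0 + x) (t + x))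
  linarith

theorem displacement_left (t : ℝ) : displacement r (t, 0) = 0 := by simp [displacement]

theorem displacement_right (h : IsCharSolution g r₀ M S r G) {t : ℝ} (ht : 0 ≤ t)
    (h0 : displacement r (0, 1) = 0) : displacement r (t, 1) = 0 := by
  -- The points `s + 1` and `s - 1` differ by one period, so the end `x = 1` does not move.
  have : ∀ s, velocity r (s, 1) = 0 := by
    intro s
    have := h.periodic s (s - 1)
    rw [show s - 1 + 2 = s + 1 by ring] at this
    simp [velocity, this]
  rw [h.displacement_eq_integral_velocity ht, h0]
  simp [this]

theorem abs_displacement_sub_space_le (h : IsCharSolution g r₀ M S r G) (t x y : ℝ) :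
    |displacement r (t, x) - displacement r (t, y)| ≤ M * |x - y| := by
  rw [h.displacement_eq_integral_strain, h.displacement_eq_integral_strain,
    intervalIntegral.integral_interval_sub_left (h.intervalIntegrable_strain t _ _)
      (h.intervalIntegrable_strain t _ _)]
  exact intervalIntegral.norm_integral_le_of_norm_le_const
    (f := fun s => strain r (t, s)) fun s _ => h.abs_strain_le (t, s)

theorem abs_displacement_sub_time_le (h : IsCharSolution g r₀ M S r G) {t s : ℝ} (ht : 0 ≤ t)
    (hs : 0 ≤ s) (x : ℝ) : |displacement r (t, x) - displacement r (s, x)| ≤ M * |t - s| := by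
  rw [h.displacement_eq_integral_velocity ht, h.displacement_eq_integral_velocity hs,
    add_sub_add_left_eq_sub,
    intervalIntegral.integral_interval_sub_left (h.intervalIntegrable_velocity x _ _)
      (h.intervalIntegrable_velocity x _ _)]
  exact intervalIntegral.norm_integral_le_of_norm_le_const
    (f := fun s => velocity r (s, x)) fun s _ => h.abs_velocity_le (s, x)

theorem continuousOn_displacement (h : IsCharSolution g r₀ M S r G) :
    ContinuousOn (displacement r) closedStrip := by
  have hM : 0 ≤ M := (abs_nonneg _).trans (h.abs_le 0 0)
  refine (LipschitzOnWith.of_dist_le_mul (K := ⟨2 * M, by positivity⟩) ?_).continuousOn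
  rintro ⟨t, x⟩ ⟨ht, -⟩ ⟨s, y⟩ ⟨hs, -⟩
  have h1 := h.abs_displacement_sub_space_le t x y
  have h2 := h.abs_displacement_sub_time_le ht hs y
  rw [Prod.dist_eq, Real.dist_eq, Real.dist_eq, Real.dist_eq]
  have h3 : |displacement r (t, x) - displacement r (s, y)| ≤ M * |x - y| + M * |t - s| :=
    (abs_sub_le _ (displacement r (t, y)) _).trans (add_le_add h1 h2)
  have h4 := mul_le_mul_of_nonneg_left (le_max_left |t - s| |x - y|) hM
  have h5 := mul_le_mul_of_nonneg_left (le_max_right |t - s| |x - y|) hM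
  change _ ≤ 2 * M * _
  linarith

theorem abs_displacement_le (h : IsCharSolution g r₀ M S r G) {q : ℝ × ℝ} (hq : q ∈ strip) :
    |displacement r q| ≤ M := by
  obtain ⟨t, x⟩ := q
  have hM : 0 ≤ M := (abs_nonneg _).trans (h.abs_le 0 0)
  have h1 := h.abs_displacement_sub_space_le t x 0
  have h2 : |x - 0| ≤ 1 := by
    rw [sub_zero, abs_of_pos hq.2.1]; exact hq.2.2.le
  rw [displacement_left, sub_zero] at h1
  exact h1.trans (mul_le_of_le_one_right hM h2)

theorem strip_subset_closedStrip : strip ⊆ closedStrip :=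
  prod_mono Ioi_subset_Ici_self Ioo_subset_Icc_self

theorem aestronglyMeasurable_displacement (h : IsCharSolution g r₀ M S r G) :
    AEStronglyMeasurable (displacement r) stripMeasure :=
  (h.continuousOn_displacement.mono strip_subset_closedStrip).aestronglyMeasurable
    measurableSet_strip

theorem ae_abs_displacement_le (h : IsCharSolution g r₀ M S r G) :
    ∀ᵐ q ∂stripMeasure, |displacement r q| ≤ M :=
  (ae_restrict_iff' measurableSet_strip).2 (Eventually.of_forall fun _ => h.abs_displacement_le)

theorem hasWeakDeriv_space (h : IsCharSolution g r₀ M S r G) :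
    HasWeakDeriv strip (0, 1) (displacement r) (strain r) := by
  intro φ hφ hc hs
  change ∫ q, _ ∂stripMeasure = -∫ q, _ ∂stripMeasure
  rw [integral_strip (integrable_mul_compactSupport h.aestronglyMeasurable_displacement
    h.ae_abs_displacement_le (contDiff_fderiv_apply hφ _).continuous
      (hasCompactSupport_fderiv_apply hc _)),
    integral_strip (integrable_mul_compactSupport h.measurable_strain.aestronglyMeasurable
      (Eventually.of_forall h.abs_strain_le) hφ.continuous hc), ← integral_neg]
  congr 1
  ext t
  have hz : ∀ x, x ∉ Ioo (0 : ℝ) 1 → φ (t, x) = 0 := fun x hx =>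
    image_eq_zero_of_notMem_tsupport fun h' => hx (hs h').2
  have hsec : ContDiff ℝ 1 fun x => φ (t, x) :=
    (hφ.comp (contDiff_const.prodMk contDiff_id)).of_le (by simp)
  have key := integral_mul_deriv_of_primitive (a := 0) (b := 1)
    (F := fun x => displacement r (t, x)) (h.intervalIntegrable_strain t 0 1)
    (fun x _ => by rw [displacement_left, zero_add, h.displacement_eq_integral_strain]) hsec
  rw [hz 0 (by simp), hz 1 (by simp)] at key
  simp only [(hasDerivAt_space hφ t _).deriv] at key
  rw [setIntegral_Ioo_eq_intervalIntegral zero_le_one,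
    setIntegral_Ioo_eq_intervalIntegral zero_le_one, key]
  ring

theorem hasWeakDeriv_time (h : IsCharSolution g r₀ M S r G) :
    HasWeakDeriv strip (1, 0) (displacement r) (velocity r) := by
  intro φ hφ hc hs
  change ∫ q, _ ∂stripMeasure = -∫ q, _ ∂stripMeasure
  obtain ⟨T, hT, hT0⟩ := exists_time_bound hc
  obtain ⟨T', hT', hT0'⟩ := exists_time_bound (hasCompactSupport_fderiv_apply hc (1, 0))
  rw [integral_strip_symm (integrable_mul_compactSupport h.aestronglyMeasurable_displacement
    h.ae_abs_displacement_le (contDiff_fderiv_apply hφ _).continuous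
      (hasCompactSupport_fderiv_apply hc _)),
    integral_strip_symm (integrable_mul_compactSupport h.measurable_velocity.aestronglyMeasurable
      (Eventually.of_forall h.abs_velocity_le) hφ.continuous hc), ← integral_neg]
  congr 1
  ext x
  have hz : ∀ t, t ≤ 0 → φ (t, x) = 0 := fun t ht =>
    image_eq_zero_of_notMem_tsupport fun h' => (not_lt.2 ht) (hs h').1
  have hsec : ContDiff ℝ 1 fun t => φ (t, x) :=
    (hφ.comp (contDiff_id.prodMk contDiff_const)).of_le (by simp)
  have hTm : 0 ≤ max T T' := hT.le.trans (le_max_left _ _)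
  have key := integral_mul_deriv_of_primitive (a := 0) (b := max T T')
    (F := fun t => displacement r (t, x)) (h.intervalIntegrable_velocity x 0 _)
    (fun t ht => by
      rw [uIcc_of_le hTm] at ht
      rw [h.displacement_eq_integral_velocity ht.1]) hsec
  rw [hz 0 le_rfl, hT0 (max T T') x (le_max_left _ _)] at key
  simp only [(hasDerivAt_time hφ _ x).deriv] at key
  rw [setIntegral_Ioi_eq_intervalIntegral hTm fun t ht => by
      rw [hT0' t x ((le_max_right _ _).trans ht), mul_zero],
    setIntegral_Ioi_eq_intervalIntegral hTm fun t ht => by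
      rw [hT0 t x ((le_max_left _ _).trans ht), mul_zero], key]
  ring

/-! ### Pointwise derivatives -/

theorem hasDerivAt_zero_of_abs_le_sq {e : ℝ → ℝ} {t C : ℝ} (h : ∀ s, |e s| ≤ C * (s - t) ^ 2) :
    HasDerivAt e 0 t := by
  have h0 : e t = 0 := by
    have := h t
    simpa using this
  rw [hasDerivAt_iff_isLittleO]
  simp only [h0, sub_zero, smul_zero]
  have h1 : e =O[𝓝 t] fun s => (s - t) ^ 2 :=
    Asymptotics.IsBigO.of_bound C (Eventually.of_forall fun s => by
      rw [Real.norm_eq_abs, Real.norm_eq_abs, abs_of_nonneg (sq_nonneg (s - t))]; exact h s)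
  refine h1.trans_isLittleO ?_
  have h2 : (fun s : ℝ => s - t) =o[𝓝 t] fun _ => (1 : ℝ) := by
    rw [Asymptotics.isLittleO_one_iff]
    have : Continuous fun s : ℝ => s - t := by fun_prop
    simpa using this.tendsto t
  have h3 := h2.mul_isBigO (Asymptotics.isBigO_refl (fun s : ℝ => s - t) (𝓝 t))
  simpa [sq] using h3

/-- With the invariant frozen at time `t`, the displacement is a difference of primitives of the
single function `r t`, evaluated at `s + x` and `s - x`, plus a remainder. Lebesgue's theorem
differentiates the primitives at almost every `x`, and the remainder is quadratic in `s - t` for all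
`x`. Hence the exceptional set is null for each individual `t`, not only for almost every `t`. -/
theorem ae_hasDerivAt (h : IsCharSolution g r₀ M S r G) (t : ℝ) :
    ∀ᵐ x, HasDerivAt (fun y => displacement r (t, y)) (strain r (t, x)) x ∧
      HasDerivAt (fun s => displacement r (s, x)) (velocity r (t, x)) t := by
  have hloc : LocallyIntegrable (r t) := by
    refine (memLp_top_of_bound (h.measurable_section t).aestronglyMeasurable M
      (Eventually.of_forall (h.abs_le t))).locallyIntegrable le_top
  have hL := _root_.LocallyIntegrable.ae_hasDerivAt_integral hloc
  have hp := (measurePreserving_add_left volume t).quasiMeasurePreserving.ae hL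
  have hm := (Measure.measurePreserving_sub_left volume t).quasiMeasurePreserving.ae hL
  filter_upwards [hp, hm] with x h1 h2
  have hsplit : ∀ a b : ℝ, ∫ c in a..b, r t c = (∫ c in (0 : ℝ)..b, r t c) - ∫ c in (0 : ℝ)..a, r t c :=
    fun a b => (intervalIntegral.integral_interval_sub_left (h.intervalIntegrable t _ _)
      (h.intervalIntegrable t _ _)).symm
  constructor
  · have d1 : HasDerivAt (fun y : ℝ => ∫ c in (0 : ℝ)..(t + y), r t c) (r t (t + x)) x := by
      simpa using (h1 0).comp_const_add t x
    have d2 : HasDerivAt (fun y : ℝ => ∫ c in (0 : ℝ)..(t - y), r t c) (-r t (t - x)) x := by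
      simpa using (h2 0).comp_const_sub t x
    have d3 := (d1.sub d2).div_const 2
    simp only [displacement, strain]
    convert! d3 using 1
    · ext y
      rw [hsplit]
      rfl
    · ring
  · have d1 : HasDerivAt (fun s : ℝ => ∫ c in (0 : ℝ)..(s + x), r t c) (r t (t + x)) t :=
      (h1 0).comp_add_const t x
    have d2 : HasDerivAt (fun s : ℝ => ∫ c in (0 : ℝ)..(s - x), r t c) (r t (t - x)) t :=
      (h2 0).comp_sub_const t x
    have d3 := (d1.sub d2).div_const 2
    -- The inner integral is at most `2S|s - t|` by `integral_source_shift`, the outer one has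
    -- length `|s - t|`, and the factor `1/2` leaves `S (s - t)²`.
    have d4 : HasDerivAt (fun s => (∫ τ in t..s, ∫ c in (s - x)..(s + x), G τ c) / 2) 0 t := by
      refine hasDerivAt_zero_of_abs_le_sq (C := S) fun s => ?_
      have hin : ∀ τ ∈ uIoc t s, ‖∫ c in (s - x)..(s + x), G τ c‖ ≤ 2 * S * |s - t| := by
        intro τ hτ
        have hS : 0 ≤ S := (abs_nonneg _).trans (h.abs_source_le 0 0)
        have k1 : |∫ c in (τ + x)..(s + x), G τ c| ≤ S * |s + x - (τ + x)| :=
          intervalIntegral.norm_integral_le_of_norm_le_const (f := G τ)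
            fun c _ => h.abs_source_le τ c
        have k2 : |∫ c in (τ - x)..(s - x), G τ c| ≤ S * |s - x - (τ - x)| :=
          intervalIntegral.norm_integral_le_of_norm_le_const (f := G τ)
            fun c _ => h.abs_source_le τ c
        rw [show s + x - (τ + x) = s - τ by ring] at k1
        rw [show s - x - (τ - x) = s - τ by ring] at k2
        have k3 : |s - τ| ≤ |s - t| := by
          exact abs_sub_right_of_mem_uIcc (uIoc_subset_uIcc hτ)
        rw [h.integral_source_shift τ s x, Real.norm_eq_abs]
        have k4 := mul_le_mul_of_nonneg_left k3 hS
        exact (abs_sub _ _).trans (by linarith)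
      have := intervalIntegral.norm_integral_le_of_norm_le_const hin
      rw [abs_div, abs_two, ← sq_abs (s - t)]
      rw [Real.norm_eq_abs] at this
      nlinarith
    have d5 := d3.sub d4
    rw [sub_zero] at d5
    simp only [velocity]
    refine d5.congr_of_eventuallyEq (Eventually.of_forall fun s => ?_)
    change displacement r (s, x) = _
    rw [h.displacement_eq_sub t s x, hsplit]
    rfl

end IsCharSolution

/-! ### Transport in characteristic coordinates and the weak wave equation -/

/-- The homeomorphism from space-time to characteristic coordinates. -/
def charHomeomorph (ε : ℝ) (hε : ε * ε = 1) : ℝ × ℝ ≃ₜ ℝ × ℝ where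
  toFun q := (q.1, ε * (q.2 - q.1))
  invFun q := (q.1, q.1 + ε * q.2)
  left_inv q := by
    ext
    · rfl
    · change q.1 + ε * (ε * (q.2 - q.1)) = q.2
      linear_combination (q.2 - q.1) * hε
  right_inv q := by
    ext
    · rfl
    · change ε * (q.1 + ε * q.2 - q.1) = q.2
      linear_combination q.2 * hε
  continuous_toFun := by fun_prop
  continuous_invFun := by fun_prop

theorem integral_comp_mul_sub {ε : ℝ} (hε : ε * ε = 1) (F : ℝ → ℝ) (t : ℝ) :
    ∫ c, F (ε * (c - t)) = ∫ x, F x := by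
  rw [integral_sub_right_eq_self (fun c => F (ε * c))]
  rcases mul_self_eq_one_iff.1 hε with rfl | rfl
  · simp
  · simpa using integral_neg_eq_self F volume

theorem integrable_halfSpace {f ψ : ℝ × ℝ → ℝ} {C : ℝ} (hf : Measurable f) (hC : ∀ q, |f q| ≤ C)
    (hψ : Continuous ψ) (hc : HasCompactSupport ψ) :
    Integrable (fun q => f q * ψ q) ((volume.restrict (Ioi (0 : ℝ))).prod volume) := by
  have : (volume.restrict (Ioi (0 : ℝ))).prod (volume : Measure ℝ) =
      (volume : Measure (ℝ × ℝ)).restrict (Ioi 0 ×ˢ univ) := by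
    rw [Measure.volume_eq_prod, ← Measure.prod_restrict, Measure.restrict_univ]
  rw [this]
  exact ((hψ.integrable_of_hasCompactSupport hc).restrict).bdd_mul
    hf.aestronglyMeasurable (Eventually.of_forall hC)

namespace IsCharSolution

variable {g : ℝ → ℝ → ℝ} {r₀ : ℝ → ℝ} {M S : ℝ} {r G : ℝ → ℝ → ℝ}

theorem integrable_transport (h : IsCharSolution g r₀ M S r G) (ε : ℝ) {φ : ℝ × ℝ → ℝ}
    (hφ : ContDiff ℝ ∞ φ) (hc : HasCompactSupport φ) :
    Integrable (fun q : ℝ × ℝ => r q.1 (q.1 + ε * q.2) * fderiv ℝ φ q (1, -ε)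
      - G q.1 (q.1 + ε * q.2) * φ q) ((volume.restrict (Ioi (0 : ℝ))).prod volume) := by
  have hm : Measurable fun q : ℝ × ℝ => (q.1, q.1 + ε * q.2) := by fun_prop
  exact (integrable_halfSpace (h.measurable.comp hm) (fun q => h.abs_le _ _)
    (contDiff_fderiv_apply hφ (1, -ε)).continuous (hasCompactSupport_fderiv_apply hc _)).sub
    (integrable_halfSpace (h.measurable_source.comp hm) (fun q => h.abs_source_le _ _)
      hφ.continuous hc)

/-- The transport equation satisfied by the Riemann invariants, tested in space-time. -/
theorem integral_transport (h : IsCharSolution g r₀ M S r G) {ε : ℝ} (hε : ε * ε = 1)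
    {φ : ℝ × ℝ → ℝ} (hφ : ContDiff ℝ ∞ φ) (hc : HasCompactSupport φ) :
    ∫ q, (r q.1 (q.1 + ε * q.2) * fderiv ℝ φ q (1, -ε) - G q.1 (q.1 + ε * q.2) * φ q)
      ∂((volume.restrict (Ioi (0 : ℝ))).prod volume) = -∫ x, r₀ (ε * x) * φ (0, x) := by
  -- In the variables `(t, c)` with `c = t + εx`, the direction `(1, -ε)` becomes the pure time
  -- direction. For each fixed `c` the identity is then an integration by parts in time, whose
  -- boundary term at `0` carries `r₀`.
  set ψ : ℝ × ℝ → ℝ := φ ∘ charHomeomorph ε hε with hψ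
  have hψs : ContDiff ℝ ∞ ψ := by
    refine hφ.comp (?_ : ContDiff ℝ ∞ fun q : ℝ × ℝ => (q.1, ε * (q.2 - q.1)))
    fun_prop
  have hψc : HasCompactSupport ψ := hc.comp_homeomorph _
  have hψd : ∀ t c, fderiv ℝ ψ (t, c) (1, 0) = fderiv ℝ φ (t, ε * (c - t)) (1, -ε) := by
    intro t c
    have h1 := hasDerivAt_time hψs t c
    have h2 : HasFDerivAt φ (fderiv ℝ φ (t, ε * (c - t))) (t, ε * (c - t)) :=
      ((hφ.differentiable (by simp)) _).hasFDerivAt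
    have h3 : HasDerivAt (fun s : ℝ => ε * (c - s)) (-ε) t := by
      simpa using ((hasDerivAt_id t).const_sub c).const_mul ε
    exact h1.unique (h2.comp_hasDerivAt t ((hasDerivAt_id t).prodMk h3))
  obtain ⟨T, hT, hT0⟩ := exists_time_bound hψc
  obtain ⟨T', hT', hT0'⟩ := exists_time_bound (hasCompactSupport_fderiv_apply hψc (1, 0))
  have hTm : 0 ≤ max T T' := hT.le.trans (le_max_left _ _)
  have hcx : ∀ t c, r t (t + ε * (ε * (c - t))) * fderiv ℝ φ (t, ε * (c - t)) (1, -ε)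
      - G t (t + ε * (ε * (c - t))) * φ (t, ε * (c - t)) =
      r t c * fderiv ℝ ψ (t, c) (1, 0) - G t c * ψ (t, c) := by
    intro t c
    rw [hψd, show t + ε * (ε * (c - t)) = c by linear_combination (c - t) * hε]
    rfl
  have hswap : Integrable (Function.uncurry fun t c =>
      r t c * fderiv ℝ ψ (t, c) (1, 0) - G t c * ψ (t, c))
      ((volume.restrict (Ioi (0 : ℝ))).prod volume) :=
    (integrable_halfSpace h.measurable (fun q => h.abs_le _ _)
      (contDiff_fderiv_apply hψs (1, 0)).continuous (hasCompactSupport_fderiv_apply hψc _)).sub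
      (integrable_halfSpace h.measurable_source (fun q => h.abs_source_le _ _)
        hψs.continuous hψc)
  have hibp : ∀ c, ∫ t in Ioi (0 : ℝ), (r t c * fderiv ℝ ψ (t, c) (1, 0) - G t c * ψ (t, c)) =
      -(r₀ c * φ (0, ε * c)) := by
    intro c
    have hsec : ContDiff ℝ 1 fun t => ψ (t, c) :=
      (hψs.comp (contDiff_id.prodMk contDiff_const)).of_le (by simp)
    have key := integral_mul_add_mul_deriv (f := fun t => -G t c) (F := fun t => r t c)
      (a := 0) (b := max T T') (h.intervalIntegrable_source_time c _ _).neg (fun t _ => by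
        rw [intervalIntegral.integral_neg, h.initial_eq, h.eq_initial_sub t]
        ring) hsec
    rw [hT0 _ c (le_max_left _ _), h.initial_eq] at key
    simp only [(hasDerivAt_time hψs _ c).deriv] at key
    have h0 : ψ (0, c) = φ (0, ε * c) := by
      change φ (0, ε * (c - 0)) = _
      rw [sub_zero]
    rw [h0, mul_zero, zero_sub] at key
    rw [setIntegral_Ioi_eq_intervalIntegral hTm fun t ht => by
      rw [hT0 t c ((le_max_left _ _).trans ht), hT0' t c ((le_max_right _ _).trans ht)]
      ring, ← key]
    refine intervalIntegral.integral_congr fun t _ => ?_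
    ring
  rw [integral_prod _ (h.integrable_transport ε hφ hc)]
  have e1 : ∀ t, ∫ x, (r t (t + ε * x) * fderiv ℝ φ (t, x) (1, -ε) - G t (t + ε * x) * φ (t, x)) =
      ∫ c, (r t c * fderiv ℝ ψ (t, c) (1, 0) - G t c * ψ (t, c)) := by
    intro t
    rw [← integral_comp_mul_sub hε (fun x => r t (t + ε * x) * fderiv ℝ φ (t, x) (1, -ε)
      - G t (t + ε * x) * φ (t, x)) t]
    simp only [hcx]
  simp only [e1]
  rw [integral_integral_swap hswap]
  simp only [hibp]
  rw [integral_neg, ← integral_comp_mul_sub hε (fun x => r₀ (ε * x) * φ (0, x)) 0]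
  congr 2
  ext c
  rw [sub_zero, show ε * (ε * c) = c by linear_combination c * hε]

/-- The weak form of the damped wave equation for the displacement. -/
theorem weak_equation (h : IsCharSolution g r₀ M S r G) {φ : ℝ × ℝ → ℝ} (hφ : ContDiff ℝ ∞ φ)
    (hc : HasCompactSupport φ) (hs : tsupport φ ⊆ (univ : Set ℝ) ×ˢ Ioo (0 : ℝ) 1) :
    ∫ q, (velocity r q * fderiv ℝ φ q (1, 0) - strain r q * fderiv ℝ φ q (0, 1)
      - G q.1 (q.1 + q.2) * φ q) ∂stripMeasure
      + ∫ x, (r₀ x - r₀ (-x)) / 2 * φ (0, x) ∂spaceMeasure = 0 := by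
  have h1 := h.integral_transport (ε := 1) (by norm_num) hφ hc
  have h2 := h.integral_transport (ε := -1) (by norm_num) hφ hc
  have i1 := h.integrable_transport 1 hφ hc
  have i2 := h.integrable_transport (-1) hφ hc
  have hz : ∀ q : ℝ × ℝ, q.2 ∉ Ioo (0 : ℝ) 1 → φ q = 0 := fun q hq =>
    image_eq_zero_of_notMem_tsupport fun h' => hq (hs h').2
  have hzd : ∀ q : ℝ × ℝ, q.2 ∉ Ioo (0 : ℝ) 1 → fderiv ℝ φ q = 0 := fun q hq =>
    image_eq_zero_of_notMem_tsupport fun h' => hq (hs (tsupport_fderiv_subset ℝ h')).2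
  have e1 : ∀ q : ℝ × ℝ, fderiv ℝ φ q (1, -1) = fderiv ℝ φ q (1, 0) - fderiv ℝ φ q (0, 1) := by
    intro q
    rw [← map_sub]
    simp
  have e2 : ∀ q : ℝ × ℝ, fderiv ℝ φ q (1, 1) = fderiv ℝ φ q (1, 0) + fderiv ℝ φ q (0, 1) := by
    intro q
    rw [← map_add]
    simp
  have e3 : ∀ q : ℝ × ℝ, G q.1 (q.1 - q.2) = -G q.1 (q.1 + q.2) := by
    intro q
    rw [← h.source_reflect]
    congr 1
    ring
  -- Half the difference of the transport identities for `ε = 1` and `ε = -1`. The two sources add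
  -- up because `G` changes sign under reflection.
  have hcong : ∀ q : ℝ × ℝ, velocity r q * fderiv ℝ φ q (1, 0) - strain r q * fderiv ℝ φ q (0, 1)
      - G q.1 (q.1 + q.2) * φ q =
      (1 / 2) * ((r q.1 (q.1 + 1 * q.2) * fderiv ℝ φ q (1, -1) - G q.1 (q.1 + 1 * q.2) * φ q) -
      (r q.1 (q.1 + -1 * q.2) * fderiv ℝ φ q (1, - -1) - G q.1 (q.1 + -1 * q.2) * φ q)) := by
    intro q
    rw [neg_neg, one_mul, neg_one_mul, ← sub_eq_add_neg, e1, e2, e3, velocity, strain]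
    ring
  have hset : ∫ q, (velocity r q * fderiv ℝ φ q (1, 0) - strain r q * fderiv ℝ φ q (0, 1)
      - G q.1 (q.1 + q.2) * φ q) ∂stripMeasure =
      ∫ q, (velocity r q * fderiv ℝ φ q (1, 0) - strain r q * fderiv ℝ φ q (0, 1)
      - G q.1 (q.1 + q.2) * φ q) ∂((volume.restrict (Ioi (0 : ℝ))).prod volume) := by
    have hm : stripMeasure = ((volume.restrict (Ioi (0 : ℝ))).prod
        (volume : Measure ℝ)).restrict (univ ×ˢ Ioo 0 1) := by
      rw [← Measure.prod_restrict, Measure.restrict_univ, stripMeasure_eq_prod]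
    rw [hm, setIntegral_eq_integral_of_forall_compl_eq_zero]
    intro q hq
    have hq2 : q.2 ∉ Ioo (0 : ℝ) 1 := fun h' => hq ⟨mem_univ _, h'⟩
    rw [hz q hq2, hzd q hq2]
    simp
  have hsp : ∫ x, (r₀ x - r₀ (-x)) / 2 * φ (0, x) ∂spaceMeasure =
      ∫ x, (r₀ x - r₀ (-x)) / 2 * φ (0, x) := by
    refine setIntegral_eq_integral_of_forall_compl_eq_zero fun x hx => ?_
    rw [hz (0, x) hx, mul_zero]
  have hm₀ : Measurable r₀ := h.initial_eq ▸ h.measurable_section 0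
  have hb₀ : ∀ c, |r₀ c| ≤ M := h.initial_eq ▸ h.abs_le 0
  have hφ0 : Integrable fun x => φ (0, x) := by
    refine Continuous.integrable_of_hasCompactSupport (hφ.continuous.comp (by fun_prop)) ?_
    exact HasCompactSupport.of_support_subset_isCompact (K := Icc 0 1) isCompact_Icc fun x hx => by
      by_contra h'
      exact hx (hz (0, x) fun h'' => h' (Ioo_subset_Icc_self h''))
  have j1 : Integrable fun x => r₀ (1 * x) * φ (0, x) :=
    hφ0.bdd_mul (c := M) (hm₀.comp (by fun_prop)).aestronglyMeasurable
      (Eventually.of_forall fun x => hb₀ _)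
  have j2 : Integrable fun x => r₀ (-1 * x) * φ (0, x) :=
    hφ0.bdd_mul (c := M) (hm₀.comp (by fun_prop)).aestronglyMeasurable
      (Eventually.of_forall fun x => hb₀ _)
  have hsum : ∫ x, (r₀ x - r₀ (-x)) / 2 * φ (0, x) =
      (1 / 2) * ((∫ x, r₀ (1 * x) * φ (0, x)) - ∫ x, r₀ (-1 * x) * φ (0, x)) := by
    rw [← integral_sub j1 j2, ← integral_const_mul]
    congr 1
    ext x
    rw [one_mul, neg_one_mul]
    ring
  rw [hset, hsp, hsum]
  simp only [hcong]
  rw [integral_const_mul, integral_sub i1 i2, h1, h2]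
  ring

end IsCharSolution

/-! ### Parseval's identity for the sine series on `(0,1)` -/

/-- The odd reflection of the restriction of `h` to `(0,1)`. -/
noncomputable def oddReflection (h : ℝ → ℝ) (x : ℝ) : ℝ :=
  (Ioo (0 : ℝ) 1).indicator h x - (Ioo (0 : ℝ) 1).indicator h (-x)

theorem measurable_oddReflection {h : ℝ → ℝ} (hm : Measurable h) :
    Measurable (oddReflection h) :=
  (hm.indicator measurableSet_Ioo).sub ((hm.indicator measurableSet_Ioo).comp measurable_neg)

theorem abs_oddReflection_le {h : ℝ → ℝ} {C : ℝ} (hC : ∀ x ∈ Ioo (0 : ℝ) 1, |h x| ≤ C) (x : ℝ) :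
    |oddReflection h x| ≤ C + C := by
  have hC0 : 0 ≤ C := (abs_nonneg _).trans (hC (1 / 2) (by norm_num))
  have key : ∀ y, |(Ioo (0 : ℝ) 1).indicator h y| ≤ C := by
    intro y
    by_cases hy : y ∈ Ioo (0 : ℝ) 1
    · rw [indicator_of_mem hy]; exact hC y hy
    · rw [indicator_of_notMem hy, abs_zero]; exact hC0
  exact (abs_sub _ _).trans (add_le_add (key _) (key _))

theorem oddReflection_neg (h : ℝ → ℝ) (x : ℝ) : oddReflection h (-x) = -oddReflection h x := by
  simp only [oddReflection, neg_neg]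
  ring

theorem oddReflection_of_mem (h : ℝ → ℝ) {x : ℝ} (hx : x ∈ Ioo (0 : ℝ) 1) :
    oddReflection h x = h x := by
  have : -x ∉ Ioo (0 : ℝ) 1 := fun h' => by linarith [h'.1, hx.1]
  rw [oddReflection, indicator_of_mem hx, indicator_of_notMem this, sub_zero]

theorem integral_reflect {E : Type*} [NormedAddCommGroup E] [NormedSpace ℝ E] {F : ℝ → E}
    (hF : ∀ a b : ℝ, IntervalIntegrable F volume a b) :
    ∫ x in (-1 : ℝ)..1, F x = ∫ x in (0 : ℝ)..1, (F x + F (-x)) := by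
  have h1 : IntervalIntegrable (fun x => F (-x)) volume 0 1 := by
    rw [IntervalIntegrable.iff_comp_neg]
    simpa using hF (-0) (-1)
  rw [intervalIntegral.integral_add (hF 0 1) h1, intervalIntegral.integral_comp_neg, neg_zero,
    add_comm, intervalIntegral.integral_add_adjacent_intervals (hF _ _) (hF _ _)]

/-- Parseval's identity on `(-1,1)` for the odd reflection: its `n`-th Fourier coefficient is `-i`
times the sine integral over `(0,1)`, and its mean square is the integral of `h²` over `(0,1)`.
Summing over all integers counts each frequency twice, so no factor `2` appears. -/
theorem hasSum_sq_sineCoeff {h : ℝ → ℝ} (hm : Measurable h) {C : ℝ}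
    (hC : ∀ x ∈ Ioo (0 : ℝ) 1, |h x| ≤ C) :
    HasSum (fun n : ℤ => (∫ x in Ioo (0 : ℝ) 1, h x * Real.sin (n * Real.pi * x)) ^ 2)
      (∫ x in Ioo (0 : ℝ) 1, h x ^ 2) := by
  set o : ℝ → ℂ := fun x => (oddReflection h x : ℂ) with ho
  have hom : Measurable o := Complex.measurable_ofReal.comp (measurable_oddReflection hm)
  have hob : ∀ x, ‖o x‖ ≤ C + C := fun x => by
    rw [ho, Complex.norm_real]; exact abs_oddReflection_le hC x
  have hL2 : MemLp o 2 (volume.restrict (Ioc (-1 : ℝ) 1)) :=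
    MemLp.of_bound hom.aestronglyMeasurable (C + C) (Eventually.of_forall hob)
  have hP := hasSum_sq_fourierCoeffOn (by norm_num : (-1 : ℝ) < 1) hL2
  have e1 : ∀ n : ℤ, ‖fourierCoeffOn (by norm_num : (-1 : ℝ) < 1) o n‖ ^ 2 =
      (∫ x in Ioo (0 : ℝ) 1, h x * Real.sin (n * Real.pi * x)) ^ 2 := by
    intro n
    have hexp : ∀ x : ℝ, (fourier (-n) (x : AddCircle ((1 : ℝ) - -1)) : ℂ) =
        Complex.exp (-(n * Real.pi * x : ℝ) * Complex.I) := by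
      intro x
      rw [fourier_coe_apply]
      congr 1
      push_cast
      ring
    have hint : ∀ a b : ℝ, IntervalIntegrable (fun x : ℝ =>
        Complex.exp (-(n * Real.pi * x : ℝ) * Complex.I) • o x) volume a b := by
      intro a b
      rw [intervalIntegrable_iff]
      refine Measure.integrableOn_of_bounded (M := C + C) (by simp) ?_
        (Eventually.of_forall fun x => ?_)
      · exact ((by fun_prop : Continuous fun x : ℝ =>
          Complex.exp (-(n * Real.pi * x : ℝ) * Complex.I)).measurable.smul
          hom).aestronglyMeasurable
      · rw [norm_smul, ← Complex.ofReal_neg, Complex.norm_exp_ofReal_mul_I, one_mul]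
        exact hob x
    rw [fourierCoeffOn_eq_integral]
    simp only [hexp]
    rw [integral_reflect hint]
    have e2 : ∫ x in (0 : ℝ)..1, (Complex.exp (-(n * Real.pi * x : ℝ) * Complex.I) • o x +
        Complex.exp (-(n * Real.pi * -x : ℝ) * Complex.I) • o (-x)) =
        ((-2 * Complex.I) * ((∫ x in (0 : ℝ)..1, h x * Real.sin (n * Real.pi * x) : ℝ) : ℂ)) := by
      rw [← intervalIntegral.integral_ofReal, ← intervalIntegral.integral_const_mul,
        ← setIntegral_Ioo_eq_intervalIntegral zero_le_one,
        ← setIntegral_Ioo_eq_intervalIntegral zero_le_one]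
      refine setIntegral_congr_fun measurableSet_Ioo fun x hx => ?_
      simp only [ho, oddReflection_neg, oddReflection_of_mem h hx, smul_eq_mul]
      have h1 : -((n * Real.pi * -x : ℝ) : ℂ) * Complex.I =
        ((n * Real.pi * x : ℝ) : ℂ) * Complex.I := by push_cast; ring
      rw [h1, ← Complex.ofReal_neg, Complex.exp_mul_I, Complex.exp_mul_I,
        ← Complex.ofReal_cos, ← Complex.ofReal_sin, ← Complex.ofReal_cos, ← Complex.ofReal_sin,
        Real.cos_neg, Real.sin_neg]
      push_cast
      ring
    rw [e2, setIntegral_Ioo_eq_intervalIntegral zero_le_one, norm_smul, norm_mul,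
      Complex.norm_real]
    simp only [Complex.norm_mul, Complex.norm_I, norm_neg, Complex.norm_ofNat, Real.norm_eq_abs]
    norm_num
    rw [← mul_assoc]
    norm_num
  have e3 : ((1 : ℝ) - -1)⁻¹ • ∫ x in (-1 : ℝ)..1, ‖o x‖ ^ 2 = ∫ x in Ioo (0 : ℝ) 1, h x ^ 2 := by
    have hsq : ∀ x, ‖o x‖ ^ 2 = oddReflection h x ^ 2 := fun x => by
      rw [ho, Complex.norm_real, Real.norm_eq_abs, sq_abs]
    have hint : ∀ a b : ℝ, IntervalIntegrable (fun x => oddReflection h x ^ 2) volume a b :=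
      fun a b => intervalIntegrable_of_bounded (C := (C + C) ^ 2)
        ((measurable_oddReflection hm).pow_const 2) (fun x => by
          rw [abs_pow]
          exact pow_le_pow_left₀ (abs_nonneg _) (abs_oddReflection_le hC x) 2) a b
    simp only [hsq]
    rw [integral_reflect hint]
    simp only [oddReflection_neg, neg_sq, ← two_mul]
    rw [intervalIntegral.integral_const_mul, ← setIntegral_Ioo_eq_intervalIntegral zero_le_one,
      setIntegral_congr_fun measurableSet_Ioo fun x hx => by rw [oddReflection_of_mem h hx]]
    rw [smul_eq_mul]
    ring
  simp only [e1, e3] at hP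
  exact hP

/-! ### Cut-off functions on `(0,1)` -/

/-- A smooth cut-off function, compactly supported in `(0,1)` and converging to `1` as
`j → ∞`. -/
noncomputable def cutoff (j : ℕ) (x : ℝ) : ℝ :=
  Real.smoothTransition ((j + 1) * (x * (1 - x)) - 1)

theorem contDiff_cutoff (j : ℕ) : ContDiff ℝ ∞ (cutoff j) :=
  Real.smoothTransition.contDiff.comp (by fun_prop)

theorem abs_cutoff_le (j : ℕ) (x : ℝ) : |cutoff j x| ≤ 1 := by
  rw [cutoff, abs_of_nonneg (Real.smoothTransition.nonneg _)]
  exact Real.smoothTransition.le_one _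

theorem support_cutoff_subset (j : ℕ) :
    Function.support (cutoff j) ⊆ {x | 1 ≤ (j + 1 : ℝ) * (x * (1 - x))} := by
  intro x hx
  by_contra h
  refine hx (Real.smoothTransition.zero_of_nonpos ?_)
  have : (j + 1 : ℝ) * (x * (1 - x)) < 1 := not_le.1 h
  linarith

theorem tsupport_cutoff_subset (j : ℕ) :
    tsupport (cutoff j) ⊆ {x | 1 ≤ (j + 1 : ℝ) * (x * (1 - x))} :=
  closure_minimal (support_cutoff_subset j) (isClosed_le continuous_const (by fun_prop))

theorem tsupport_cutoff_subset_Ioo (j : ℕ) : tsupport (cutoff j) ⊆ Ioo 0 1 := by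
  intro x hx
  have h1 : 1 ≤ (j + 1 : ℝ) * (x * (1 - x)) := tsupport_cutoff_subset j hx
  have h2 : 0 < x * (1 - x) := by
    by_contra h
    have : (j + 1 : ℝ) * (x * (1 - x)) ≤ 0 :=
      mul_nonpos_of_nonneg_of_nonpos (by positivity) (not_lt.1 h)
    linarith
  constructor <;> nlinarith

theorem hasCompactSupport_cutoff (j : ℕ) : HasCompactSupport (cutoff j) :=
  HasCompactSupport.of_support_subset_isCompact isCompact_Icc
    ((subset_tsupport _).trans ((tsupport_cutoff_subset_Ioo j).trans Ioo_subset_Icc_self))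

theorem eventually_cutoff_eq_one {x : ℝ} (hx : x ∈ Ioo (0 : ℝ) 1) :
    ∀ᶠ j : ℕ in atTop, cutoff j =ᶠ[𝓝 x] fun _ => 1 := by
  have hd : 0 < x * (1 - x) := mul_pos hx.1 (by linarith [hx.2])
  obtain ⟨N, hN⟩ := exists_nat_gt (2 / (x * (1 - x)))
  rw [div_lt_iff₀ hd] at hN
  filter_upwards [eventually_ge_atTop N] with j hj
  have h1 : (N : ℝ) ≤ j := by exact_mod_cast hj
  have h2 : 2 < (j + 1 : ℝ) * (x * (1 - x)) := by nlinarith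
  have hc : Continuous fun y : ℝ => (j + 1 : ℝ) * (y * (1 - y)) := by fun_prop
  filter_upwards [hc.continuousAt.eventually_const_lt h2] with y hy
  exact Real.smoothTransition.one_of_one_le (by linarith)

theorem tendsto_cutoff {x : ℝ} (hx : x ∈ Ioo (0 : ℝ) 1) :
    Tendsto (fun j => cutoff j x) atTop (𝓝 1) :=
  tendsto_const_nhds.congr' (by
    filter_upwards [eventually_cutoff_eq_one hx] with j hj using hj.self_of_nhds.symm)

theorem tendsto_deriv_cutoff {x : ℝ} (hx : x ∈ Ioo (0 : ℝ) 1) :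
    Tendsto (fun j => deriv (cutoff j) x) atTop (𝓝 0) :=
  tendsto_const_nhds.congr' (by
    filter_upwards [eventually_cutoff_eq_one hx] with j hj
    rw [hj.deriv_eq, deriv_const])

/-- The transition is locally constant off `[0,1]`, so the product is a continuous function
supported in `[1,2]`. -/
theorem exists_deriv_smoothTransition_bound :
    ∃ C, 0 ≤ C ∧ ∀ u : ℝ, |u * deriv Real.smoothTransition (u - 1)| ≤ C := by
  have hcont : Continuous (deriv Real.smoothTransition) :=
    (Real.smoothTransition.contDiff (n := 1)).continuous_deriv le_rfl
  have hout : ∀ v : ℝ, v ∉ Icc (0 : ℝ) 1 → deriv Real.smoothTransition v = 0 := by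
    intro v hv
    rw [mem_Icc, not_and_or, not_le, not_le] at hv
    rcases hv with hv | hv
    · have : Real.smoothTransition =ᶠ[𝓝 v] fun _ => 0 := by
        filter_upwards [Iio_mem_nhds hv] with y hy
          using Real.smoothTransition.zero_of_nonpos (le_of_lt hy)
      rw [this.deriv_eq, deriv_const]
    · have : Real.smoothTransition =ᶠ[𝓝 v] fun _ => 1 := by
        filter_upwards [Ioi_mem_nhds hv] with y hy
          using Real.smoothTransition.one_of_one_le (le_of_lt hy)
      rw [this.deriv_eq, deriv_const]
  have hcs : HasCompactSupport fun u : ℝ => u * deriv Real.smoothTransition (u - 1) := by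
    refine HasCompactSupport.of_support_subset_isCompact (K := Icc 1 2) isCompact_Icc fun u hu => ?_
    by_contra h
    refine hu ?_
    have : u - 1 ∉ Icc (0 : ℝ) 1 := fun h' => h ⟨by linarith [h'.1], by linarith [h'.2]⟩
    simp only [hout _ this, mul_zero]
  obtain ⟨C, hC⟩ := hcs.exists_bound_of_continuous (continuous_id.mul (hcont.comp (by fun_prop)))
  exact ⟨C, (norm_nonneg _).trans (hC 0), hC⟩

/-- The slope of the cut-off grows with `j`, but only where `u = (j + 1) x (1 - x)` lies in `[1,2]`.
With the weight `x (1 - x)`, the chain rule gives the expression `u * deriv Real.smoothTransition (u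
- 1)` times `1 - 2x`, which is bounded uniformly in `j`. -/
theorem exists_deriv_cutoff_bound :
    ∃ C, 0 ≤ C ∧ ∀ j : ℕ, ∀ x ∈ Ioo (0 : ℝ) 1, |x * (1 - x) * deriv (cutoff j) x| ≤ C := by
  obtain ⟨C, hC0, hC⟩ := exists_deriv_smoothTransition_bound
  refine ⟨C, hC0, fun j x hx => ?_⟩
  have h1 : HasDerivAt (fun x : ℝ => (j + 1 : ℝ) * (x * (1 - x)) - 1)
      ((j + 1) * (1 - 2 * x)) x := by
    have := (((hasDerivAt_id x).mul ((hasDerivAt_id x).const_sub 1)).const_mul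
      (j + 1 : ℝ)).sub_const 1
    convert! this using 1
    simp only [id]
    ring
  have h2 : HasDerivAt Real.smoothTransition
      (deriv Real.smoothTransition ((j + 1 : ℝ) * (x * (1 - x)) - 1))
      ((j + 1 : ℝ) * (x * (1 - x)) - 1) :=
    ((Real.smoothTransition.contDiff (n := 1)).differentiable one_ne_zero _).hasDerivAt
  have h3 : deriv (cutoff j) x = _ := (h2.comp x h1).deriv
  rw [h3]
  have h4 := hC ((j + 1 : ℝ) * (x * (1 - x)))
  have h5 : |1 - 2 * x| ≤ 1 := by rw [abs_le]; constructor <;> linarith [hx.1, hx.2]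
  calc _ = |(j + 1 : ℝ) * (x * (1 - x)) * deriv Real.smoothTransition
        ((j + 1 : ℝ) * (x * (1 - x)) - 1)| * |1 - 2 * x| := by
        rw [← abs_mul]; congr 1; ring
    _ ≤ _ := mul_le_of_le_one_right (abs_nonneg _) h5 |>.trans h4

/-- The sine vanishes at both ends, so it is bounded by `|nπ|` times the distance to either end, and
the smaller of `x` and `1 - x` is at most `2x(1 - x)`. This supplies the weight that tames the
derivative of the cut-off. -/
theorem abs_sin_int_mul_pi_le (n : ℤ) {x : ℝ} (hx : x ∈ Ioo (0 : ℝ) 1) :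
    |Real.sin (n * Real.pi * x)| ≤ 2 * |n * Real.pi| * (x * (1 - x)) := by
  have h1 : |Real.sin (n * Real.pi * x)| ≤ |n * Real.pi| * x := by
    refine Real.abs_sin_le_abs.trans ?_
    rw [abs_mul, abs_of_pos hx.1]
  have h2 : |Real.sin (n * Real.pi * x)| ≤ |n * Real.pi| * (1 - x) := by
    have e : Real.sin (n * Real.pi * x) = -((-1) ^ n * Real.sin (n * Real.pi * (1 - x))) := by
      have := Real.sin_int_mul_pi_sub (n * Real.pi * (1 - x)) n
      rw [show n * Real.pi - n * Real.pi * (1 - x) = n * Real.pi * x by ring] at this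
      rw [this]
    rw [e, abs_neg, abs_mul, abs_zpow, abs_neg, abs_one, one_zpow, one_mul]
    refine Real.abs_sin_le_abs.trans ?_
    rw [abs_mul, abs_of_pos (by linarith [hx.2] : 0 < 1 - x)]
  have h0 := abs_nonneg ((n : ℝ) * Real.pi)
  rcases le_total x (1 / 2) with h | h
  · refine h1.trans ?_
    have := mul_nonneg (mul_nonneg h0 hx.1.le) (by linarith : 0 ≤ 1 - 2 * x)
    nlinarith
  · refine h2.trans ?_
    have := mul_nonneg (mul_nonneg h0 (by linarith [hx.2] : 0 ≤ 1 - x)) (by linarith : 0 ≤ 2 * x - 1)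
    nlinarith

/-! ### Tensor product test functions -/

theorem tsupport_tensor_subset (θ η : ℝ → ℝ) :
    tsupport (fun q : ℝ × ℝ => θ q.1 * η q.2) ⊆ tsupport θ ×ˢ tsupport η := by
  refine closure_minimal (fun q hq => ?_) ((isClosed_tsupport _).prod (isClosed_tsupport _))
  exact ⟨subset_tsupport _ (left_ne_zero_of_mul hq), subset_tsupport _ (right_ne_zero_of_mul hq)⟩

theorem hasCompactSupport_tensor {θ η : ℝ → ℝ} (hθ : HasCompactSupport θ)
    (hη : HasCompactSupport η) : HasCompactSupport fun q : ℝ × ℝ => θ q.1 * η q.2 :=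
  (hθ.isCompact.prod hη.isCompact).of_isClosed_subset (isClosed_tsupport _)
    (tsupport_tensor_subset θ η)

theorem contDiff_tensor {θ η : ℝ → ℝ} (hθ : ContDiff ℝ ∞ θ) (hη : ContDiff ℝ ∞ η) :
    ContDiff ℝ ∞ fun q : ℝ × ℝ => θ q.1 * η q.2 :=
  (hθ.comp contDiff_fst).mul (hη.comp contDiff_snd)

theorem fderiv_tensor_time {θ η : ℝ → ℝ} (hθ : ContDiff ℝ ∞ θ) (hη : ContDiff ℝ ∞ η)
    (q : ℝ × ℝ) : fderiv ℝ (fun q : ℝ × ℝ => θ q.1 * η q.2) q (1, 0) = deriv θ q.1 * η q.2 := by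
  have h1 := hasDerivAt_time (contDiff_tensor hθ hη) q.1 q.2
  exact h1.unique (((hθ.differentiable (by simp)) q.1).hasDerivAt.mul_const (η q.2))

theorem fderiv_tensor_space {θ η : ℝ → ℝ} (hθ : ContDiff ℝ ∞ θ) (hη : ContDiff ℝ ∞ η)
    (q : ℝ × ℝ) : fderiv ℝ (fun q : ℝ × ℝ => θ q.1 * η q.2) q (0, 1) = θ q.1 * deriv η q.2 := by
  have h1 := hasDerivAt_space (contDiff_tensor hθ hη) q.1 q.2
  exact h1.unique (((hη.differentiable (by simp)) q.2).hasDerivAt.const_mul (θ q.1))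

theorem integrable_tensor_strip {θ η : ℝ → ℝ} (hθ : Continuous θ) (hc : HasCompactSupport θ)
    (hη : Continuous η) : Integrable (fun q : ℝ × ℝ => θ q.1 * η q.2) stripMeasure := by
  rw [stripMeasure_eq_prod]
  exact (hθ.integrable_of_hasCompactSupport hc).restrict.mul_prod
    (hη.integrableOn_Icc.mono_set Ioo_subset_Icc_self)

theorem integrable_mul_tensor {F : ℝ × ℝ → ℝ} {C : ℝ} (hF : AEStronglyMeasurable F stripMeasure)
    (hC : ∀ᵐ q ∂stripMeasure, |F q| ≤ C) {θ η : ℝ → ℝ} (hθ : Continuous θ)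
    (hc : HasCompactSupport θ) (hη : Continuous η) :
    Integrable (fun q : ℝ × ℝ => F q * (θ q.1 * η q.2)) stripMeasure :=
  (integrable_tensor_strip hθ hc hη).bdd_mul hF hC

theorem integral_mul_tensor {F : ℝ × ℝ → ℝ} {C : ℝ} (hF : AEStronglyMeasurable F stripMeasure)
    (hC : ∀ᵐ q ∂stripMeasure, |F q| ≤ C) {θ η : ℝ → ℝ} (hθ : Continuous θ)
    (hc : HasCompactSupport θ) (hη : Continuous η) :
    ∫ q, F q * (θ q.1 * η q.2) ∂stripMeasure =
      ∫ t in Ioi (0 : ℝ), (∫ x in Ioo (0 : ℝ) 1, F (t, x) * η x) * θ t := by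
  rw [integral_strip (integrable_mul_tensor hF hC hθ hc hη)]
  congr 1
  ext t
  rw [← integral_mul_const]
  congr 1
  ext x
  ring

theorem integral_mul_tensor_symm {F : ℝ × ℝ → ℝ} {C : ℝ}
    (hF : AEStronglyMeasurable F stripMeasure)
    (hC : ∀ᵐ q ∂stripMeasure, |F q| ≤ C) {θ η : ℝ → ℝ} (hθ : Continuous θ)
    (hc : HasCompactSupport θ) (hη : Continuous η) :
    ∫ q, F q * (θ q.1 * η q.2) ∂stripMeasure =
      ∫ x in Ioo (0 : ℝ) 1, (∫ t in Ioi (0 : ℝ), F (t, x) * θ t) * η x := by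
  rw [integral_strip_symm (integrable_mul_tensor hF hC hθ hc hη)]
  congr 1
  ext x
  rw [← integral_mul_const]
  congr 1
  ext t
  ring

theorem tendsto_integral_mul_tensor {F : ℝ × ℝ → ℝ} {C : ℝ}
    (hF : AEStronglyMeasurable F stripMeasure)
    (hC : ∀ᵐ q ∂stripMeasure, |F q| ≤ C) {θ : ℝ → ℝ} (hθ : Continuous θ)
    (hc : HasCompactSupport θ) {ηs : ℕ → ℝ → ℝ} {η : ℝ → ℝ} {B : ℝ} (hηs : ∀ j, Continuous (ηs j))
    (hB : ∀ j, ∀ x ∈ Ioo (0 : ℝ) 1, |ηs j x| ≤ B)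
    (hlim : ∀ x ∈ Ioo (0 : ℝ) 1, Tendsto (fun j => ηs j x) atTop (𝓝 (η x))) :
    Tendsto (fun j => ∫ q, F q * (θ q.1 * ηs j q.2) ∂stripMeasure) atTop
      (𝓝 (∫ q, F q * (θ q.1 * η q.2) ∂stripMeasure)) := by
  have hstrip : ∀ᵐ q ∂stripMeasure, q ∈ strip := ae_restrict_mem measurableSet_strip
  refine tendsto_integral_of_dominated_convergence (fun q => C * (|θ q.1| * B))
    (fun j => (integrable_mul_tensor hF hC hθ hc (hηs j)).aestronglyMeasurable) ?_ (fun j => ?_) ?_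
  · exact (integrable_tensor_strip hθ.abs hc.abs continuous_const).const_mul C
  · filter_upwards [hC, hstrip] with q hq hqs
    rw [Real.norm_eq_abs, abs_mul, abs_mul]
    exact mul_le_mul hq (mul_le_mul_of_nonneg_left (hB j _ hqs.2) (abs_nonneg _))
      (by positivity) ((abs_nonneg _).trans hq)
  · filter_upwards [hstrip] with q hqs
    exact ((hlim _ hqs.2).const_mul _).const_mul _

/-! ### Sine coefficients of the difference of two solutions -/

/-- A weak solution `w` of `w_tt = w_xx - f` on the strip with zero initial and boundary data,
all of whose derivatives are bounded. -/
structure IsNullSolution (w wt wx f : ℝ × ℝ → ℝ) (C : ℝ) : Prop where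
  continuous : Continuous w
  ae_abs_le : ∀ᵐ q ∂stripMeasure, |w q| ≤ C
  left : ∀ t, 0 ≤ t → w (t, 0) = 0
  right : ∀ t, 0 ≤ t → w (t, 1) = 0
  initial : ∀ x ∈ Icc (0 : ℝ) 1, w (0, x) = 0
  measurable_time : Measurable wt
  measurable_space : Measurable wx
  measurable_source : Measurable f
  abs_time_le : ∀ q, |wt q| ≤ C
  abs_space_le : ∀ q, |wx q| ≤ C
  abs_source_le : ∀ q, |f q| ≤ C
  weak_time : HasWeakDeriv strip (1, 0) w wt
  weak_space : HasWeakDeriv strip (0, 1) w wx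
  weak_equation : ∀ φ : ℝ × ℝ → ℝ, ContDiff ℝ ∞ φ → HasCompactSupport φ →
    tsupport φ ⊆ (univ : Set ℝ) ×ˢ Ioo (0 : ℝ) 1 →
    ∫ q, (wt q * fderiv ℝ φ q (1, 0) - wx q * fderiv ℝ φ q (0, 1) - f q * φ q) ∂stripMeasure = 0

/-- The `n`-th sine coefficient of `F(t,·)`. -/
noncomputable def sineCoeff (F : ℝ × ℝ → ℝ) (n : ℤ) (t : ℝ) : ℝ :=
  ∫ x in Ioo (0 : ℝ) 1, F (t, x) * Real.sin (n * Real.pi * x)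

theorem measurable_integral_Ioo {F : ℝ × ℝ → ℝ} (hF : Measurable F) :
    Measurable fun t => ∫ x in Ioo (0 : ℝ) 1, F (t, x) :=
  (StronglyMeasurable.integral_prod_right' (f := F) hF.stronglyMeasurable).measurable

theorem abs_setIntegral_Ioo_le {h : ℝ → ℝ} {C : ℝ} (hC : ∀ x, |h x| ≤ C) :
    |∫ x in Ioo (0 : ℝ) 1, h x| ≤ C := by
  rw [setIntegral_Ioo_eq_intervalIntegral zero_le_one]
  simpa using intervalIntegral.norm_integral_le_of_norm_le_const (f := h) (a := 0) (b := 1)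
    fun x _ => hC x

theorem measurable_sineCoeff {F : ℝ × ℝ → ℝ} (hF : Measurable F) (n : ℤ) :
    Measurable (sineCoeff F n) :=
  measurable_integral_Ioo (F := fun q => F q * Real.sin (n * Real.pi * q.2))
    (hF.mul (by fun_prop))

theorem abs_mul_sin_le {a C : ℝ} (h : |a| ≤ C) (y : ℝ) : |a * Real.sin y| ≤ C := by
  rw [abs_mul]
  exact (mul_le_of_le_one_right (abs_nonneg _) (Real.abs_sin_le_one y)).trans h

theorem abs_sineCoeff_le {F : ℝ × ℝ → ℝ} {C : ℝ} (hC : ∀ q, |F q| ≤ C) (n : ℤ) (t : ℝ) :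
    |sineCoeff F n t| ≤ C :=
  abs_setIntegral_Ioo_le fun x => abs_mul_sin_le (hC (t, x)) _

theorem continuous_sineCoeff {w : ℝ × ℝ → ℝ} (hw : Continuous w) (n : ℤ) :
    Continuous (sineCoeff w n) := by
  simp only [funext fun t => show sineCoeff w n t = _ from
    setIntegral_Ioo_eq_intervalIntegral zero_le_one]
  exact intervalIntegral.continuous_parametric_intervalIntegral_of_continuous'
    (f := fun t x => w (t, x) * Real.sin (n * Real.pi * x)) (by
      simp only [Function.uncurry_def]; fun_prop) 0 1

theorem contDiff_sin_mul (c : ℝ) : ContDiff ℝ ∞ fun x => Real.sin (c * x) :=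
  Real.contDiff_sin.comp (contDiff_const.mul contDiff_id)

theorem contDiff_cos_mul (c : ℝ) : ContDiff ℝ ∞ fun x => Real.cos (c * x) :=
  Real.contDiff_cos.comp (contDiff_const.mul contDiff_id)

theorem hasDerivAt_sin_mul (c x : ℝ) :
    HasDerivAt (fun x => Real.sin (c * x)) (c * Real.cos (c * x)) x := by
  have := ((hasDerivAt_id x).const_mul c).sin
  simp only [id] at this
  convert! this using 1
  ring

theorem hasDerivAt_cos_mul (c x : ℝ) :
    HasDerivAt (fun x => Real.cos (c * x)) (-(c * Real.sin (c * x))) x := by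
  have := ((hasDerivAt_id x).const_mul c).cos
  simp only [id] at this
  convert! this using 1
  ring

theorem tsupport_mul_cutoff_subset (s : ℝ → ℝ) (j : ℕ) :
    tsupport (fun x => s x * cutoff j x) ⊆ Ioo 0 1 :=
  (closure_mono (Function.support_mul_subset_right _ _)).trans (tsupport_cutoff_subset_Ioo j)

namespace IsNullSolution

variable {w wt wx f : ℝ × ℝ → ℝ} {C : ℝ}

/-- The displacement coefficient is the primitive of the velocity coefficient (weak form). -/
theorem weak_coeff_time (h : IsNullSolution w wt wx f C) (n : ℤ) {θ : ℝ → ℝ} (hθ : ContDiff ℝ ∞ θ)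
    (hc : HasCompactSupport θ) (hs : tsupport θ ⊆ Ioi 0) :
    ∫ t in Ioi (0 : ℝ), sineCoeff w n t * deriv θ t =
      -∫ t in Ioi (0 : ℝ), sineCoeff wt n t * θ t := by
  have hwm := h.continuous.aestronglyMeasurable (μ := stripMeasure)
  have htm := h.measurable_time.aestronglyMeasurable (μ := stripMeasure)
  have htb : ∀ᵐ q ∂stripMeasure, |wt q| ≤ C := Eventually.of_forall h.abs_time_le
  have hθ' : ContDiff ℝ ∞ (deriv θ) := (contDiff_infty_iff_deriv.1 hθ).2
  set s : ℝ → ℝ := fun x => Real.sin (n * Real.pi * x) with hsdef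
  have hss : ContDiff ℝ ∞ s := contDiff_sin_mul _
  -- A sine mode is not compactly supported in `(0,1)`, so it is cut off and `j` tends to infinity.
  -- Only time derivatives occur here, hence none falls on the cut-off.
  have hη : ∀ j, ContDiff ℝ ∞ fun x => s x * cutoff j x := fun j => hss.mul (contDiff_cutoff j)
  have hb : ∀ j, ∀ x ∈ Ioo (0 : ℝ) 1, |s x * cutoff j x| ≤ 1 := fun j x _ => by
    rw [abs_mul]
    exact mul_le_one₀ (Real.abs_sin_le_one _) (abs_nonneg _) (abs_cutoff_le j x)
  have hl : ∀ x ∈ Ioo (0 : ℝ) 1, Tendsto (fun j => s x * cutoff j x) atTop (𝓝 (s x)) :=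
    fun x hx => by simpa using (tendsto_cutoff hx).const_mul (s x)
  have l1 := tendsto_integral_mul_tensor hwm h.ae_abs_le hθ'.continuous hc.deriv
    (fun j => (hη j).continuous) hb hl
  have l2 := (tendsto_integral_mul_tensor htm htb hθ.continuous hc
    (fun j => (hη j).continuous) hb hl).neg
  have heq : ∀ j, ∫ q, w q * (deriv θ q.1 * (s q.2 * cutoff j q.2)) ∂stripMeasure =
      -∫ q, wt q * (θ q.1 * (s q.2 * cutoff j q.2)) ∂stripMeasure := by
    intro j
    have hcs : HasCompactSupport fun x => s x * cutoff j x :=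
      HasCompactSupport.mul_left (f := s) (hasCompactSupport_cutoff j)
    have := h.weak_time _ (contDiff_tensor hθ (hη j)) (hasCompactSupport_tensor (η := fun x => s x * cutoff j x) hc hcs)
      ((tsupport_tensor_subset θ fun x => s x * cutoff j x).trans (prod_mono hs (tsupport_mul_cutoff_subset s j)))
    simp only [fderiv_tensor_time hθ (hη j)] at this
    exact this
  have := tendsto_nhds_unique (l1.congr heq) l2
  rwa [integral_mul_tensor hwm h.ae_abs_le hθ'.continuous hc.deriv hss.continuous,
    integral_mul_tensor htm htb hθ.continuous hc hss.continuous] at this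

/-- The weak equation tested with a sine mode. -/
theorem weak_coeff_equation (h : IsNullSolution w wt wx f C) (n : ℤ) {θ : ℝ → ℝ}
    (hθ : ContDiff ℝ ∞ θ) (hc : HasCompactSupport θ) :
    ∫ t in Ioi (0 : ℝ), sineCoeff wt n t * deriv θ t =
      ∫ t in Ioi (0 : ℝ), (n * Real.pi * (∫ x in Ioo (0 : ℝ) 1,
        wx (t, x) * Real.cos (n * Real.pi * x)) + sineCoeff f n t) * θ t := by
  have htm := h.measurable_time.aestronglyMeasurable (μ := stripMeasure)
  have htb : ∀ᵐ q ∂stripMeasure, |wt q| ≤ C := Eventually.of_forall h.abs_time_le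
  have hxm := h.measurable_space.aestronglyMeasurable (μ := stripMeasure)
  have hxb : ∀ᵐ q ∂stripMeasure, |wx q| ≤ C := Eventually.of_forall h.abs_space_le
  have hfm := h.measurable_source.aestronglyMeasurable (μ := stripMeasure)
  have hfb : ∀ᵐ q ∂stripMeasure, |f q| ≤ C := Eventually.of_forall h.abs_source_le
  have hθ' : ContDiff ℝ ∞ (deriv θ) := (contDiff_infty_iff_deriv.1 hθ).2
  set ν : ℝ := n * Real.pi with hν
  set s : ℝ → ℝ := fun x => Real.sin (ν * x) with hsdef
  have hss : ContDiff ℝ ∞ s := contDiff_sin_mul _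
  have hη : ∀ j, ContDiff ℝ ∞ fun x => s x * cutoff j x := fun j => hss.mul (contDiff_cutoff j)
  have hb : ∀ j, ∀ x ∈ Ioo (0 : ℝ) 1, |s x * cutoff j x| ≤ 1 := fun j x _ => by
    rw [abs_mul]
    exact mul_le_one₀ (Real.abs_sin_le_one _) (abs_nonneg _) (abs_cutoff_le j x)
  have hl : ∀ x ∈ Ioo (0 : ℝ) 1, Tendsto (fun j => s x * cutoff j x) atTop (𝓝 (s x)) :=
    fun x hx => by simpa using (tendsto_cutoff hx).const_mul (s x)
  have hder : ∀ j x, deriv (fun x => s x * cutoff j x) x =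
      ν * Real.cos (ν * x) * cutoff j x + s x * deriv (cutoff j) x := fun j x =>
    ((hasDerivAt_sin_mul ν x).mul
      (((contDiff_cutoff j).differentiable (by simp)) x).hasDerivAt).deriv
  obtain ⟨B, hB0, hB⟩ := exists_deriv_cutoff_bound
  -- The critical term is the sine times the derivative of the cut-off. It is bounded uniformly in
  -- `j` because the sine vanishes at the ends, and it tends to zero pointwise; so no boundary term
  -- survives in the limit.
  have hb' : ∀ j, ∀ x ∈ Ioo (0 : ℝ) 1, |deriv (fun x => s x * cutoff j x) x| ≤
      |ν| + 2 * |ν| * B := by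
    intro j x hx
    rw [hder]
    refine (abs_add_le _ _).trans (add_le_add ?_ ?_)
    · rw [abs_mul, abs_mul]
      have h1 : |ν| * |Real.cos (ν * x)| ≤ |ν| :=
        mul_le_of_le_one_right (abs_nonneg _) (Real.abs_cos_le_one _)
      exact (mul_le_of_le_one_right (by positivity) (abs_cutoff_le j x)).trans h1
    · have h1 := abs_sin_int_mul_pi_le n hx
      have h2 := hB j x hx
      have h3 : 0 ≤ x * (1 - x) := mul_nonneg hx.1.le (by linarith [hx.2])
      rw [abs_mul, abs_of_nonneg h3] at h2
      rw [abs_mul]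
      calc _ ≤ 2 * |ν| * (x * (1 - x)) * |deriv (cutoff j) x| :=
            mul_le_mul_of_nonneg_right h1 (abs_nonneg _)
        _ = 2 * |ν| * (x * (1 - x) * |deriv (cutoff j) x|) := by ring
        _ ≤ _ := mul_le_mul_of_nonneg_left h2 (by positivity)
  have hl' : ∀ x ∈ Ioo (0 : ℝ) 1, Tendsto (fun j => deriv (fun x => s x * cutoff j x) x) atTop
      (𝓝 (ν * Real.cos (ν * x))) := by
    intro x hx
    simp only [hder]
    simpa using ((tendsto_cutoff hx).const_mul (ν * Real.cos (ν * x))).add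
      ((tendsto_deriv_cutoff hx).const_mul (s x))
  have hηd : ∀ j, Continuous (deriv fun x => s x * cutoff j x) := fun j =>
    ((hη j).of_le (by simp : (1 : WithTop ℕ∞) ≤ ∞)).continuous_deriv le_rfl
  have hcc : Continuous fun x => ν * Real.cos (ν * x) := by fun_prop
  have l1 := tendsto_integral_mul_tensor htm htb hθ'.continuous hc.deriv
    (fun j => (hη j).continuous) hb hl
  have l2 := tendsto_integral_mul_tensor hxm hxb hθ.continuous hc hηd hb' hl'
  have l3 := tendsto_integral_mul_tensor hfm hfb hθ.continuous hc
    (fun j => (hη j).continuous) hb hl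
  have heq : ∀ j, ∫ q, wt q * (deriv θ q.1 * (s q.2 * cutoff j q.2)) ∂stripMeasure =
      ∫ q, wx q * (θ q.1 * deriv (fun x => s x * cutoff j x) q.2) ∂stripMeasure +
      ∫ q, f q * (θ q.1 * (s q.2 * cutoff j q.2)) ∂stripMeasure := by
    intro j
    have hcs : HasCompactSupport fun x => s x * cutoff j x :=
      HasCompactSupport.mul_left (f := s) (hasCompactSupport_cutoff j)
    have := h.weak_equation _ (contDiff_tensor hθ (hη j)) (hasCompactSupport_tensor (η := fun x => s x * cutoff j x) hc hcs)
      ((tsupport_tensor_subset θ fun x => s x * cutoff j x).trans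
        (prod_mono (subset_univ _) (tsupport_mul_cutoff_subset s j)))
    simp only [fderiv_tensor_time hθ (hη j), fderiv_tensor_space hθ (hη j)] at this
    have i1 := integrable_mul_tensor htm htb hθ'.continuous hc.deriv (hη j).continuous
    have i2 := integrable_mul_tensor hxm hxb hθ.continuous hc (hηd j)
    have i3 := integrable_mul_tensor hfm hfb hθ.continuous hc (hη j).continuous
    have i12 : Integrable (fun q => wt q * (deriv θ q.1 * (s q.2 * cutoff j q.2)) -
        wx q * (θ q.1 * deriv (fun x => s x * cutoff j x) q.2)) stripMeasure := i1.sub i2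
    rw [integral_sub i12 i3, integral_sub i1 i2] at this
    linarith
  have := tendsto_nhds_unique (l1.congr heq) (l2.add l3)
  rw [← integral_add (integrable_mul_tensor hxm hxb hθ.continuous hc hcc)
    (integrable_mul_tensor hfm hfb hθ.continuous hc hss.continuous),
    integral_mul_tensor htm htb hθ'.continuous hc.deriv hss.continuous] at this
  refine this.trans ?_
  rw [integral_strip ((integrable_mul_tensor hxm hxb hθ.continuous hc hcc).fun_add
    (integrable_mul_tensor hfm hfb hθ.continuous hc hss.continuous))]
  congr 1
  ext t
  have j1 : IntegrableOn (fun x => wx (t, x) * Real.cos (ν * x)) (Ioo 0 1) :=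
    ((by fun_prop : Continuous fun x => Real.cos (ν * x)).integrableOn_Icc.mono_set
      Ioo_subset_Icc_self).bdd_mul
      (h.measurable_space.comp measurable_prodMk_left).aestronglyMeasurable
      (Eventually.of_forall fun x => h.abs_space_le (t, x))
  have j2 : IntegrableOn (fun x => f (t, x) * s x) (Ioo 0 1) :=
    (hss.continuous.integrableOn_Icc.mono_set Ioo_subset_Icc_self).bdd_mul
      (h.measurable_source.comp measurable_prodMk_left).aestronglyMeasurable
      (Eventually.of_forall fun x => h.abs_source_le (t, x))
  rw [add_mul, sineCoeff, ← integral_const_mul, ← integral_mul_const, ← integral_mul_const,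
    ← integral_add ((j1.const_mul ν).mul_const (θ t)) (j2.mul_const (θ t))]
  congr 1
  ext x
  ring

/-- The cosine coefficient of the strain in terms of the sine coefficient of the displacement. -/
theorem weak_coeff_space (h : IsNullSolution w wt wx f C) (n : ℤ) {θ : ℝ → ℝ}
    (hθ : ContDiff ℝ ∞ θ) (hc : HasCompactSupport θ) (hs : tsupport θ ⊆ Ioi 0) :
    ∫ t in Ioi (0 : ℝ), (∫ x in Ioo (0 : ℝ) 1, wx (t, x) * Real.cos (n * Real.pi * x)) * θ t =
      ∫ t in Ioi (0 : ℝ), n * Real.pi * sineCoeff w n t * θ t := by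
  have hwm := h.continuous.aestronglyMeasurable (μ := stripMeasure)
  have hxm := h.measurable_space.aestronglyMeasurable (μ := stripMeasure)
  have hxb : ∀ᵐ q ∂stripMeasure, |wx q| ≤ C := Eventually.of_forall h.abs_space_le
  set ν : ℝ := n * Real.pi with hν
  obtain ⟨T, hT, hT0⟩ : ∃ T : ℝ, 0 < T ∧ ∀ t, T ≤ t → θ t = 0 := by
    obtain ⟨R, hR⟩ := hc.isCompact.isBounded.subset_closedBall 0
    refine ⟨max R 0 + 1, by positivity, fun t ht => ?_⟩
    refine image_eq_zero_of_notMem_tsupport fun h' => ?_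
    have h1 := hR h'
    rw [mem_closedBall_zero_iff, Real.norm_eq_abs] at h1
    linarith [le_max_left R 0, le_abs_self t]
  -- Averaging in time against `θ` leaves functions of `x` alone, with `V` the weak derivative of
  -- `W`. The Dirichlet conditions give `W 0 = W 1 = 0`, so integration by parts against a cosine,
  -- which does not vanish at the ends, has no boundary terms.
  set W : ℝ → ℝ := fun x => ∫ t in Ioi (0 : ℝ), w (t, x) * θ t with hW
  set V : ℝ → ℝ := fun x => ∫ t in Ioi (0 : ℝ), wx (t, x) * θ t with hV
  have hWc : Continuous W := by
    have : W = fun x => ∫ t in (0 : ℝ)..T, w (t, x) * θ t := funext fun x =>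
      setIntegral_Ioi_eq_intervalIntegral hT.le fun t ht => by rw [hT0 t ht, mul_zero]
    rw [this]
    have hθc := hθ.continuous
    have hwc := h.continuous
    exact intervalIntegral.continuous_parametric_intervalIntegral_of_continuous'
      (f := fun x t => w (t, x) * θ t) (by
        simp only [Function.uncurry_def]; fun_prop) 0 T
  have hVi : IntegrableOn V (Ioo 0 1) := by
    have i1 := integrable_mul_tensor hxm hxb hθ.continuous hc
      (continuous_const (y := (1 : ℝ)))
    rw [stripMeasure_eq_prod] at i1
    have i2 := i1.integral_prod_right
    simp only [mul_one] at i2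
    exact i2
  have hWV : HasWeakDeriv (Ioo 0 1) 1 W V := by
    intro η h1 h2 h3
    have h1' : ContDiff ℝ ∞ (deriv η) := (contDiff_infty_iff_deriv.1 h1).2
    have := h.weak_space _ (contDiff_tensor hθ h1) (hasCompactSupport_tensor hc h2)
      ((tsupport_tensor_subset _ _).trans (prod_mono hs h3))
    simp only [fderiv_tensor_space hθ h1] at this
    simp only [fderiv_apply_one_eq_deriv]
    exact (integral_mul_tensor_symm hwm h.ae_abs_le hθ.continuous hc h1'.continuous).symm.trans
      (this.trans (congrArg Neg.neg
        (integral_mul_tensor_symm hxm hxb hθ.continuous hc h1.continuous)))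
  have hprim := hWV.eq_primitive zero_lt_one hWc.continuousOn hVi
  have hW0 : W 0 = 0 := by
    refine setIntegral_eq_zero_of_forall_eq_zero fun t ht => ?_
    rw [h.left t (le_of_lt ht), zero_mul]
  have hW1 : W 1 = 0 := by
    refine setIntegral_eq_zero_of_forall_eq_zero fun t ht => ?_
    rw [h.right t (le_of_lt ht), zero_mul]
  have hibp := integral_mul_deriv_of_primitive (a := 0) (b := 1) (F := W) (f := V)
    (φ := fun x => Real.cos (ν * x))
    (by rwa [intervalIntegrable_iff_integrableOn_Ioo_of_le zero_le_one])
    (fun t ht => hprim t (by rwa [uIcc_of_le zero_le_one] at ht))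
    ((contDiff_cos_mul ν).of_le (by simp))
  rw [hW0, hW1, ← setIntegral_Ioo_eq_intervalIntegral zero_le_one,
    ← setIntegral_Ioo_eq_intervalIntegral zero_le_one] at hibp
  simp only [(hasDerivAt_cos_mul ν _).deriv] at hibp
  have hcosc : Continuous fun x => Real.cos (ν * x) := by fun_prop
  have hsinc : Continuous fun x => -(ν * Real.sin (ν * x)) := by fun_prop
  have e1 := (integral_mul_tensor_symm hwm h.ae_abs_le hθ.continuous hc hsinc).symm.trans
    (integral_mul_tensor hwm h.ae_abs_le hθ.continuous hc hsinc)
  have e2 := (integral_mul_tensor_symm hxm hxb hθ.continuous hc hcosc).symm.trans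
    (integral_mul_tensor hxm hxb hθ.continuous hc hcosc)
  rw [← e2]
  have e3 : ∫ t in Ioi (0 : ℝ), ν * sineCoeff w n t * θ t =
      -∫ t in Ioi (0 : ℝ), (∫ x in Ioo (0 : ℝ) 1, w (t, x) * -(ν * Real.sin (ν * x))) * θ t := by
    rw [← integral_neg]
    congr 1
    ext t
    rw [sineCoeff, ← neg_mul, ← integral_neg, ← integral_const_mul]
    congr 2
    ext x
    ring
  rw [e3, ← e1, hibp]
  ring

/-- By `weak_coeff_time` the coefficient of `w` has that of `wt` as weak derivative. It is also
continuous and zero at time `0`, so it is the primitive at every time. -/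
theorem sineCoeff_eq_integral (h : IsNullSolution w wt wx f C) (n : ℤ) {t : ℝ} (ht : 0 ≤ t) :
    sineCoeff w n t = ∫ s in (0 : ℝ)..t, sineCoeff wt n s := by
  rcases ht.eq_or_lt with rfl | ht
  · rw [intervalIntegral.integral_same]
    refine setIntegral_eq_zero_of_forall_eq_zero fun x hx => ?_
    rw [h.initial x (Ioo_subset_Icc_self hx), zero_mul]
  have h0 : sineCoeff w n 0 = 0 := by
    refine setIntegral_eq_zero_of_forall_eq_zero fun x hx => ?_
    rw [h.initial x (Ioo_subset_Icc_self hx), zero_mul]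
  have hi : IntegrableOn (sineCoeff wt n) (Ioo 0 t) :=
    Measure.integrableOn_of_bounded (M := C) (by simp)
      (measurable_sineCoeff h.measurable_time n).aestronglyMeasurable
      (Eventually.of_forall fun s => abs_sineCoeff_le h.abs_time_le n s)
  have hwd : HasWeakDeriv (Ioo 0 t) 1 (sineCoeff w n) (sineCoeff wt n) := by
    intro θ h1 h2 h3
    have := h.weak_coeff_time n h1 h2 (h3.trans Ioo_subset_Ioi_self)
    simp only [fderiv_apply_one_eq_deriv]
    have hz : ∀ s, s ∈ Ioi (0 : ℝ) \ Ioo 0 t → θ s = 0 ∧ deriv θ s = 0 := fun s hs =>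
      ⟨image_eq_zero_of_notMem_tsupport fun h' => hs.2 (h3 h'),
        image_eq_zero_of_notMem_tsupport fun h' => hs.2 (h3 (tsupport_deriv_subset h'))⟩
    rwa [setIntegral_eq_of_subset_of_forall_sdiff_eq_zero measurableSet_Ioi Ioo_subset_Ioi_self
        (fun s hs => by rw [(hz s hs).2, mul_zero]),
      setIntegral_eq_of_subset_of_forall_sdiff_eq_zero measurableSet_Ioi Ioo_subset_Ioi_self
        (fun s hs => by rw [(hz s hs).1, mul_zero])] at this
  rw [hwd.eq_primitive ht (continuous_sineCoeff h.continuous n).continuousOn hi t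
    (right_mem_Icc.2 ht.le), h0, zero_add]

end IsNullSolution

/-! ### Energy estimate for one mode and Gronwall's inequality -/

theorem intervalIntegral_mono_ae {f g : ℝ → ℝ} {a b : ℝ} (hab : a ≤ b)
    (hf : IntervalIntegrable f volume a b) (hg : IntervalIntegrable g volume a b)
    (h : ∀ᵐ t, t ∈ Ioc a b → f t ≤ g t) : ∫ t in a..b, f t ≤ ∫ t in a..b, g t := by
  rw [intervalIntegral.integral_of_le hab, intervalIntegral.integral_of_le hab]
  exact setIntegral_mono_ae_restrict hf.1 hg.1 ((ae_restrict_iff' measurableSet_Ioc).2 h)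

theorem setIntegral_indicator_mul {F η : ℝ → ℝ} {T : ℝ}
    (hη : ∀ t, t ∉ Ioo (-1) T → η t = 0) :
    ∫ t in Ioo (-1) T, (Ioi (0 : ℝ)).indicator F t * η t = ∫ t in Ioi (0 : ℝ), F t * η t := by
  rw [setIntegral_eq_integral_of_forall_compl_eq_zero (fun t ht => by rw [hη t ht, mul_zero]),
    ← integral_indicator measurableSet_Ioi]
  congr 1
  ext t
  by_cases h : t ∈ Ioi (0 : ℝ)
  · rw [indicator_of_mem h, indicator_of_mem h]
  · rw [indicator_of_notMem h, indicator_of_notMem h, zero_mul]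

/-- A function on `(0,∞)` vanishing initially in the weak sense is the primitive of its weak
derivative. -/
theorem ae_eq_neg_integral_of_weak {A E : ℝ → ℝ} {C : ℝ} (hA : Measurable A)
    (hAb : ∀ t, |A t| ≤ C) (hE : Measurable E) (hEb : ∀ t, |E t| ≤ C)
    (h : ∀ θ : ℝ → ℝ, ContDiff ℝ ∞ θ → HasCompactSupport θ →
      ∫ t in Ioi (0 : ℝ), A t * deriv θ t = ∫ t in Ioi (0 : ℝ), E t * θ t) {T : ℝ} (hT : 0 < T) :
    ∀ᵐ t, t ∈ Ioo 0 T → A t = -∫ s in (0 : ℝ)..t, E s := by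
  have hC : 0 ≤ C := (abs_nonneg _).trans (hAb 0)
  have hbi : ∀ {F : ℝ → ℝ}, (∀ t, |F t| ≤ C) → ∀ t, |(Ioi (0 : ℝ)).indicator F t| ≤ C := by
    intro F hF t
    by_cases ht : t ∈ Ioi (0 : ℝ)
    · rw [indicator_of_mem ht]; exact hF t
    · rw [indicator_of_notMem ht, abs_zero]; exact hC
  have hAm := hA.indicator (measurableSet_Ioi (a := (0 : ℝ)))
  have hEm := hE.indicator (measurableSet_Ioi (a := (0 : ℝ)))
  have hAi : IntegrableOn ((Ioi (0 : ℝ)).indicator A) (Ioo (-1) T) :=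
    Measure.integrableOn_of_bounded (M := C) (by simp) hAm.aestronglyMeasurable
      (Eventually.of_forall (hbi hAb))
  have hEi : IntegrableOn (fun t => -(Ioi (0 : ℝ)).indicator E t) (Ioo (-1) T) :=
    (Measure.integrableOn_of_bounded (M := C) (by simp) hEm.aestronglyMeasurable
      (Eventually.of_forall (hbi hEb))).neg
  -- The hypothesis admits test functions that do not vanish at `0`. Hence the extension by zero to
  -- negative times has no jump at `0`, and the constant of integration can be read off on `(-1,
  -- 0)`.
  have hwd : HasWeakDeriv (Ioo (-1) T) 1 ((Ioi (0 : ℝ)).indicator A)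
      (fun t => -(Ioi (0 : ℝ)).indicator E t) := by
    intro θ h1 h2 h3
    simp only [fderiv_apply_one_eq_deriv, neg_mul]
    rw [integral_neg, neg_neg, setIntegral_indicator_mul fun t ht =>
        image_eq_zero_of_notMem_tsupport fun h' => ht (h3 (tsupport_deriv_subset h')),
      setIntegral_indicator_mul fun t ht => image_eq_zero_of_notMem_tsupport fun h' => ht (h3 h')]
    exact h θ h1 h2
  obtain ⟨c, hc⟩ := hwd.ae_eq_primitive (by linarith) hAi hEi
  have hint : ∀ a b : ℝ, IntervalIntegrable (fun t => -(Ioi (0 : ℝ)).indicator E t) volume a b :=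
    fun a b => (intervalIntegrable_of_bounded hEm (hbi hEb) a b).neg
  have hneg : ∀ t, t ≤ 0 → ∫ s in (-1 : ℝ)..t, -(Ioi (0 : ℝ)).indicator E s = 0 := by
    intro t ht
    refine intervalIntegral.integral_zero_ae (Eventually.of_forall fun s hs => ?_)
    have : s ≤ max (-1) t := hs.2
    rw [indicator_of_notMem (fun h' => ?_), neg_zero]
    have : max (-1) t ≤ 0 := max_le (by norm_num) ht
    linarith [mem_Ioi.1 h']
  have hc0 : c = 0 := by
    by_contra hne
    have : ∀ᵐ t : ℝ, t ∉ Ioo (-1 : ℝ) 0 := by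
      filter_upwards [hc] with t ht htm
      have := ht ⟨htm.1, htm.2.trans hT⟩
      rw [hneg t htm.2.le, add_zero, indicator_of_notMem (notMem_Ioi.2 htm.2.le)] at this
      exact hne this.symm
    rw [ae_iff] at this
    simp only [not_not] at this
    have h2 : volume (Ioo (-1 : ℝ) 0) = 0 := this
    rw [Real.volume_Ioo] at h2
    norm_num at h2
  filter_upwards [hc] with t ht htm
  have := ht ⟨by linarith [htm.1], htm.2⟩
  rw [indicator_of_mem (mem_Ioi.2 htm.1), hc0, zero_add,
    ← intervalIntegral.integral_add_adjacent_intervals (hint (-1) 0) (hint 0 t), hneg 0 le_rfl,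
    zero_add, intervalIntegral.integral_neg] at this
  rw [this]
  congr 1
  refine intervalIntegral.integral_congr_ae (Eventually.of_forall fun s hs => ?_)
  rw [uIoc_of_le htm.1.le] at hs
  exact indicator_of_mem (mem_Ioi.2 hs.1) _

/-- Energy estimate for a forced harmonic oscillator starting at rest. -/
theorem ae_sq_le_of_oscillator {A D F : ℝ → ℝ} {ν C T : ℝ} (hA : Measurable A)
    (hAb : ∀ t, |A t| ≤ C) (hF : Measurable F) (hFb : ∀ t, |F t| ≤ C) (hD : Continuous D)
    (hDA : ∀ t, 0 ≤ t → D t = ∫ s in (0 : ℝ)..t, A s)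
    (hAD : ∀ᵐ t, t ∈ Ioo 0 T → A t = -∫ s in (0 : ℝ)..t, (ν ^ 2 * D s + F s)) :
    ∀ᵐ t, t ∈ Ioo 0 T → A t ^ 2 ≤ ∫ s in (0 : ℝ)..t, (A s ^ 2 + F s ^ 2) := by
  set P : ℝ → ℝ := fun t => -∫ s in (0 : ℝ)..t, (ν ^ 2 * D s + F s) with hP
  have hAi : ∀ a b, IntervalIntegrable A volume a b := intervalIntegrable_of_bounded hA hAb
  have hFi : ∀ a b, IntervalIntegrable F volume a b := intervalIntegrable_of_bounded hF hFb
  have hsrc : ∀ a b, IntervalIntegrable (fun s => -(ν ^ 2 * D s + F s)) volume a b := fun a b =>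
    (((continuous_const.mul hD).intervalIntegrable a b).add (hFi a b)).neg
  have hP' : ∀ t, P t = P 0 + ∫ s in (0 : ℝ)..t, -(ν ^ 2 * D s + F s) := fun t => by
    rw [intervalIntegral.integral_neg]
    simp [hP]
  have hPc : Continuous P := by
    have : P = fun t => ∫ s in (0 : ℝ)..t, -(ν ^ 2 * D s + F s) := by
      ext t
      rw [intervalIntegral.integral_neg]
    rw [this]
    exact intervalIntegral.continuous_primitive hsrc 0
  have hD0 : D 0 = 0 := by rw [hDA 0 le_rfl, intervalIntegral.integral_same]
  filter_upwards [hAD] with t ht htm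
  have hsub : ∀ s ∈ uIcc 0 t, 0 ≤ s := fun s hs => by
    rw [uIcc_of_le htm.1.le] at hs; exact hs.1
  have hDt : ∀ s ∈ uIcc 0 t, D s = D 0 + ∫ τ in (0 : ℝ)..s, A τ := fun s hs => by
    rw [hD0, zero_add, hDA s (hsub s hs)]
  have hAP : ∀ᵐ s, s ∈ uIoc 0 t → A s = P s := by
    filter_upwards [hAD] with s hs hsm
    rw [uIoc_of_le htm.1.le] at hsm
    exact hs ⟨hsm.1, hsm.2.trans_lt htm.2⟩
  have k1 := integral_mul_add_mul_of_primitive (hAi 0 t) (hAi 0 t) hDt hDt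
  have k2 := integral_mul_add_mul_of_primitive (hsrc 0 t) (hsrc 0 t) (fun s _ => hP' s)
    (fun s _ => hP' s)
  have hP0 : P 0 = 0 := by simp [hP]
  rw [hD0, mul_zero, sub_zero] at k1
  rw [hP0, mul_zero, sub_zero] at k2
  have hbd : ∀ {u v : ℝ → ℝ}, Continuous u → (∀ a b, IntervalIntegrable v volume a b) →
      IntervalIntegrable (fun s => u s * v s) volume 0 t := fun hu hv =>
    (hv 0 t).continuousOn_mul hu.continuousOn
  have i1 : IntervalIntegrable (fun s => A s * D s + D s * A s) volume 0 t :=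
    ((hAi 0 t).mul_continuousOn hD.continuousOn).add (hbd hD hAi)
  have i2 : IntervalIntegrable (fun s => -(ν ^ 2 * D s + F s) * P s +
      P s * -(ν ^ 2 * D s + F s)) volume 0 t :=
    ((hsrc 0 t).mul_continuousOn hPc.continuousOn).add (hbd hPc hsrc)
  -- `P` is the continuous version of `A`. As `P' = -(ν² D + F)` and `D' = A`, the terms with `ν²`
  -- cancel in the derivative of `P² + ν² D²`, leaving `-2AF ≤ A² + F²`.
  have hkey : P t * P t + ν ^ 2 * (D t * D t) = ∫ s in (0 : ℝ)..t,
      ((-(ν ^ 2 * D s + F s) * P s + P s * -(ν ^ 2 * D s + F s)) +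
        ν ^ 2 * (A s * D s + D s * A s)) := by
    rw [intervalIntegral.integral_add i2 (i1.const_mul _), intervalIntegral.integral_const_mul,
      k1, k2]
  have isq : ∀ {u : ℝ → ℝ}, Measurable u → (∀ s, |u s| ≤ C) →
      IntervalIntegrable (fun s => u s ^ 2) volume 0 t := fun hu hub =>
    intervalIntegrable_of_bounded (C := C ^ 2) (hu.pow_const 2) (fun s => by
      rw [abs_pow]; exact pow_le_pow_left₀ (abs_nonneg _) (hub s) 2) 0 t
  have hle : P t * P t + ν ^ 2 * (D t * D t) ≤ ∫ s in (0 : ℝ)..t, (A s ^ 2 + F s ^ 2) := by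
    rw [hkey]
    refine intervalIntegral_mono_ae htm.1.le (i2.add (i1.const_mul _))
      ((isq hA hAb).add (isq hF hFb)) ?_
    filter_upwards [hAP] with s hs hsm
    rw [← hs (by rwa [uIoc_of_le htm.1.le])]
    nlinarith [sq_nonneg (A s + F s)]
  have hA2 : A t = P t := ht htm
  rw [hA2]
  nlinarith [mul_nonneg (sq_nonneg ν) (mul_self_nonneg (D t))]

/-- Gronwall's inequality for a bounded function controlled by its integral. -/
theorem ae_eq_zero_of_le_integral {N : ℝ → ℝ} {B K T : ℝ} (hN : Measurable N) (h0 : ∀ t, 0 ≤ N t)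
    (hB : ∀ t, N t ≤ B) (hK : 0 ≤ K)
    (h : ∀ᵐ t, t ∈ Ioo 0 T → N t ≤ K * ∫ s in (0 : ℝ)..t, N s) :
    ∀ᵐ t, t ∈ Ioo 0 T → N t = 0 := by
  have hNi : ∀ a b, IntervalIntegrable N volume a b :=
    intervalIntegrable_of_bounded hN fun t => by rw [abs_of_nonneg (h0 t)]; exact hB t
  set u : ℝ → ℝ := fun t => ∫ s in (0 : ℝ)..t, N s with hu
  have huc : Continuous u := intervalIntegral.continuous_primitive hNi 0
  -- `N` is only measurable and bounded, so its primitive `u` is merely continuous. One further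
  -- integration gives a differentiable `U` with `0 ≤ U' = u ≤ K U` and `U 0 = 0`.
  set U : ℝ → ℝ := fun t => ∫ s in (0 : ℝ)..t, u s with hU
  have hUd : ∀ t, HasDerivAt U (u t) t := fun t => huc.integral_hasStrictDerivAt 0 t |>.hasDerivAt
  have hle : ∀ t ∈ Icc 0 T, u t ≤ K * U t := by
    intro t ht
    simp only [hu, hU]
    rw [← intervalIntegral.integral_const_mul]
    refine intervalIntegral_mono_ae ht.1 (hNi 0 t) ((huc.intervalIntegrable _ _).const_mul K) ?_
    have hT : ∀ᵐ s : ℝ, s ≠ T := by simp [ae_iff, measure_singleton]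
    filter_upwards [h, hT] with s hs hsT hsm
    exact hs ⟨hsm.1, lt_of_le_of_ne (hsm.2.trans ht.2) hsT⟩
  have hu0 : ∀ t, 0 ≤ t → 0 ≤ u t := fun t ht =>
    intervalIntegral.integral_nonneg ht fun s _ => h0 s
  have hU0 : ∀ t, 0 ≤ t → 0 ≤ U t := fun t ht =>
    intervalIntegral.integral_nonneg ht fun s hs => hu0 s hs.1
  have hUz : ∀ t ∈ Icc 0 T, U t = 0 :=
    eq_zero_of_abs_deriv_le_mul_abs_self_of_eq_zero_right
      (fun t _ => (hUd t).continuousAt.continuousWithinAt) (fun t _ => (hUd t).hasDerivWithinAt)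
      intervalIntegral.integral_same (K := K) fun t ht => by
        rw [Real.norm_of_nonneg (hu0 t ht.1), Real.norm_of_nonneg (hU0 t ht.1)]
        exact hle t (Ico_subset_Icc_self ht)
  filter_upwards [h] with t ht htm
  have h1 := hle t (Ioo_subset_Icc_self htm)
  rw [hUz t (Ioo_subset_Icc_self htm), mul_zero] at h1
  have h2 := ht htm
  have h3 := mul_le_mul_of_nonneg_left h1 hK
  rw [mul_zero] at h3
  exact le_antisymm (h2.trans h3) (h0 t)

namespace IsNullSolution

variable {w wt wx f : ℝ × ℝ → ℝ} {C : ℝ}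

/-- `weak_coeff_space` is this identity tested against every `θ` supported in `(0,∞)`; the
fundamental lemma of the calculus of variations removes `θ`. -/
theorem ae_cosCoeff_eq (h : IsNullSolution w wt wx f C) (n : ℤ) :
    ∀ᵐ t : ℝ, t ∈ Ioi 0 → (∫ x in Ioo (0 : ℝ) 1, wx (t, x) * Real.cos (n * Real.pi * x)) =
      n * Real.pi * sineCoeff w n t := by
  set B : ℝ → ℝ := fun t => ∫ x in Ioo (0 : ℝ) 1, wx (t, x) * Real.cos (n * Real.pi * x) with hBdef
  have hBm : Measurable B := measurable_integral_Ioo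
    (F := fun q => wx q * Real.cos (n * Real.pi * q.2)) (h.measurable_space.mul (by fun_prop))
  have hBb : ∀ t, |B t| ≤ C := fun t => abs_setIntegral_Ioo_le fun x => by
    rw [abs_mul]
    exact (mul_le_of_le_one_right (abs_nonneg _) (Real.abs_cos_le_one _)).trans
      (h.abs_space_le (t, x))
  have hBl : LocallyIntegrable B := (memLp_top_of_bound hBm.aestronglyMeasurable C
    (Eventually.of_forall hBb)).locallyIntegrable le_top
  have hDc : Continuous fun t => n * Real.pi * sineCoeff w n t :=
    continuous_const.mul (continuous_sineCoeff h.continuous n)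
  have key := IsOpen.ae_eq_zero_of_integral_contDiff_smul_eq_zero
    (f := fun t => B t - n * Real.pi * sineCoeff w n t) (μ := volume) (isOpen_Ioi (a := (0 : ℝ)))
    ((hBl.sub hDc.locallyIntegrable).locallyIntegrableOn _) fun θ h1 h2 h3 => by
      have hz : ∀ t, t ∉ Ioi (0 : ℝ) → θ t • (B t - n * Real.pi * sineCoeff w n t) = 0 :=
        fun t ht => by
          rw [image_eq_zero_of_notMem_tsupport fun h' => ht (h3 h'), zero_smul]
      have hθi := h1.continuous.integrable_of_hasCompactSupport (μ := volume) h2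
      rw [← setIntegral_eq_integral_of_forall_compl_eq_zero hz]
      have e : ∀ t, θ t • (B t - n * Real.pi * sineCoeff w n t) =
          B t * θ t - n * Real.pi * sineCoeff w n t * θ t := fun t => by
        rw [smul_eq_mul]; ring
      simp only [e]
      rw [integral_sub, h.weak_coeff_space n h1 h2 h3, sub_self]
      · exact (hθi.bdd_mul hBm.aestronglyMeasurable (Eventually.of_forall hBb)).restrict
      · exact ((hDc.mul h1.continuous).integrable_of_hasCompactSupport h2.mul_left).restrict
  filter_upwards [key] with t ht htm
  exact sub_eq_zero.1 (ht htm)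

/-- The weak equation for a mode and `ae_cosCoeff_eq` combine to a forced oscillator of frequency
`nπ` starting at rest. The frequency does not appear in the bound, so the estimates can be summed
over `n`. -/
theorem ae_sq_sineCoeff_le (h : IsNullSolution w wt wx f C) (n : ℤ) {T : ℝ} (hT : 0 < T) :
    ∀ᵐ t, t ∈ Ioo 0 T → sineCoeff wt n t ^ 2 ≤
      ∫ s in (0 : ℝ)..t, (sineCoeff wt n s ^ 2 + sineCoeff f n s ^ 2) := by
  have hC : 0 ≤ C := (abs_nonneg _).trans (h.abs_time_le 0)
  set B : ℝ → ℝ := fun t => ∫ x in Ioo (0 : ℝ) 1, wx (t, x) * Real.cos (n * Real.pi * x) with hBdef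
  have hBm : Measurable B := measurable_integral_Ioo
    (F := fun q => wx q * Real.cos (n * Real.pi * q.2)) (h.measurable_space.mul (by fun_prop))
  have hBb : ∀ t, |B t| ≤ C := fun t => abs_setIntegral_Ioo_le fun x => by
    rw [abs_mul]
    exact (mul_le_of_le_one_right (abs_nonneg _) (Real.abs_cos_le_one _)).trans
      (h.abs_space_le (t, x))
  have hfm := measurable_sineCoeff h.measurable_source n
  have hfb := abs_sineCoeff_le h.abs_source_le n
  have htm := measurable_sineCoeff h.measurable_time n
  have htb := abs_sineCoeff_le h.abs_time_le n
  have hEb : ∀ t, |n * Real.pi * B t + sineCoeff f n t| ≤ |n * Real.pi| * C + C := fun t => by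
    refine (abs_add_le _ _).trans (add_le_add ?_ (hfb t))
    rw [abs_mul]
    exact mul_le_mul_of_nonneg_left (hBb t) (abs_nonneg _)
  have hle : C ≤ |n * Real.pi| * C + C := by
    have := mul_nonneg (abs_nonneg ((n : ℝ) * Real.pi)) hC
    linarith
  have hA := ae_eq_neg_integral_of_weak htm (fun t => (htb t).trans hle)
    ((hBm.const_mul (n * Real.pi)).add hfm) hEb (fun θ h1 h2 => h.weak_coeff_equation n h1 h2) hT
  refine ae_sq_le_of_oscillator (ν := n * Real.pi) htm htb hfm hfb
    (continuous_sineCoeff h.continuous n) (fun t ht => h.sineCoeff_eq_integral n ht) ?_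
  filter_upwards [hA] with t ht hti
  rw [ht hti]
  congr 1
  refine intervalIntegral.integral_congr_ae ?_
  filter_upwards [h.ae_cosCoeff_eq n] with s hs hsm
  rw [uIoc_of_le hti.1.le] at hsm
  simp only [Pi.add_apply]
  rw [show B s = n * Real.pi * sineCoeff w n s from hs hsm.1]
  ring

/-- The kinetic energy of a null solution, and the size of the source term. -/
theorem hasSum_sq_sineCoeff_of_bounded {F : ℝ × ℝ → ℝ} (hF : Measurable F)
    (hFb : ∀ q, |F q| ≤ C) (t : ℝ) :
    HasSum (fun n => sineCoeff F n t ^ 2) (∫ x in Ioo (0 : ℝ) 1, F (t, x) ^ 2) :=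
  hasSum_sq_sineCoeff (hF.comp measurable_prodMk_left) (C := C) fun x _ => hFb (t, x)

/-- Any finite sum of the mode estimates is bounded, through Parseval, by the time integral of `N +
L`, and `L ≤ K² N` almost everywhere by the bound on the source. Taking the supremum over finite
sets avoids exchanging an infinite sum with the integral, and Gronwall's inequality concludes. -/
theorem ae_time_eq_zero (h : IsNullSolution w wt wx f C) {K : ℝ}
    (hK : ∀ᵐ q ∂stripMeasure, |f q| ≤ K * |wt q|) {T : ℝ} (hT : 0 < T) :
    ∀ᵐ t, t ∈ Ioo 0 T → ∫ x in Ioo (0 : ℝ) 1, wt (t, x) ^ 2 = 0 := by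
  set N : ℝ → ℝ := fun t => ∫ x in Ioo (0 : ℝ) 1, wt (t, x) ^ 2 with hN
  set L : ℝ → ℝ := fun t => ∫ x in Ioo (0 : ℝ) 1, f (t, x) ^ 2 with hL
  have hNm : Measurable N := measurable_integral_Ioo (h.measurable_time.pow_const 2)
  have hLm : Measurable L := measurable_integral_Ioo (h.measurable_source.pow_const 2)
  have hsq : ∀ {F : ℝ × ℝ → ℝ}, (∀ q, |F q| ≤ C) → ∀ q, |F q ^ 2| ≤ C ^ 2 := fun hF q => by
    rw [abs_pow]; exact pow_le_pow_left₀ (abs_nonneg _) (hF q) 2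
  have hNb : ∀ t, |N t| ≤ C ^ 2 := fun t =>
    abs_setIntegral_Ioo_le fun x => hsq h.abs_time_le (t, x)
  have hLb : ∀ t, |L t| ≤ C ^ 2 := fun t =>
    abs_setIntegral_Ioo_le fun x => hsq h.abs_source_le (t, x)
  have hNi := intervalIntegrable_of_bounded hNm hNb
  have hLi := intervalIntegrable_of_bounded hLm hLb
  have hLN : ∀ᵐ t : ℝ, t ∈ Ioi 0 → L t ≤ K ^ 2 * N t := by
    rw [stripMeasure_eq_prod] at hK
    have h1 := Measure.ae_ae_of_ae_prod hK
    rw [ae_restrict_iff' measurableSet_Ioi] at h1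
    filter_upwards [h1] with t ht htm
    simp only [hL, hN]
    rw [← integral_const_mul]
    have hi : ∀ {F : ℝ × ℝ → ℝ}, Measurable F → (∀ q, |F q| ≤ C) →
        IntegrableOn (fun x => F (t, x) ^ 2) (Ioo 0 1) := fun hF hFb =>
      Measure.integrableOn_of_bounded (M := C ^ 2) (by simp)
        ((hF.comp measurable_prodMk_left).pow_const 2).aestronglyMeasurable
        (Eventually.of_forall fun x => hsq hFb (t, x))
    refine integral_mono_ae (hi h.measurable_source h.abs_source_le)
      ((hi h.measurable_time h.abs_time_le).const_mul _) ?_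
    filter_upwards [ht htm] with x hx
    have := pow_le_pow_left₀ (abs_nonneg _) hx 2
    rwa [mul_pow, sq_abs, sq_abs] at this
  have hsqb : ∀ {F : ℝ × ℝ → ℝ}, Measurable F → (∀ q, |F q| ≤ C) → ∀ (n : ℤ) (a b : ℝ),
      IntervalIntegrable (fun s => sineCoeff F n s ^ 2) volume a b := fun hF hFb n a b =>
    intervalIntegrable_of_bounded (C := C ^ 2) ((measurable_sineCoeff hF n).pow_const 2)
      (fun s => by
        rw [abs_pow]; exact pow_le_pow_left₀ (abs_nonneg _) (abs_sineCoeff_le hFb n s) 2) a b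
  refine ae_eq_zero_of_le_integral (K := 1 + K ^ 2) hNm
    (fun t => integral_nonneg fun x => sq_nonneg _) (fun t => (le_abs_self _).trans (hNb t))
    (by positivity) ?_
  filter_upwards [ae_all_iff.2 fun n => h.ae_sq_sineCoeff_le n hT] with t ht htm
  refine hasSum_le_of_sum_le (hasSum_sq_sineCoeff_of_bounded h.measurable_time h.abs_time_le t)
    fun S => ?_
  have hterm : ∀ n ∈ S, IntervalIntegrable
      (fun s => sineCoeff wt n s ^ 2 + sineCoeff f n s ^ 2) volume 0 t := fun n _ =>
    (hsqb h.measurable_time h.abs_time_le n 0 t).add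
      (hsqb h.measurable_source h.abs_source_le n 0 t)
  calc ∑ n ∈ S, sineCoeff wt n t ^ 2
      ≤ ∑ n ∈ S, ∫ s in (0 : ℝ)..t, (sineCoeff wt n s ^ 2 + sineCoeff f n s ^ 2) :=
        Finset.sum_le_sum fun n _ => ht n htm
    _ = ∫ s in (0 : ℝ)..t, ∑ n ∈ S, (sineCoeff wt n s ^ 2 + sineCoeff f n s ^ 2) :=
        (intervalIntegral.integral_finsetSum hterm).symm
    _ ≤ ∫ s in (0 : ℝ)..t, (1 + K ^ 2) * N s := by
        refine intervalIntegral_mono_ae htm.1.le (by simpa only [Finset.sum_fn] using IntervalIntegrable.sum S hterm)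
          ((hNi 0 t).const_mul _) ?_
        filter_upwards [hLN] with s hs hsm
        rw [Finset.sum_add_distrib]
        have h1 := sum_le_hasSum S (fun n _ => sq_nonneg _)
          (hasSum_sq_sineCoeff_of_bounded h.measurable_time h.abs_time_le s)
        have h2 := sum_le_hasSum S (fun n _ => sq_nonneg _)
          (hasSum_sq_sineCoeff_of_bounded h.measurable_source h.abs_source_le s)
        have h3 := hs hsm.1
        simp only [hL, hN] at h3 ⊢
        linarith
    _ = _ := by rw [intervalIntegral.integral_const_mul]

/-- A null solution whose source is controlled by its velocity vanishes. -/
theorem eqOn_zero (h : IsNullSolution w wt wx f C) {K : ℝ}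
    (hK : ∀ᵐ q ∂stripMeasure, |f q| ≤ K * |wt q|) : EqOn w 0 closedStrip := by
  rintro ⟨t, x⟩ ⟨ht, hx⟩
  have ht' : 0 ≤ t := ht
  have hvel := h.ae_time_eq_zero hK (T := t + 1) (by linarith)
  have hcoeff : ∀ n, sineCoeff w n t = 0 := by
    intro n
    rw [h.sineCoeff_eq_integral n ht']
    refine intervalIntegral.integral_zero_ae ?_
    filter_upwards [hvel] with s hs hsm
    rw [uIoc_of_le ht'] at hsm
    have h1 := hasSum_sq_sineCoeff_of_bounded h.measurable_time h.abs_time_le s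
    rw [hs ⟨hsm.1, by linarith [hsm.2]⟩] at h1
    have h2 := (hasSum_zero_iff_of_nonneg fun n => sq_nonneg (sineCoeff wt n s)).1 h1
    exact pow_eq_zero_iff two_ne_zero |>.1 (congrFun h2 n)
  have hwc : Continuous fun x => w (t, x) := h.continuous.comp (by fun_prop)
  obtain ⟨B, hB⟩ := isCompact_Icc.exists_bound_of_continuousOn (s := Icc (0 : ℝ) 1)
    hwc.continuousOn
  have hsum := hasSum_sq_sineCoeff hwc.measurable (C := B) fun x hx =>
    hB x (Ioo_subset_Icc_self hx)
  have hz : ∀ n : ℤ, (∫ x in Ioo (0 : ℝ) 1, w (t, x) * Real.sin (n * Real.pi * x)) ^ 2 = 0 :=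
    fun n => by rw [show ∫ x in Ioo (0 : ℝ) 1, w (t, x) * Real.sin (n * Real.pi * x) = 0 from
      hcoeff n, zero_pow two_ne_zero]
  simp only [hz] at hsum
  have hint : ∫ x in Ioo (0 : ℝ) 1, w (t, x) ^ 2 = 0 := hsum.unique hasSum_zero
  have hae : (fun x => w (t, x) ^ 2) =ᵐ[volume.restrict (Icc 0 1)] fun _ => 0 := by
    rw [← restrict_Ioo_eq_restrict_Icc]
    exact (setIntegral_eq_zero_iff_of_nonneg_ae (Eventually.of_forall fun x => sq_nonneg _)
      ((hwc.pow 2).integrableOn_Icc.mono_set Ioo_subset_Icc_self)).1 hint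
  have := Measure.eqOn_Icc_of_ae_eq (μ := volume) zero_ne_one hae (hwc.pow 2).continuousOn
    continuousOn_const hx
  exact pow_eq_zero_iff two_ne_zero |>.1 this

end IsNullSolution

/-! ### Bounded Borel representatives -/

theorem ae_abs_le_of_memLp_top {α : Type*} [MeasurableSpace α] {μ : Measure α} {f : α → ℝ}
    (hf : MemLp f ⊤ μ) : ∀ᵐ x ∂μ, |f x| ≤ (eLpNorm f ⊤ μ).toReal := by
  rw [eLpNorm_exponent_top]
  filter_upwards [ae_le_eLpNormEssSup (f := f) (μ := μ)] with x hx
  have h1 : eLpNormEssSup f μ ≠ ⊤ := by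
    have := hf.2.ne
    rwa [eLpNorm_exponent_top] at this
  have := ENNReal.toReal_mono h1 hx
  rwa [toReal_enorm] at this

/-- Clamping a Borel version to `[l, C]` alters it only on a null set and makes the bounds hold at
every point. -/
theorem exists_measurable_bounded_version {α : Type*} [MeasurableSpace α] {μ : Measure α}
    {f : α → ℝ} (hf : AEMeasurable f μ) {l C : ℝ} (hlC : l ≤ C) (hC : ∀ᵐ x ∂μ, f x ∈ Icc l C) :
    ∃ f' : α → ℝ, Measurable f' ∧ (∀ x, f' x ∈ Icc l C) ∧ f =ᵐ[μ] f' := by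
  refine ⟨fun x => max l (min C (hf.mk f x)), measurable_const.max
    (measurable_const.min hf.measurable_mk), fun x => ⟨le_max_left _ _,
      max_le hlC (min_le_left _ _)⟩, ?_⟩
  filter_upwards [hf.ae_eq_mk, hC] with x h1 h2
  rw [← h1, min_eq_right h2.2, max_eq_right h2.1]

theorem exists_measurable_version_of_memLp_top {α : Type*} [MeasurableSpace α] {μ : Measure α}
    {f : α → ℝ} (hf : MemLp f ⊤ μ) :
    ∃ f' : α → ℝ, Measurable f' ∧ (∀ x, |f' x| ≤ (eLpNorm f ⊤ μ).toReal) ∧ f =ᵐ[μ] f' := by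
  obtain ⟨f', h1, h2, h3⟩ := exists_measurable_bounded_version hf.1.aemeasurable
    (neg_le_self ENNReal.toReal_nonneg) ((ae_abs_le_of_memLp_top hf).mono fun x hx => abs_le.1 hx)
  exact ⟨f', h1, fun x => abs_le.2 (h2 x), h3⟩

theorem exists_measurable_coefficient {a : ℝ → ℝ} {aSup : ℝ} (ha : AEMeasurable a spaceMeasure)
    (ha_bd : ∀ x ∈ Icc (0 : ℝ) 1, 0 ≤ a x ∧ a x ≤ aSup) :
    ∃ b : ℝ → ℝ, Measurable b ∧ (∀ x, b x ∈ Icc 0 aSup) ∧ a =ᵐ[spaceMeasure] b := by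
  have h0 := ha_bd 0 (by simp)
  refine exists_measurable_bounded_version ha (h0.1.trans h0.2) ?_
  exact (ae_restrict_iff' measurableSet_Ioo).2
    (Eventually.of_forall fun x hx => ha_bd x (Ioo_subset_Icc_self hx))

theorem ae_strip_of_ae_space {p : ℝ → Prop} (h : ∀ᵐ x ∂spaceMeasure, p x) :
    ∀ᵐ q ∂stripMeasure, p q.2 := by
  rw [stripMeasure_eq_prod]
  exact Measure.quasiMeasurePreserving_snd.ae h

/-! ### Uniqueness -/

theorem IsDamping.exists_lipschitz {σ : ℝ → ℝ} (hσ : IsDamping σ) (R : ℝ) :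
    ∃ K : ℝ, 0 ≤ K ∧ ∀ s t, |s| ≤ R → |t| ≤ R → |σ s - σ t| ≤ K * |s - t| := by
  obtain ⟨K, hK⟩ := (hσ.locallyLipschitz.locallyLipschitzOn
    (s := Icc (-R) R)).exists_lipschitzOnWith_of_compact isCompact_Icc
  exact ⟨K, K.2, fun s t hs ht => hK.dist_le_mul s (abs_le.1 hs) t (abs_le.1 ht)⟩

theorem HasWeakDeriv.congr_ae {Ω : Set (ℝ × ℝ)} {e : ℝ × ℝ} {u u' g g' : ℝ × ℝ → ℝ}
    (h : HasWeakDeriv Ω e u g) (hu : u =ᵐ[volume.restrict Ω] u')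
    (hg : g =ᵐ[volume.restrict Ω] g') : HasWeakDeriv Ω e u' g' := by
  intro φ h1 h2 h3
  have := h φ h1 h2 h3
  have e1 : ∫ x in Ω, u x * fderiv ℝ φ x e = ∫ x in Ω, u' x * fderiv ℝ φ x e :=
    integral_congr_ae (by filter_upwards [hu] with x hx; rw [hx])
  have e2 : ∫ x in Ω, g x * φ x = ∫ x in Ω, g' x * φ x :=
    integral_congr_ae (by filter_upwards [hg] with x hx; rw [hx])
  rwa [e1, e2] at this

theorem integrable_memLp_mul {f ψ : ℝ × ℝ → ℝ} (hf : MemLp f ⊤ stripMeasure)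
    (hψ : Continuous ψ) (hc : HasCompactSupport ψ) :
    Integrable (fun q => f q * ψ q) stripMeasure :=
  integrable_mul_compactSupport hf.1 (ae_abs_le_of_memLp_top hf) hψ hc

theorem HasWeakDeriv.sub {e : ℝ × ℝ} {u v g h : ℝ × ℝ → ℝ} (hu : HasWeakDeriv strip e u g)
    (hv : HasWeakDeriv strip e v h) (mu : MemLp u ⊤ stripMeasure) (mv : MemLp v ⊤ stripMeasure)
    (mg : MemLp g ⊤ stripMeasure) (mh : MemLp h ⊤ stripMeasure) :
    HasWeakDeriv strip e (fun q => u q - v q) (fun q => g q - h q) := by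
  intro φ h1 h2 h3
  have hd := (contDiff_fderiv_apply h1 e).continuous
  have hdc := hasCompactSupport_fderiv_apply h2 e
  have e1 := hu φ h1 h2 h3
  have e2 := hv φ h1 h2 h3
  simp only [sub_mul]
  have i1 := integral_sub (integrable_memLp_mul mu hd hdc) (integrable_memLp_mul mv hd hdc)
  have i2 := integral_sub (integrable_memLp_mul mg h1.continuous h2)
    (integrable_memLp_mul mh h1.continuous h2)
  simp only [stripMeasure] at i1 i2
  rw [i1, i2, e1, e2]
  ring

/-- The difference of two solutions is a null solution with source `σ(b y_t) - σ(b z_t)`. Both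
arguments stay in a bounded interval, on which `σ` has a Lipschitz constant `K`; so the source is at
most `K * aSup` times the velocity difference, and `IsNullSolution.eqOn_zero` applies. -/
theorem IsSolution.eqOn {σ a z₀ z₁ : ℝ → ℝ} {aSup : ℝ} {y z : ℝ × ℝ → ℝ} (hσ : IsDamping σ)
    (ha : AEMeasurable a spaceMeasure) (ha_bd : ∀ x ∈ Icc (0 : ℝ) 1, 0 ≤ a x ∧ a x ≤ aSup)
    (hy : IsSolution σ a z₀ z₁ y) (hz : IsSolution σ a z₀ z₁ z) : EqOn y z closedStrip := by
  obtain ⟨b, hbm, hb, hab⟩ := exists_measurable_coefficient ha ha_bd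
  have haS : 0 ≤ aSup := (hb 0).1.trans (hb 0).2
  obtain ⟨yt, yx, myt, myx, wyt, wyx, eqy⟩ := hy.weak
  obtain ⟨zt, zx, mzt, mzx, wzt, wzx, eqz⟩ := hz.weak
  obtain ⟨yt', yt1, yt2, yt3⟩ := exists_measurable_version_of_memLp_top myt
  obtain ⟨zt', zt1, zt2, zt3⟩ := exists_measurable_version_of_memLp_top mzt
  obtain ⟨yx', yx1, yx2, yx3⟩ := exists_measurable_version_of_memLp_top myx
  obtain ⟨zx', zx1, zx2, zx3⟩ := exists_measurable_version_of_memLp_top mzx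
  set Cyt := (eLpNorm yt ⊤ stripMeasure).toReal
  set Czt := (eLpNorm zt ⊤ stripMeasure).toReal
  set Cyx := (eLpNorm yx ⊤ stripMeasure).toReal
  set Czx := (eLpNorm zx ⊤ stripMeasure).toReal
  have hCyt : 0 ≤ Cyt := ENNReal.toReal_nonneg
  have hCzt : 0 ≤ Czt := ENNReal.toReal_nonneg
  have hCyx : 0 ≤ Cyx := ENNReal.toReal_nonneg
  have hCzx : 0 ≤ Czx := ENNReal.toReal_nonneg
  obtain ⟨K, hK0, hK⟩ := hσ.exists_lipschitz (aSup * (Cyt + Czt))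
  have hσc : Continuous σ := hσ.locallyLipschitz.continuous
  have hbv : ∀ x s : ℝ, |s| ≤ Cyt + Czt → |b x * s| ≤ aSup * (Cyt + Czt) := fun x s hs => by
    rw [abs_mul, abs_of_nonneg (hb x).1]
    exact mul_le_mul (hb x).2 hs (abs_nonneg _) haS
  have hyt' : ∀ q, |yt' q| ≤ Cyt + Czt := fun q => (yt2 q).trans (by linarith)
  have hzt' : ∀ q, |zt' q| ≤ Cyt + Czt := fun q => (zt2 q).trans (by linarith)
  set f : ℝ × ℝ → ℝ := fun q => σ (b q.2 * yt' q) - σ (b q.2 * zt' q) with hf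
  have hfle : ∀ q, |f q| ≤ K * aSup * |yt' q - zt' q| := fun q => by
    refine (hK _ _ (hbv _ _ (hyt' q)) (hbv _ _ (hzt' q))).trans ?_
    rw [← mul_sub, abs_mul, abs_of_nonneg (hb q.2).1, ← mul_assoc]
    exact mul_le_mul_of_nonneg_right (mul_le_mul_of_nonneg_left (hb q.2).2 hK0) (abs_nonneg _)
  have hym : Measurable fun q : ℝ × ℝ => σ (b q.2 * yt' q) :=
    hσc.measurable.comp ((hbm.comp measurable_snd).mul yt1)
  have hzm : Measurable fun q : ℝ × ℝ => σ (b q.2 * zt' q) :=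
    hσc.measurable.comp ((hbm.comp measurable_snd).mul zt1)
  have hσb : ∀ s, |s| ≤ aSup * (Cyt + Czt) → |σ s| ≤ K * (aSup * (Cyt + Czt)) := fun s hs => by
    have := hK s 0 hs (by rw [abs_zero]; positivity)
    rw [hσ.map_zero, sub_zero, sub_zero] at this
    exact this.trans (mul_le_mul_of_nonneg_left hs hK0)
  -- A retraction of the plane onto the closed strip, which extends `y - z` to a function continuous
  -- on the whole plane.
  set p : ℝ × ℝ → ℝ × ℝ := fun q => (max q.1 0, max 0 (min q.2 1)) with hp
  have hpc : Continuous p := by fun_prop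
  have hpm : ∀ q, p q ∈ closedStrip := fun q =>
    ⟨mem_Ici.2 (le_max_right _ _),
      mem_Icc.2 ⟨le_max_left _ _, max_le zero_le_one (min_le_right _ _)⟩⟩
  have hpid : ∀ q ∈ closedStrip, p q = q := by
    rintro ⟨t, x⟩ ⟨ht, hx0, hx1⟩
    simp only [hp]
    rw [max_eq_left ht, min_eq_left hx1, max_eq_right hx0]
  set w : ℝ × ℝ → ℝ := fun q => y (p q) - z (p q) with hw
  have hwid : ∀ q ∈ closedStrip, w q = y q - z q := fun q hq => by simp only [hw, hpid q hq]
  have hwae : (fun q => y q - z q) =ᵐ[stripMeasure] w :=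
    (ae_restrict_iff' measurableSet_strip).2 (Eventually.of_forall fun q hq =>
      (hwid q (IsCharSolution.strip_subset_closedStrip hq)).symm)
  set Cy := (eLpNorm y ⊤ stripMeasure).toReal
  set Cz := (eLpNorm z ⊤ stripMeasure).toReal
  have hCy : 0 ≤ Cy := ENNReal.toReal_nonneg
  have hCz : 0 ≤ Cz := ENNReal.toReal_nonneg
  have hKS : 0 ≤ K * aSup * (Cyt + Czt) := by positivity
  have hns : IsNullSolution w (fun q => yt' q - zt' q) (fun q => yx' q - zx' q) f
      (Cy + Cz + Cyt + Czt + Cyx + Czx + K * aSup * (Cyt + Czt)) := by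
    refine ⟨(hy.continuousOn.comp_continuous hpc hpm).sub (hz.continuousOn.comp_continuous hpc hpm),
      ?_, ?_, ?_, ?_, yt1.sub zt1, yx1.sub zx1, hym.sub hzm, ?_, ?_, ?_, ?_, ?_, ?_⟩
    · filter_upwards [hwae, ae_abs_le_of_memLp_top hy.memLp, ae_abs_le_of_memLp_top hz.memLp]
        with q h1 h2 h3
      rw [← h1]
      exact (abs_sub _ _).trans (by linarith)
    · intro t ht
      rw [hwid (t, 0) ⟨mem_Ici.2 ht, by simp⟩, hy.left t ht, hz.left t ht, sub_zero]
    · intro t ht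
      rw [hwid (t, 1) ⟨mem_Ici.2 ht, by simp⟩, hy.right t ht, hz.right t ht, sub_zero]
    · intro x hx
      rw [hwid (0, x) ⟨self_mem_Ici, hx⟩, hy.initial x hx, hz.initial x hx, sub_self]
    · intro q
      exact (abs_sub _ _).trans (by linarith [yt2 q, zt2 q])
    · intro q
      exact (abs_sub _ _).trans (by linarith [yx2 q, zx2 q])
    · intro q
      have h1 : |yt' q - zt' q| ≤ Cyt + Czt :=
        (abs_sub _ _).trans (add_le_add (yt2 q) (zt2 q))
      have h2 := mul_le_mul_of_nonneg_left h1 (mul_nonneg hK0 haS)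
      linarith [hfle q]
    · refine (wyt.sub wzt hy.memLp hz.memLp myt mzt).congr_ae hwae ?_
      exact yt3.sub zt3
    · refine (wyx.sub wzx hy.memLp hz.memLp myx mzx).congr_ae hwae ?_
      exact yx3.sub zx3
    · intro φ h1 h2 h3
      have e1 := eqy φ h1 h2 h3
      have e2 := eqz φ h1 h2 h3
      have hab' := ae_strip_of_ae_space hab
      have d1 := (contDiff_fderiv_apply h1 (1, 0)).continuous
      have c1 := hasCompactSupport_fderiv_apply h2 (1, 0)
      have d2 := (contDiff_fderiv_apply h1 (0, 1)).continuous
      have c2 := hasCompactSupport_fderiv_apply h2 (0, 1)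
      have key : ∀ {vt' vx' : ℝ × ℝ → ℝ} {B B' : ℝ}, Measurable vt' → Measurable vx' →
          (∀ q, |vt' q| ≤ B) → (∀ q, |vx' q| ≤ B') → (∀ q, |vt' q| ≤ Cyt + Czt) →
          Measurable (fun q : ℝ × ℝ => σ (b q.2 * vt' q)) →
          Integrable (fun q => vt' q * fderiv ℝ φ q (1, 0) - vx' q * fderiv ℝ φ q (0, 1)
            - σ (b q.2 * vt' q) * φ q) stripMeasure := by
        intro vt' vx' B B' m1 m2 b1 b2 b3 m3
        exact ((integrable_mul_compactSupport m1.aestronglyMeasurable (Eventually.of_forall b1)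
          d1 c1).sub (integrable_mul_compactSupport m2.aestronglyMeasurable
            (Eventually.of_forall b2) d2 c2)).sub
          (integrable_mul_compactSupport m3.aestronglyMeasurable
            (Eventually.of_forall fun q => hσb _ (hbv _ _ (b3 q))) h1.continuous h2)
      have cong : ∀ {vt vx vt' vx' : ℝ × ℝ → ℝ}, vt =ᵐ[stripMeasure] vt' →
          vx =ᵐ[stripMeasure] vx' →
          ∫ q, (vt q * fderiv ℝ φ q (1, 0) - vx q * fderiv ℝ φ q (0, 1)
            - σ (a q.2 * vt q) * φ q) ∂stripMeasure =
          ∫ q, (vt' q * fderiv ℝ φ q (1, 0) - vx' q * fderiv ℝ φ q (0, 1)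
            - σ (b q.2 * vt' q) * φ q) ∂stripMeasure := by
        intro vt vx vt' vx' k1 k2
        refine integral_congr_ae ?_
        filter_upwards [k1, k2, hab'] with q l1 l2 l3
        rw [l1, l2, l3]
      rw [cong yt3 yx3] at e1
      rw [cong zt3 zx3] at e2
      have i1 := key yt1 yx1 yt2 yx2 hyt' hym
      have i2 := key zt1 zx1 zt2 zx2 hzt' hzm
      have i3 := integral_sub i1 i2
      refine Eq.trans (integral_congr_ae (Eventually.of_forall fun q => ?_))
        (i3.trans (by linarith))
      simp only [hf]
      ring
  intro q hq
  have h1 := hns.eqOn_zero (K := K * aSup) (Eventually.of_forall hfle) hq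
  rw [hwid q hq] at h1
  exact sub_eq_zero.1 h1

/-! ### Existence -/

/-- The even, 2-periodic extension of the identity of `[0,1]`. -/
noncomputable def fold (x : ℝ) : ℝ := Real.arccos (Real.cos (Real.pi * x)) / Real.pi

theorem measurable_fold : Measurable fold := by
  have : Continuous fold :=
    (Real.continuous_arccos.comp (Real.continuous_cos.comp (by fun_prop))).div_const _
  exact this.measurable

theorem fold_neg (x : ℝ) : fold (-x) = fold x := by
  rw [fold, mul_neg, Real.cos_neg, fold]

theorem fold_add_two (x : ℝ) : fold (x + 2) = fold x := by
  rw [fold, mul_add, mul_comm Real.pi 2, Real.cos_add_two_pi, fold]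

theorem fold_of_mem {x : ℝ} (hx : x ∈ Icc (0 : ℝ) 1) : fold x = x := by
  rw [fold, Real.arccos_cos (mul_nonneg Real.pi_pos.le hx.1)
    (mul_le_of_le_one_right Real.pi_pos.le hx.2), mul_div_cancel_left₀ _ Real.pi_ne_zero]

/-- The initial Riemann invariant on the line: the even extension of `u` plus the odd extension
of `v`. -/
noncomputable def initialInvariant (u v : ℝ → ℝ) (c : ℝ) : ℝ :=
  u (fold c) + if 0 < Real.sin (Real.pi * c) then v (fold c) else -v (fold c)

theorem measurable_initialInvariant {u v : ℝ → ℝ} (hu : Measurable u) (hv : Measurable v) :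
    Measurable (initialInvariant u v) := by
  have hvf := hv.comp measurable_fold
  exact (hu.comp measurable_fold).add (Measurable.ite
    (measurableSet_lt measurable_const (by fun_prop)) hvf hvf.neg)

theorem abs_initialInvariant_le {u v : ℝ → ℝ} {P Q : ℝ} (hu : ∀ x, |u x| ≤ P)
    (hv : ∀ x, |v x| ≤ Q) (c : ℝ) : |initialInvariant u v c| ≤ P + Q := by
  refine (abs_add_le _ _).trans (add_le_add (hu _) ?_)
  split_ifs
  · exact hv _
  · rw [abs_neg]; exact hv _

theorem initialInvariant_add_two (u v : ℝ → ℝ) (c : ℝ) :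
    initialInvariant u v (c + 2) = initialInvariant u v c := by
  rw [initialInvariant, fold_add_two, mul_add, mul_comm Real.pi 2, Real.sin_add_two_pi,
    initialInvariant]

theorem initialInvariant_of_mem (u v : ℝ → ℝ) {x : ℝ} (hx : x ∈ Ioo (0 : ℝ) 1) :
    initialInvariant u v x = u x + v x := by
  have : 0 < Real.sin (Real.pi * x) := Real.sin_pos_of_pos_of_lt_pi (mul_pos Real.pi_pos hx.1)
    (mul_lt_of_lt_one_right Real.pi_pos hx.2)
  rw [initialInvariant, if_pos this, fold_of_mem (Ioo_subset_Icc_self hx)]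

theorem initialInvariant_neg_of_mem (u v : ℝ → ℝ) {x : ℝ} (hx : x ∈ Ioo (0 : ℝ) 1) :
    initialInvariant u v (-x) = u x - v x := by
  have : 0 < Real.sin (Real.pi * x) := Real.sin_pos_of_pos_of_lt_pi (mul_pos Real.pi_pos hx.1)
    (mul_lt_of_lt_one_right Real.pi_pos hx.2)
  rw [initialInvariant, fold_neg, mul_neg, Real.sin_neg, if_neg (by linarith),
    fold_of_mem (Ioo_subset_Icc_self hx), sub_eq_add_neg]

theorem IsDamping.nonneg {σ : ℝ → ℝ} (hσ : IsDamping σ) {s : ℝ} (hs : 0 ≤ s) : 0 ≤ σ s := by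
  rcases hs.eq_or_lt with rfl | hs
  · rw [hσ.map_zero]
  · exact (pos_of_mul_pos_left (hσ.mul_self_pos s hs.ne') hs.le).le

theorem IsDamping.exists_isPeriodicDamping {σ b : ℝ → ℝ} {aSup : ℝ} (hσ : IsDamping σ)
    (hbm : Measurable b) (hb : ∀ x, b x ∈ Icc 0 aSup) (M : ℝ) :
    ∃ κ, 0 < κ ∧ IsPeriodicDamping (fun x s => σ (b (fold x) * s)) M κ := by
  obtain ⟨K, hK0, hK⟩ := hσ.exists_lipschitz (aSup * M)
  have haS : 0 ≤ aSup := (hb 0).1.trans (hb 0).2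
  have hbv : ∀ x s : ℝ, |s| ≤ M → |b x * s| ≤ aSup * M := fun x s hs => by
    rw [abs_mul, abs_of_nonneg (hb x).1]
    exact mul_le_mul (hb x).2 hs (abs_nonneg _) haS
  -- `K * aSup` is already a Lipschitz constant; the added `1` keeps `κ` positive when it vanishes.
  refine ⟨K * aSup + 1, by positivity, ?_, ?_, ?_, ?_, ?_, ?_⟩
  · exact hσ.locallyLipschitz.continuous.measurable.comp
      (((hbm.comp measurable_fold).comp measurable_fst).mul measurable_snd)
  · intro x v w hv hw
    refine (hK _ _ (hbv _ _ hv) (hbv _ _ hw)).trans ?_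
    rw [← mul_sub, abs_mul, abs_of_nonneg (hb _).1, ← mul_assoc]
    refine mul_le_mul_of_nonneg_right ?_ (abs_nonneg _)
    have := mul_le_mul_of_nonneg_left (hb (fold x)).2 hK0
    linarith
  · exact fun x v _ hv => hσ.nonneg (mul_nonneg (hb _).1 hv)
  · intro x v
    rw [mul_neg, hσ.odd]
  · intro x v
    rw [fold_neg]
  · intro x v
    rw [fold_add_two]

theorem MemW0.eq_integral {u u' : ℝ → ℝ} (h : MemW0 u u') {x : ℝ} (hx : x ∈ Icc (0 : ℝ) 1) :
    u x = ∫ s in (0 : ℝ)..x, u' s := by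
  have hi : IntegrableOn u' (Ioo 0 1) := by
    have : IsFiniteMeasure (volume.restrict (Ioo (0 : ℝ) 1)) := ⟨by simp⟩
    exact MemLp.integrable le_top h.memLp_deriv
  rw [h.hasWeakDeriv.eq_primitive zero_lt_one h.continuousOn hi x hx, h.left, zero_add]

/-- On `(0,1)` the initial invariant is `u + v` at `x` and `u - v` at `-x`, so half the sum and half
the difference return the initial slope and velocity. There `fold` is the identity, so the reflected
source agrees almost everywhere with `σ(a z_t)`. -/
theorem IsCharSolution.isSolution {σ a b z₀ z₀' z₁ u v : ℝ → ℝ} {M S : ℝ} {r G : ℝ → ℝ → ℝ}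
    (h : IsCharSolution (fun x s => σ (b (fold x) * s)) (initialInvariant u v) M S r G)
    (hab : a =ᵐ[spaceMeasure] b) (hz₀ : MemW0 z₀ z₀') (hu : z₀' =ᵐ[spaceMeasure] u)
    (hv : z₁ =ᵐ[spaceMeasure] v) : IsSolution σ a z₀ z₁ (displacement r) := by
  have hinit : ∀ x ∈ Icc (0 : ℝ) 1, displacement r (0, x) = z₀ x := by
    intro x hx
    rw [h.displacement_eq_integral_strain, hz₀.eq_integral hx]
    refine intervalIntegral.integral_congr_ae ?_
    have h1 : ∀ᵐ s : ℝ, s ≠ 1 := by simp [ae_iff, measure_singleton]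
    filter_upwards [(ae_restrict_iff' measurableSet_Ioo).1 hu, h1] with s hs hs1 hsm
    rw [uIoc_of_le hx.1] at hsm
    have hsI : s ∈ Ioo (0 : ℝ) 1 := ⟨hsm.1, lt_of_le_of_ne (hsm.2.trans hx.2) hs1⟩
    rw [hs hsI, strain, h.initial_eq, zero_add, zero_sub, initialInvariant_of_mem u v hsI,
      initialInvariant_neg_of_mem u v hsI]
    ring
  refine ⟨h.continuousOn_displacement, fun t _ => displacement_left t, fun t ht =>
    h.displacement_right ht ?_, hinit, memLp_top_of_bound h.aestronglyMeasurable_displacement M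
      h.ae_abs_displacement_le, velocity r, strain r,
    memLp_top_of_bound h.measurable_velocity.aestronglyMeasurable M
      (Eventually.of_forall h.abs_velocity_le),
    memLp_top_of_bound h.measurable_strain.aestronglyMeasurable M
      (Eventually.of_forall h.abs_strain_le), h.hasWeakDeriv_time, h.hasWeakDeriv_space, ?_⟩
  · rw [hinit 1 (by simp), hz₀.right]
  · intro φ h1 h2 h3
    refine Eq.trans ?_ (h.weak_equation h1 h2 h3)
    congr 1
    · refine integral_congr_ae ?_
      filter_upwards [ae_strip_of_ae_space hab, ae_restrict_mem measurableSet_strip] with q hq hqs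
      rw [h.source_eq q.1 hqs.1, add_sub_cancel_left, fold_of_mem (Ioo_subset_Icc_self hqs.2), ← hq,
        show 2 * q.1 - (q.1 + q.2) = q.1 - q.2 by ring]
      rfl
    · refine integral_congr_ae ?_
      filter_upwards [hv, ae_restrict_mem measurableSet_Ioo] with x hx hxm
      rw [hx, initialInvariant_of_mem u v hxm, initialInvariant_neg_of_mem u v hxm]
      ring

end DampedWave


/-! ### Well-posedness and the uniform bound -/

theorem theorem1 (σ : ℝ → ℝ) (hσ : DampedWave.IsDamping σ)
    (a : ℝ → ℝ) (aSup : ℝ) (ha : AEMeasurable a DampedWave.spaceMeasure)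
    (ha_bd : ∀ x ∈ Set.Icc (0 : ℝ) 1, 0 ≤ a x ∧ a x ≤ aSup)
    (z₀ z₀' z₁ : ℝ → ℝ) (hz₀ : DampedWave.MemW0 z₀ z₀')
    (hz₁ : MeasureTheory.MemLp z₁ ⊤ DampedWave.spaceMeasure) :
    ∃ z : ℝ × ℝ → ℝ,
      DampedWave.IsSolution σ a z₀ z₁ z ∧
      (∀ y : ℝ × ℝ → ℝ, DampedWave.IsSolution σ a z₀ z₁ y →
        Set.EqOn y z DampedWave.closedStrip) ∧
      ∀ t : ℝ, 0 ≤ t → ∃ zx zt : ℝ → ℝ,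
        (∀ᵐ x ∂DampedWave.spaceMeasure,
          HasDerivAt (fun y => z (t, y)) (zx x) x ∧
          HasDerivWithinAt (fun s => z (s, x)) (zt x) (Set.Ici 0) t) ∧
        MeasureTheory.eLpNorm (fun x => |zx x| + |zt x|) ⊤ DampedWave.spaceMeasure ≤
          2 * max (MeasureTheory.eLpNorm z₀' ⊤ DampedWave.spaceMeasure)
            (MeasureTheory.eLpNorm z₁ ⊤ DampedWave.spaceMeasure) := by
  open DampedWave in
  obtain ⟨b, hbm, hb, hab⟩ := exists_measurable_coefficient ha ha_bd
  obtain ⟨u, hum, hub, hu⟩ := exists_measurable_version_of_memLp_top hz₀.memLp_deriv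
  obtain ⟨v, hvm, hvb, hv⟩ := exists_measurable_version_of_memLp_top hz₁
  set P := (eLpNorm z₀' ⊤ spaceMeasure).toReal with hP
  set Q := (eLpNorm z₁ ⊤ spaceMeasure).toReal with hQ
  have hP0 : 0 ≤ P := ENNReal.toReal_nonneg
  have hQ0 : 0 ≤ Q := ENNReal.toReal_nonneg
  -- The initial invariant is bounded by `P + Q`, and this bound persists. The constant `2` in the
  -- conclusion is the estimate `P + Q ≤ 2 max(P, Q)`.
  obtain ⟨κ, hκ, hg⟩ := hσ.exists_isPeriodicDamping hbm hb (P + Q)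
  obtain ⟨r, G, h⟩ := exists_isCharSolution hg hκ (by positivity)
    (measurable_initialInvariant hum hvm) (abs_initialInvariant_le hub hvb)
    (initialInvariant_add_two u v)
  have hsol : IsSolution σ a z₀ z₁ (displacement r) := h.isSolution hab hz₀ hu hv
  refine ⟨displacement r, hsol, fun y hy => hy.eqOn hσ ha ha_bd hsol, fun t _ =>
    ⟨fun x => strain r (t, x), fun x => velocity r (t, x), ?_, ?_⟩⟩
  · refine ae_restrict_of_ae ?_
    filter_upwards [h.ae_hasDerivAt t] with x hx
    exact ⟨hx.1, hx.2.hasDerivWithinAt⟩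
  · rw [eLpNorm_exponent_top]
    refine (eLpNormEssSup_le_of_ae_bound (C := P + Q) (Eventually.of_forall fun x => ?_)).trans ?_
    · rw [Real.norm_of_nonneg (by positivity)]
      exact h.abs_strain_add_abs_velocity_le (t, x)
    · rw [ENNReal.ofReal_add hP0 hQ0, hP, hQ, ENNReal.ofReal_toReal hz₀.memLp_deriv.2.ne,
        ENNReal.ofReal_toReal hz₁.2.ne, two_mul]
      exact add_le_add (le_max_left _ _) (le_max_right _ _)
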